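/- \textbf{Combining spillovers.} Conventions: $[K]=\{0,\dots,K-1\}$. A data structure for inputs from a set $Z$ using space $[K]\times\{0,1\}^m$ is a map $D:Z\to[K]\times\{0,1\}^m$; the first component of $D(z)$ is called the spillover, the second the memory. It answers a query $f$ on $Z$ in time $c$ (cell-probe model with word size $w$) if there is an adaptive query algorithm which is given the spillover for free, makes at most $c$ probes to the memory, each probe returning $w$ consecutive memory bits starting at a position of its choice (bits beyond the end of the memory read as $0$), and which returns $f(z)$ on $D(z)$ for every $z\in Z$; computation is free. There are absolute constants $c$ and $n_0$ such that the following holds for all integers $n\ge n_0$. Let $w$ be an even perfect cube, $B=w^{1/3}$, let $l\ge w$ be an even integer with $Bl\le n$, and let $\sigma$ be an integer with $n\,2^{w/2}\le\sigma\le 2^w/n$. Let $\mathrm{SUM}:[2^w+\sigma]\to\{0,1,\dots,l\}$ be a function that decodes the sum of an array of length $l$ from a spillover, i.e. there is an injective map $E:\{0,1\}^l\to[2^w+\sigma]\times\{0,1\}^{l-w}$ such that, for every $A\in\{0,1\}^l$, $\mathrm{SUM}$ maps the first component of $E(A)$ to the number of ones in $A$. For $k_1,\dots,k_B\in[2^w+\sigma]$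 and $1\le i\le B$ put $T_i=\sum_{j\le i}\mathrm{SUM}(k_j)$. Then there is a data structure for the tuples $(k_1,\dots,k_B)\in[2^w+\sigma]^B$ using space $$[2^w+34B\sigma]\times\{0,1\}^{(B-1)w}$$ such that, for every $i=1,\dots,B$, the query $k_i$ and the query $T_i$ are each answered in time $c$ (with word size $w$), and such that the spillover alone determines $T_B$. -/

import Mathlib

namespace Spillover

/-- A query algorithm in the cell-probe model with word size `w`: an adaptive decision tree.
In each step it either answers, or names a position `p` of the memory, receives the `w`
consecutive memory bits starting there, and continues depending on them. Computation is free. -/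
inductive ProbeTree (w : ℕ) (α : Type) : Type
  | answer (a : α) : ProbeTree w α
  | probe (p : ℕ) (next : (Fin w → Bool) → ProbeTree w α) : ProbeTree w α

/-- The `w` consecutive bits of the memory `mem` that start at position `p`
(positions past the end of the memory read as `false`). -/
def window (w : ℕ) {m : ℕ} (mem : Fin m → Bool) (p : ℕ) : Fin w → Bool :=
  fun j => if h : p + (j : ℕ) < m then mem ⟨p + (j : ℕ), h⟩ else false

/-- The answer that a query algorithm returns on the memory `mem`. -/
def ProbeTree.eval {w : ℕ} {α : Type} {m : ℕ} (mem : Fin m → Bool) : ProbeTree w α → α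
  | .answer a => a
  | .probe p next => (next (window w mem p)).eval mem

/-- The running time of a query algorithm on the memory `mem`: the number of its probes. -/
def ProbeTree.time {w : ℕ} {α : Type} {m : ℕ} (mem : Fin m → Bool) : ProbeTree w α → ℕ
  | .answer _ => 0
  | .probe p next => (next (window w mem p)).time mem + 1

/-- A data structure for inputs from `Z` that uses space `[K] × {0,1}^m`: every input is
represented by a spillover in `[K] = {0, …, K - 1}` and `m` bits of memory. -/
abbrev DataStructure (Z : Type) (K m : ℕ) : Type := Z → Fin K × (Fin m → Bool)

/-- The query `f` is answered by the data structure `D` in time `c` with word size `w`: there is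
a query algorithm that is given the spillover for free, probes the memory at most `c` times in
the worst case, and returns `f z` on the representation of every input `z`. -/
def DataStructure.DecodesInTime {Z α : Type} {K m : ℕ} (D : DataStructure Z K m) (w c : ℕ)
    (f : Z → α) : Prop :=
  ∃ query : Fin K → ProbeTree w α,
    (∀ (k : Fin K) (mem : Fin m → Bool), (query k).time mem ≤ c) ∧
    ∀ z : Z, (query (D z).1).eval (D z).2 = f z

/-- The spillover of the data structure `D` alone determines `f`. -/
def DataStructure.SpilloverDetermines {Z α : Type} {K m : ℕ} (D : DataStructure Z K m)
    (f : Z → α) : Prop :=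
  ∃ g : Fin K → α, ∀ z : Z, g (D z).1 = f z

/-- `SUM` decodes the number of ones from the spillover of some representation of the bit arrays
of length `l` in space `[K] × {0,1}^(l - w)`: distinct arrays have distinct representations, and
`SUM` maps the spillover of the representation of an array to the number of ones in it. -/
def IsSumDecoder (w l K : ℕ) (SUM : Fin K → Fin (l + 1)) : Prop :=
  ∃ D : DataStructure (Fin l → Bool) K (l - w),
    Function.Injective D ∧
    ∀ A : Fin l → Bool, ((SUM (D A).1 : Fin (l + 1)) : ℕ) = (Finset.univ.filter (A · = true)).card

/-- The prefix sum of the values encoded by the spillovers with index at most `i`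
(`T_{i+1}` when, as here, the indices start at `0`). -/
def prefixSum {B K l : ℕ} (SUM : Fin K → Fin (l + 1)) (i : Fin B) (k : Fin B → Fin K) : ℕ :=
  ∑ j ∈ Finset.Iic i, (SUM (k j) : ℕ)

/-- The sum `T_B` of all the values encoded by a tuple of `B` spillovers. -/
def totalSum {B K l : ℕ} (SUM : Fin K → Fin (l + 1)) (k : Fin B → Fin K) : ℕ :=
  ∑ j, (SUM (k j) : ℕ)

end Spillover

/-! The tuple is stored through its prefix sums. A key amounts to two consecutive prefix sums `T'`,
`T` together with an index among the keys of value `T - T'`. The obstacle is that the number of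
these keys, about the binomial weight `2^w * C(l, T - T') / 2^l`, depends on both sums, so that
cells holding the sums and the indices would not have independent ranges.

The remedy is to bound this number tightly by a sum over few components `j` of products `A_j(T) *
G_j(T')`. The component and coarse blocks of the prefix sums are moved into a class shared by the
whole tuple; the index becomes a pair, one entry stored with `T` and one with `T'`. Within a class
the cells are independent. Summing the products of the cell sizes over all classes counts paths of
prefix sums, so the class costs nothing beyond the excess of the products over the weights
(`Chain.sum_prod_card_cell_le`, `Chain.exists_encoding`).

Such products exist because binomial coefficients are smooth near the centre. On a block much
shorter than `√l` the Newton series converges so fast that degree below `B` suffices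
(`abs_fwdDiff_iter_choose_le`), Vandermonde's identity separates the variables, and rounding the
factors to integers costs at most `2^(w/2)` per sum (`exists_products_of_newton`,
`exists_products_binWeight`). Blocks take `O(B^2)` bits each, so the class takes `O(B^3) = O(w)`
bits, that is `O(1)` words; this is where the cube root comes from.

Keys with an atypical value, or in excess of the expected number for their value, are bad; there are
at most `σ + l + 4` of them (`IsSumDecoder.exists_good`). They go into a second, wasteful chain. A
factor of order `l` is wasted for every bad key except the first one, and because `B * l * σ ≤ 2^w`
these factors contribute only a constant overall (`sum_weight_le`, `weight_numeric`).

Finally the cells of a class are packed into memory with relative loss `O(2^(-w))` per cell, each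
cell remaining readable in `O(1)` probes (`exists_packing`). The pairs of a class and a leftover
carry are enumerated in the order of the total sum; the spillover is the leading part of the
position plus the total itself, which makes it determine the total
(`exists_dataStructure_of_cells`). -/

namespace Spillover

/-! ### Combining query algorithms. -/

/-- Run one query algorithm and continue with another one that depends on its answer. -/
def ProbeTree.bind {w : ℕ} {α β : Type} : ProbeTree w α → (α → ProbeTree w β) → ProbeTree w β
  | .answer a, f => f a
  | .probe p next, f => .probe p (fun x => (next x).bind f)

theorem ProbeTree.eval_bind {w m : ℕ} {α β : Type} (mem : Fin m → Bool) (t : ProbeTree w α)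
    (f : α → ProbeTree w β) : (t.bind f).eval mem = (f (t.eval mem)).eval mem := by
  induction t with
  | answer a => rfl
  | probe p next ih => exact ih _

theorem ProbeTree.time_bind {w m : ℕ} {α β : Type} (mem : Fin m → Bool) (t : ProbeTree w α)
    (f : α → ProbeTree w β) :
    (t.bind f).time mem = t.time mem + (f (t.eval mem)).time mem := by
  induction t with
  | answer a => simp [ProbeTree.bind, ProbeTree.time, ProbeTree.eval]
  | probe p next ih =>
    simp only [ProbeTree.bind, ProbeTree.time, ProbeTree.eval, ih]
    omega

section Decodes

variable {Z : Type} {K m : ℕ} {D : DataStructure Z K m} {w c : ℕ}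

theorem DataStructure.decodesInTime_spillover (D : DataStructure Z K m) (w : ℕ) :
    D.DecodesInTime w 0 (fun z => (D z).1) :=
  ⟨fun k => .answer k, fun _ _ => le_rfl, fun _ => rfl⟩

theorem DataStructure.DecodesInTime.mono {α : Type} {f : Z → α} (h : D.DecodesInTime w c f)
    {c' : ℕ} (hc : c ≤ c') : D.DecodesInTime w c' f :=
  ⟨h.choose, fun k mem => (h.choose_spec.1 k mem).trans hc, h.choose_spec.2⟩

theorem DataStructure.DecodesInTime.map {α β : Type} {f : Z → α} (h : D.DecodesInTime w c f)
    {g : Z → β} (e : α → β) (hg : ∀ z, g z = e (f z)) : D.DecodesInTime w c g := by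
  obtain ⟨q, hq, hq'⟩ := h
  refine ⟨fun k => (q k).bind fun a => .answer (e a), fun k mem => ?_, fun z => ?_⟩
  · rw [ProbeTree.time_bind]; exact hq k mem
  · rw [ProbeTree.eval_bind, hq', hg]; rfl

theorem DataStructure.DecodesInTime.probe {α : Type} {f : Z → α} (h : D.DecodesInTime w c f)
    (p : α → ℕ) :
    D.DecodesInTime w (c + 1) (fun z => (f z, window w (D z).2 (p (f z)))) := by
  obtain ⟨q, hq, hq'⟩ := h
  refine ⟨fun k => (q k).bind fun a => .probe (p a) fun x => .answer (a, x),
    fun k mem => ?_, fun z => ?_⟩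
  · rw [ProbeTree.time_bind]; exact Nat.add_le_add_right (hq k mem) 1
  · rw [ProbeTree.eval_bind, hq']; rfl

/-- The bit at a position of the memory, `false` past its end. -/
def bitAt {m : ℕ} (mem : Fin m → Bool) (i : ℕ) : Bool := if h : i < m then mem ⟨i, h⟩ else false

theorem DataStructure.DecodesInTime.interval {α : Type} {f : Z → α}
    (h : D.DecodesInTime w c f) (p : α → ℕ) (q : ℕ) :
    D.DecodesInTime w (c + q)
      (fun z => (f z, fun j : Fin (q * w) => bitAt (D z).2 (p (f z) + j))) := by
  induction q with
  | zero => exact h.map (fun a => (a, fun j => absurd j.2 (by simp))) (fun z => by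
      congr 1; funext j; exact absurd j.2 (by simp))
  | succ q ih =>
    refine (ih.probe fun a => p a.1 + q * w).map (fun a => (a.1.1, fun j =>
      if h : (j : ℕ) < q * w then a.1.2 ⟨j, h⟩ else
        a.2 ⟨j - q * w, by have := j.2.trans_eq (Nat.succ_mul q w); omega⟩)) (fun z => ?_)
    congr 1
    funext j
    split_ifs with hj
    · rfl
    · have e : p (f z) + q * w + ((j : ℕ) - q * w) = p (f z) + j := by omega
      simp only [window, bitAt, e]

/-- Computation is free, so decoding reduces to an information-theoretic statement: a function
constant on the fibres of what has been read factors through it. All later decoding arguments only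
show that equal readings force equal answers. -/
theorem DataStructure.DecodesInTime.of_determined [Nonempty Z] {α β : Type} {f : Z → α}
    (h : D.DecodesInTime w c f) (p : α → ℕ) (q : ℕ) (g : Z → β)
    (hg : ∀ z z', f z = f z' → (∀ i, p (f z) ≤ i → i < p (f z) + q * w →
      bitAt (D z).2 i = bitAt (D z').2 i) → g z = g z') :
    D.DecodesInTime w (c + q) g := by
  have : Nonempty β := ‹Nonempty Z›.map g
  have hfac : Function.FactorsThrough g
      (fun z => (f z, fun j : Fin (q * w) => bitAt (D z).2 (p (f z) + j))) := by
    intro z z' e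
    simp only [Prod.mk.injEq] at e
    refine hg z z' e.1 fun i hi hi' => ?_
    have := congrFun e.2 ⟨i - p (f z), by omega⟩
    simpa [← e.1, Nat.add_sub_cancel' hi] using this
  obtain ⟨e, he⟩ := (Function.factorsThrough_iff g).1 hfac
  exact (h.interval p q).map e fun z => congrFun he z

end Decodes

/-! ### Packing cells into bits with negligible loss. -/

theorem exists_two_pow_between {R : ℕ} (hR : 1 ≤ R) : ∃ e, R ≤ 2 ^ e ∧ 2 ^ e ≤ 2 * R := by
  refine ⟨Nat.log 2 R + 1, (Nat.lt_pow_succ_log_self (by norm_num) R).le, ?_⟩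
  rw [pow_succ, mul_comm]
  exact Nat.mul_le_mul_left 2 (Nat.pow_log_le_self 2 (by omega))

theorem eq_of_testBit_eq_of_lt {x y b : ℕ} (hx : x < 2 ^ b) (hy : y < 2 ^ b)
    (h : ∀ i < b, x.testBit i = y.testBit i) : x = y := by
  refine Nat.eq_of_testBit_eq fun i => ?_
  by_cases hi : i < b
  · exact h i hi
  · have hb : 2 ^ b ≤ 2 ^ i := Nat.pow_le_pow_right (by norm_num) (not_lt.1 hi)
    rw [Nat.testBit_lt_two_pow (hx.trans_le hb), Nat.testBit_lt_two_pow (hy.trans_le hb)]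

/-- A splitting of `[G]` into pieces of size `A` such that `[R] × [A]` nearly fills `[2 ^ b]`. -/
theorem exists_split {w a q R G : ℕ} (hw : 1 ≤ w) (ha : 3 ≤ a) (hR : 1 ≤ R)
    (hR' : R ≤ 2 ^ ((a + q) * w)) (hG : 2 ^ (a * w) ≤ G) (hG' : G < 2 ^ ((a + q) * w)) :
    ∃ A b : ℕ, 1 ≤ A ∧ R * A ≤ 2 ^ b ∧ b ≤ (a + q + 2) * w ∧
      2 ^ ((a - 2) * w) ≤ G / A + 1 ∧ G / A + 1 ≤ 2 ^ ((a + q) * w) ∧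
      (((G / A + 1 : ℕ) : ℝ) * 2 ^ b ≤ R * G * (1 + 4 / 2 ^ w)) := by
  obtain ⟨e, he, he'⟩ := exists_two_pow_between hR
  have hw2 : 2 ≤ 2 ^ w := by
    calc 2 = 2 ^ 1 := rfl
      _ ≤ 2 ^ w := Nat.pow_le_pow_right (by norm_num) hw
  -- As `R ≤ 2^e ≤ 2R`, this `A` lies between `2^w` and `2^(w+1)`: large enough that rounding down
  -- loses a fraction at most `2^(-w)` of `2^(w+e)`, and small compared with `G`.
  set A := 2 ^ (w + e) / R with hA
  have hAR : R * A ≤ 2 ^ (w + e) := Nat.mul_div_le _ _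
  have hAl : 2 ^ w ≤ A := by
    rw [hA, Nat.le_div_iff_mul_le hR, pow_add]
    exact Nat.mul_le_mul_left _ he
  have hAu : A ≤ 2 ^ (w + 1) := by
    refine Nat.div_le_of_le_mul ?_
    calc 2 ^ (w + e) = 2 ^ w * 2 ^ e := pow_add _ _ _
      _ ≤ 2 ^ w * (2 * R) := Nat.mul_le_mul_left _ he'
      _ = R * 2 ^ (w + 1) := by ring
  have hlt : 2 ^ (w + e) < R * (A + 1) := by
    rw [hA]; exact Nat.lt_mul_div_succ _ hR
  have hApos : 1 ≤ A := le_trans Nat.one_le_two_pow hAl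
  have hG3 : 2 ^ (3 * w) ≤ G := le_trans (Nat.pow_le_pow_right (by norm_num) (by gcongr)) hG
  refine ⟨A, w + e, hApos, hAR, ?_, ?_, ?_, ?_⟩
  · have h1 : 2 ^ (w + e) ≤ 2 ^ (w + 1 + (a + q) * w) := by
      calc 2 ^ (w + e) = 2 ^ w * 2 ^ e := pow_add _ _ _
        _ ≤ 2 ^ w * (2 * 2 ^ ((a + q) * w)) := by gcongr; exact he'.trans (by gcongr)
        _ = _ := by ring
    have h2 := (Nat.pow_le_pow_iff_right (by norm_num : 1 < 2)).1 h1
    have : (a + q + 2) * w = (a + q) * w + w + w := by ring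
    omega
  · refine le_trans ?_ (Nat.le_succ _)
    rw [Nat.le_div_iff_mul_le hApos]
    calc 2 ^ ((a - 2) * w) * A ≤ 2 ^ ((a - 2) * w) * 2 ^ (w + 1) := by gcongr
      _ = 2 ^ ((a - 2) * w + (w + 1)) := (pow_add _ _ _).symm
      _ ≤ 2 ^ (a * w) := by
        refine Nat.pow_le_pow_right (by norm_num) ?_
        obtain ⟨k, rfl⟩ : ∃ k, a = k + 2 := ⟨a - 2, by omega⟩
        rw [Nat.add_sub_cancel, add_mul]; omega
      _ ≤ G := hG
  · have h4 : G / A ≤ G / 2 := Nat.div_le_div_left (hw2.trans hAl) (by norm_num)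
    have h5 : 2 ≤ G := by
      refine le_trans ?_ hG3
      calc 2 = 2 ^ 1 := rfl
        _ ≤ _ := Nat.pow_le_pow_right (by norm_num) (by omega)
    omega
  · have hA0 : (0 : ℝ) < A := by exact_mod_cast hApos
    have hGA : ((G / A + 1 : ℕ) : ℝ) ≤ (G : ℝ) / A + 1 := by
      push_cast; gcongr; exact Nat.cast_div_le
    have hb : (2 : ℝ) ^ (w + e) ≤ R * (A + 1) := by exact_mod_cast hlt.le
    have hR0 : (0 : ℝ) ≤ R := by positivity
    have hAG : (A : ℝ) * 2 ^ w ≤ G := by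
      have : A * 2 ^ w ≤ G := by
        refine le_trans ?_ hG3
        calc A * 2 ^ w ≤ 2 ^ (w + 1) * 2 ^ w := by gcongr
          _ = 2 ^ (w + 1 + w) := (pow_add _ _ _).symm
          _ ≤ _ := Nat.pow_le_pow_right (by norm_num) (by omega)
      exact_mod_cast this
    have hAl' : (2 : ℝ) ^ w ≤ A := by exact_mod_cast hAl
    have hW : (1 : ℝ) ≤ 2 ^ w := one_le_pow₀ (by norm_num)
    set W : ℝ := 2 ^ w
    have hG0 : (0 : ℝ) ≤ G := by positivity
    -- The two roundings leave the extra terms `A`, `G / A` and `1`, each at most `G / 2^w`, by `2^w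
    -- ≤ A ≤ 2^(w+1)` and `2^(3w) ≤ G`.
    calc ((G / A + 1 : ℕ) : ℝ) * 2 ^ (w + e) ≤ ((G : ℝ) / A + 1) * (R * (A + 1)) := by gcongr
      _ = R * (G + A + G / A + 1) := by field_simp; ring
      _ ≤ R * (G + G / W + G / W + G / W) := by
        gcongr
        · rw [le_div_iff₀ (by positivity)]; exact hAG
        · rw [le_div_iff₀ (by positivity), one_mul]
          nlinarith
      _ ≤ R * G * (1 + 4 / W) := by
        have : 0 ≤ R * (G / W) := by positivity
        have e : R * G * (1 + 4 / W) = R * (G + G / W + G / W + G / W) + R * (G / W) := by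
          field_simp; ring
        linarith

/-- The result of packing the first `C` cells, of sizes `n 0, n 1, …`: a carry `r < R`, a group
`g < G` of cells that still waits for being packed, and `L` bits of memory. Every cell is
determined by `O(1)` words of memory, or by the carry and the last `O(1)` words of memory,
or by the group. -/
theorem exists_packing {w a q : ℕ} (hw : 1 ≤ w) (ha : 3 ≤ a) {n : ℕ → ℕ}
    (hn1 : ∀ c, 1 ≤ n c) (hn : ∀ c, n c ≤ 2 ^ (q * w)) (C : ℕ) :
    ∃ (R G L pl : ℕ) (r g : (ℕ → ℕ) → ℕ) (mem : (ℕ → ℕ) → ℕ → Bool),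
      1 ≤ R ∧ R ≤ 2 ^ ((a + q) * w) ∧ 1 ≤ G ∧ G < 2 ^ (a * w) ∧
      (L = 0 ∨ 2 ^ ((a - 2) * w) ≤ R) ∧
      ((R : ℝ) * G * 2 ^ L ≤ (∏ c ∈ Finset.range C, (n c : ℝ)) * (1 + 4 / 2 ^ w) ^ C) ∧
      pl ≤ L ∧ L ≤ pl + (a + q + 2) * w ∧
      (∀ y : ℕ → ℕ, (∀ c < C, y c < n c) → r y < R ∧ g y < G) ∧
      ∀ c < C,
        (∃ p, ∀ y y' : ℕ → ℕ, (∀ c < C, y c < n c) → (∀ c < C, y' c < n c) →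
          (∀ i, p ≤ i → i < p + 2 * (a + q + 2) * w → i < L → mem y i = mem y' i) →
          y c = y' c) ∨
        (∀ y y' : ℕ → ℕ, (∀ c < C, y c < n c) → (∀ c < C, y' c < n c) → r y = r y' →
          (∀ i, pl ≤ i → i < L → mem y i = mem y' i) → y c = y' c) ∨
        (∀ y y' : ℕ → ℕ, (∀ c < C, y c < n c) → (∀ c < C, y' c < n c) → g y = g y' →
          y c = y' c) := by
  induction C with
  | zero =>
    refine ⟨1, 1, 0, 0, fun _ => 0, fun _ => 0, fun _ _ => false, le_rfl, Nat.one_le_two_pow,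
      le_rfl, Nat.one_lt_two_pow (by positivity), Or.inl rfl, by simp, le_rfl, by simp,
      fun _ _ => by simp, fun c hc => absurd hc (Nat.not_lt_zero c)⟩
  | succ C ih =>
    obtain ⟨R, G, L, pl, r, g, mem, hR, hRu, hG, hGu, hLR, hsize, hpl, hpl', hbd, hdet⟩ := ih
    have hcut : ∀ y : ℕ → ℕ, (∀ c < C + 1, y c < n c) → ∀ c < C, y c < n c :=
      fun y hy c hc => hy c (Nat.lt_succ_of_lt hc)
    have hgC : ∀ y y' : ℕ → ℕ, (∀ c < C + 1, y c < n c) → (∀ c < C + 1, y' c < n c) →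
        g y + G * y C = g y' + G * y' C → g y = g y' ∧ y C = y' C := by
      intro y y' hy hy' e
      have h1 := (hbd y (hcut y hy)).2
      have h2 := (hbd y' (hcut y' hy')).2
      have e1 := congrArg (· % G) e
      have e2 := congrArg (· / G) e
      simp only [Nat.add_mul_mod_self_left, Nat.mod_eq_of_lt h1, Nat.mod_eq_of_lt h2] at e1
      simp only [Nat.add_mul_div_left _ _ hG, Nat.div_eq_of_lt h1, Nat.div_eq_of_lt h2,
        zero_add] at e2
      exact ⟨e1, e2⟩
    have hglt : ∀ y : ℕ → ℕ, (∀ c < C + 1, y c < n c) → g y + G * y C < G * n C := by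
      intro y hy
      have h1 := (hbd y (hcut y hy)).2
      have h2 : y C + 1 ≤ n C := hy C (Nat.lt_succ_self C)
      calc g y + G * y C < G + G * y C := by omega
        _ = G * (y C + 1) := by ring
        _ ≤ G * n C := Nat.mul_le_mul_left _ h2
    have heps : (0 : ℝ) ≤ 4 / 2 ^ w := by positivity
    -- A group still below `a` words simply absorbs the new cell without loss; otherwise it is
    -- flushed.
    by_cases hflush : G * n C < 2 ^ (a * w)
    · refine ⟨R, G * n C, L, pl, r, fun y => g y + G * y C, mem, hR, hRu,
        Nat.mul_pos hG (hn1 C), hflush, hLR, ?_, hpl, hpl',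
        fun y hy => ⟨(hbd y (hcut y hy)).1, hglt y hy⟩, fun c hc => ?_⟩
      · rw [Finset.prod_range_succ, pow_succ]
        push_cast
        have h0 : (0 : ℝ) ≤ n C := by positivity
        calc (R : ℝ) * (G * n C) * 2 ^ L = (R * G * 2 ^ L) * n C := by ring
          _ ≤ ((∏ c ∈ Finset.range C, (n c : ℝ)) * (1 + 4 / 2 ^ w) ^ C) * n C := by gcongr
          _ = ((∏ c ∈ Finset.range C, (n c : ℝ)) * n C) * ((1 + 4 / 2 ^ w) ^ C * 1) := by ring
          _ ≤ _ := by gcongr; linarith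
      · rcases Nat.lt_succ_iff_lt_or_eq.1 hc with hc | rfl
        · rcases hdet c hc with ⟨p, h⟩ | h | h
          · exact Or.inl ⟨p, fun y y' hy hy' => h y y' (hcut y hy) (hcut y' hy')⟩
          · exact Or.inr (Or.inl fun y y' hy hy' => h y y' (hcut y hy) (hcut y' hy'))
          · exact Or.inr (Or.inr fun y y' hy hy' e =>
              h y y' (hcut y hy) (hcut y' hy') (hgC y y' hy hy' e).1)
        · exact Or.inr (Or.inr fun y y' hy hy' e => (hgC y y' hy hy' e).2)
    · have hGn : G * n C < 2 ^ ((a + q) * w) := by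
        rw [add_mul, pow_add]
        exact Nat.mul_lt_mul_of_lt_of_le hGu (hn C) (by positivity)
      obtain ⟨A, b, hA, hRA, hb, hRl, hRu', hsz⟩ :=
        exists_split hw ha hR hRu (not_lt.1 hflush) hGn
      -- Flushing splits the group as quotient and remainder modulo `A`. The remainder and the old
      -- carry together nearly fill a block of `b` bits; the quotient becomes the new carry. The
      -- carry is never extended further, only written out with the next flush, so no chain of
      -- dependences builds up.
      set x : (ℕ → ℕ) → ℕ := fun y => r y + R * ((g y + G * y C) % A) with hx
      have hxlt : ∀ y : ℕ → ℕ, (∀ c < C + 1, y c < n c) → x y < 2 ^ b := by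
        intro y hy
        refine lt_of_lt_of_le ?_ hRA
        have h1 := (hbd y (hcut y hy)).1
        have h2 : (g y + G * y C) % A + 1 ≤ A := Nat.mod_lt _ hA
        calc x y < R + R * ((g y + G * y C) % A) := by simp only [hx]; omega
          _ = R * ((g y + G * y C) % A + 1) := by ring
          _ ≤ R * A := Nat.mul_le_mul_left _ h2
      have hxr : ∀ y y' : ℕ → ℕ, (∀ c < C + 1, y c < n c) → (∀ c < C + 1, y' c < n c) →
          x y = x y' → r y = r y' ∧ (g y + G * y C) % A = (g y' + G * y' C) % A := by
        intro y y' hy hy' e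
        have h1 := (hbd y (hcut y hy)).1
        have h2 := (hbd y' (hcut y' hy')).1
        have e1 := congrArg (· % R) e
        have e2 := congrArg (· / R) e
        simp only [hx, Nat.add_mul_mod_self_left, Nat.mod_eq_of_lt h1, Nat.mod_eq_of_lt h2] at e1
        simp only [hx, Nat.add_mul_div_left _ _ hR, Nat.div_eq_of_lt h1, Nat.div_eq_of_lt h2,
          zero_add] at e2
        exact ⟨e1, e2⟩
      set mem' : (ℕ → ℕ) → ℕ → Bool :=
        fun y i => if i < L then mem y i else (x y).testBit (i - L) with hmem'
      have hold : ∀ y y' i, i < L → mem' y i = mem' y' i → mem y i = mem y' i := by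
        intro y y' i hi e
        simpa [hmem', hi] using e
      have hnew : ∀ y y' : ℕ → ℕ, (∀ c < C + 1, y c < n c) → (∀ c < C + 1, y' c < n c) →
          (∀ i, L ≤ i → i < L + b → mem' y i = mem' y' i) → x y = x y' := by
        intro y y' hy hy' e
        refine eq_of_testBit_eq_of_lt (hxlt y hy) (hxlt y' hy') fun i hi => ?_
        simpa [hmem'] using e (L + i) (by omega) (by omega)
      have hdm : ∀ y y' : ℕ → ℕ, (∀ c < C + 1, y c < n c) → (∀ c < C + 1, y' c < n c) →
          (g y + G * y C) / A = (g y' + G * y' C) / A →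
          (∀ i, L ≤ i → i < L + b → mem' y i = mem' y' i) → g y = g y' ∧ y C = y' C := by
        intro y y' hy hy' e h
        refine hgC y y' hy hy' ?_
        rw [← Nat.div_add_mod (g y + G * y C) A, ← Nat.div_add_mod (g y' + G * y' C) A, e,
          (hxr y y' hy hy' (hnew y y' hy hy' h)).2]
      refine ⟨G * n C / A + 1, 1, L + b, L, fun y => (g y + G * y C) / A, fun _ => 0, mem',
        Nat.succ_pos _, hRu', le_rfl, Nat.one_lt_two_pow (by positivity), Or.inr hRl, ?_,
        Nat.le_add_right _ _, by omega, fun y hy => ⟨?_, Nat.one_pos⟩, fun c hc => ?_⟩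
      · rw [Finset.prod_range_succ, pow_succ, pow_add, Nat.cast_one, mul_one]
        calc ((G * n C / A + 1 : ℕ) : ℝ) * (2 ^ L * 2 ^ b)
            = (((G * n C / A + 1 : ℕ) : ℝ) * 2 ^ b) * 2 ^ L := by ring
          _ ≤ (R * ((G * n C : ℕ) : ℝ) * (1 + 4 / 2 ^ w)) * 2 ^ L := by gcongr
          _ = (R * G * 2 ^ L) * (n C * (1 + 4 / 2 ^ w)) := by push_cast; ring
          _ ≤ ((∏ c ∈ Finset.range C, (n c : ℝ)) * (1 + 4 / 2 ^ w) ^ C) *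
              (n C * (1 + 4 / 2 ^ w)) := by gcongr
          _ = _ := by ring
      · exact Nat.lt_succ_of_le (Nat.div_le_div_right (hglt y hy).le)
      · rcases Nat.lt_succ_iff_lt_or_eq.1 hc with hc | rfl
        · rcases hdet c hc with ⟨p, h⟩ | h | h
          · exact Or.inl ⟨p, fun y y' hy hy' e => h y y' (hcut y hy) (hcut y' hy')
              fun i hi hi' hiL => hold y y' i hiL (e i hi hi' (by omega))⟩
          -- A cell that relied on the old carry now finds it in the new block, adjacent to the
          -- block starting at `pl` that it also needs. Two consecutive blocks explain the factor 2
          -- in the window.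
          · have h2 : 2 * (a + q + 2) * w = (a + q + 2) * w + (a + q + 2) * w := by ring
            refine Or.inl ⟨pl, fun y y' hy hy' e => h y y' (hcut y hy) (hcut y' hy') ?_ ?_⟩
            · exact (hxr y y' hy hy' (hnew y y' hy hy' fun i hi hi' =>
                e i (by omega) (by omega) hi')).1
            · exact fun i hi hiL => hold y y' i hiL (e i hi (by omega) (by omega))
          · exact Or.inr (Or.inl fun y y' hy hy' e em =>
              h y y' (hcut y hy) (hcut y' hy') (hdm y y' hy hy' e em).1)
        · exact Or.inr (Or.inl fun y y' hy hy' e em => (hdm y y' hy hy' e em).2)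

/-- Packing into a prescribed number `L'` of bits of memory. -/
theorem exists_packing_of_length {w a q B : ℕ} (hw : 1 ≤ w) (ha : 3 ≤ a) {n : ℕ → ℕ}
    (hn1 : ∀ c, 1 ≤ n c) (hn : ∀ c, n c ≤ 2 ^ (q * w)) (C L' : ℕ)
    (hsize : (∏ c ∈ Finset.range C, (n c : ℝ)) * (1 + 4 / 2 ^ w) ^ C ≤ 2 ^ (B * w))
    (hL' : B * w ≤ L' + (a - 2) * w) :
    ∃ (R p₀ : ℕ) (r : (ℕ → ℕ) → ℕ) (mem : (ℕ → ℕ) → ℕ → Bool),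
      ((R : ℝ) * 2 ^ L' ≤
        2 ^ L' + (∏ c ∈ Finset.range C, (n c : ℝ)) * (1 + 4 / 2 ^ w) ^ C) ∧
      (∀ y : ℕ → ℕ, (∀ c < C, y c < n c) → r y < R) ∧
      ∀ c < C, ∃ p, ∀ y y' : ℕ → ℕ, (∀ c < C, y c < n c) → (∀ c < C, y' c < n c) →
        r y = r y' →
        (∀ i, p₀ ≤ i → i < p₀ + (2 * a + q) * w → i < L' → mem y i = mem y' i) →
        (∀ i, p ≤ i → i < p + 2 * (a + q + 2) * w → i < L' → mem y i = mem y' i) →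
        y c = y' c := by
  obtain ⟨R, G, L, pl, r, g, mem, hR, hRu, hG, hGu, hLR, hsz, hpl, hpl', hbd, hdet⟩ :=
    exists_packing hw ha hn1 hn C
  have hLL : L ≤ L' := by
    rcases hLR with rfl | h
    · exact Nat.zero_le _
    -- After a flush the carry has at least `2^((a-2)w)` values, and these count against the total
    -- size, so the bits already written cannot exceed `L'`.
    · have h1 : (2 : ℝ) ^ ((a - 2) * w) * 2 ^ L ≤ 2 ^ (B * w) := by
        refine le_trans ?_ (hsz.trans hsize)
        have h2 : (2 : ℝ) ^ ((a - 2) * w) ≤ R := by exact_mod_cast h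
        have h3 : (1 : ℝ) ≤ G := by exact_mod_cast hG
        gcongr
        nlinarith [(by positivity : (0 : ℝ) ≤ R)]
      rw [← pow_add] at h1
      have := (pow_le_pow_iff_right₀ (by norm_num : (1 : ℝ) < 2)).1 h1
      omega
  set Q : (ℕ → ℕ) → ℕ := fun y => r y + R * g y with hQ
  have hQlt : ∀ y : ℕ → ℕ, (∀ c < C, y c < n c) → Q y < R * G := by
    intro y hy
    have h1 := hbd y hy
    have h2 : g y + 1 ≤ G := h1.2
    calc Q y < R + R * g y := by simp only [hQ]; omega
      _ = R * (g y + 1) := by ring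
      _ ≤ R * G := Nat.mul_le_mul_left _ h2
  have hRG : R * G ≤ 2 ^ ((2 * a + q) * w) := by
    calc R * G ≤ 2 ^ ((a + q) * w) * 2 ^ (a * w) := Nat.mul_le_mul hRu hGu.le
      _ = _ := by rw [← pow_add]; ring_nf
  -- The unused `L' - L` bits take the low bits of the combined carry and group; only the rest is
  -- left over.
  set mem' : (ℕ → ℕ) → ℕ → Bool :=
    fun y i => if i < L then mem y i else (Q y % 2 ^ (L' - L)).testBit (i - L) with hmem'
  have hold : ∀ y y' i, i < L → mem' y i = mem' y' i → mem y i = mem y' i := by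
    intro y y' i hi e
    simpa [hmem', hi] using e
  have hkey : ∀ y y' : ℕ → ℕ, (∀ c < C, y c < n c) → (∀ c < C, y' c < n c) →
      Q y / 2 ^ (L' - L) = Q y' / 2 ^ (L' - L) →
      (∀ i, L ≤ i → i < L + (2 * a + q) * w → i < L' → mem' y i = mem' y' i) →
      r y = r y' ∧ g y = g y' := by
    intro y y' hy hy' e em
    have h1 : Q y % 2 ^ (L' - L) = Q y' % 2 ^ (L' - L) := by
      refine Nat.eq_of_testBit_eq fun i => ?_
      by_cases hi : L + i < L' ∧ i < (2 * a + q) * w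
      · simpa [hmem'] using em (L + i) (by omega) (by omega) hi.1
      · have aux : ∀ z : ℕ → ℕ, (∀ c < C, z c < n c) →
            (Q z % 2 ^ (L' - L)).testBit i = false := by
          intro z hz
          refine Nat.testBit_lt_two_pow ?_
          by_cases hi' : L + i < L'
          -- The padding may be long, but `Q` has at most `(2a+q)w` bits, so beyond that point the
          -- padding is zero and need not be read.
          · have h3 : (2 * a + q) * w ≤ i := by by_contra h; exact hi ⟨hi', by omega⟩
            calc Q z % 2 ^ (L' - L) ≤ Q z := Nat.mod_le _ _
              _ < R * G := hQlt z hz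
              _ ≤ 2 ^ ((2 * a + q) * w) := hRG
              _ ≤ 2 ^ i := Nat.pow_le_pow_right (by norm_num) h3
          · exact (Nat.mod_lt _ (by positivity)).trans_le
              (Nat.pow_le_pow_right (by norm_num) (by omega))
        rw [aux y hy, aux y' hy']
    have h2 : Q y = Q y' := by
      rw [← Nat.div_add_mod (Q y) (2 ^ (L' - L)), ← Nat.div_add_mod (Q y') (2 ^ (L' - L)), e, h1]
    have b1 := (hbd y hy).1
    have b2 := (hbd y' hy').1
    have e1 := congrArg (· % R) h2
    have e2 := congrArg (· / R) h2
    simp only [hQ, Nat.add_mul_mod_self_left, Nat.mod_eq_of_lt b1, Nat.mod_eq_of_lt b2] at e1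
    simp only [hQ, Nat.add_mul_div_left _ _ hR, Nat.div_eq_of_lt b1, Nat.div_eq_of_lt b2,
      zero_add] at e2
    exact ⟨e1, e2⟩
  refine ⟨R * G / 2 ^ (L' - L) + 1, L, fun y => Q y / 2 ^ (L' - L), mem', ?_, ?_, ?_⟩
  · refine le_trans ?_ (add_le_add_right hsz _)
    have h1 : ((R * G / 2 ^ (L' - L) : ℕ) : ℝ) ≤ (R * G) / 2 ^ (L' - L) := by
      have := @Nat.cast_div_le ℝ _ _ _ (R * G) (2 ^ (L' - L))
      push_cast at this; exact_mod_cast this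
    have h2 : (2 : ℝ) ^ L' = 2 ^ (L' - L) * 2 ^ L := by rw [← pow_add]; congr 1; omega
    push_cast
    calc (((R * G / 2 ^ (L' - L) : ℕ) : ℝ) + 1) * 2 ^ L'
        ≤ ((R * G) / 2 ^ (L' - L) + 1) * 2 ^ L' := by gcongr
      _ = 2 ^ L' + (R * G) / 2 ^ (L' - L) * 2 ^ L' := by ring
      _ = 2 ^ L' + R * G * 2 ^ L := by rw [h2]; field_simp
  · exact fun y hy => Nat.lt_succ_of_le (Nat.div_le_div_right (hQlt y hy).le)
  · intro c hc
    have h2 : 2 * (a + q + 2) * w = (a + q + 2) * w + (a + q + 2) * w := by ring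
    rcases hdet c hc with ⟨p, h⟩ | h | h
    · exact ⟨p, fun y y' hy hy' _ _ em => h y y' hy hy' fun i hi hi' hiL =>
        hold y y' i hiL (em i hi hi' (by omega))⟩
    · exact ⟨pl, fun y y' hy hy' e e0 em => h y y' hy hy' (hkey y y' hy hy' e e0).1
        fun i hi hiL => hold y y' i hiL (em i hi (by omega) (by omega))⟩
    · exact ⟨0, fun y y' hy hy' e e0 _ => h y y' hy hy' (hkey y y' hy hy' e e0).2⟩

/-! ### From packed cells to a data structure with an ordered spillover. -/

theorem DataStructure.DecodesInTime.pair {Z : Type} {K m w c c' : ℕ} {D : DataStructure Z K m}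
    {α β : Type} {f : Z → α} {g : Z → β}
    (hf : D.DecodesInTime w c f) (hg : D.DecodesInTime w c' g) :
    D.DecodesInTime w (c + c') (fun z => (f z, g z)) := by
  obtain ⟨q, hq, hq'⟩ := hf
  obtain ⟨r, hr, hr'⟩ := hg
  refine ⟨fun k => (q k).bind fun a => (r k).bind fun b => .answer (a, b),
    fun k mem => ?_, fun z => ?_⟩
  · rw [ProbeTree.time_bind, ProbeTree.time_bind]
    exact Nat.add_le_add (hq k mem) (hr k mem)
  · rw [ProbeTree.eval_bind, ProbeTree.eval_bind, hq', hr']; rfl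

/-- A finite type can be enumerated in the order of a given function. -/
theorem exists_monotone_enumeration {E : Type} [Fintype E] (τ : E → ℕ) :
    ∃ pos : E → ℕ, (∀ e, pos e < Fintype.card E) ∧ Function.Injective pos ∧
      ∀ e e', τ e < τ e' → pos e < pos e' := by
  let e0 := Fintype.equivFin E
  let σ := Tuple.sort (τ ∘ e0.symm)
  have hmono := Tuple.monotone_sort (τ ∘ e0.symm)
  refine ⟨fun e => (σ.symm (e0 e) : ℕ), fun e => (σ.symm (e0 e)).2, fun e e' h => ?_,
    fun e e' h => ?_⟩
  · exact e0.injective (σ.symm.injective (Fin.ext h))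
  · by_contra hle
    have h1 : σ.symm (e0 e') ≤ σ.symm (e0 e) := not_lt.1 hle
    have h2 := hmono h1
    simp only [Function.comp_apply] at h2
    change τ (e0.symm (σ (σ.symm (e0 e')))) ≤ τ (e0.symm (σ (σ.symm (e0 e)))) at h2
    simp only [Equiv.apply_symm_apply, Equiv.symm_apply_apply] at h2
    omega

theorem exists_finset_index {α : Type} (s : Finset α) :
    ∃ e : α → ℕ, Set.InjOn e s ∧ ∀ x ∈ s, e x < s.card := by
  classical
  refine ⟨fun x => if h : x ∈ s then s.equivFin ⟨x, h⟩ else 0, fun x hx y hy h => ?_,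
    fun x hx => ?_⟩
  · have hx' : x ∈ s := hx
    have hy' : y ∈ s := hy
    simp only [hx', hy', dif_pos] at h
    simpa using s.equivFin.injective (Fin.ext h)
  · simp only [hx, dif_pos]; exact Fin.is_lt _

/-- Packing of the tuples `(y z 0, y z 1, …)` where `y z c` ranges over a finite set `Y c`. -/
theorem exists_packing_of_finset {Z α : Type} {w a q B : ℕ} (hw : 1 ≤ w) (ha : 3 ≤ a)
    (Y : ℕ → Finset α) (hY : ∀ c, (Y c).card ≤ 2 ^ (q * w)) (C L' : ℕ)
    (V : Z → Prop) (y : Z → ℕ → α) (hy : ∀ z, V z → ∀ c < C, y z c ∈ Y c)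
    (hsize : (∏ c ∈ Finset.range C, ((Y c).card : ℝ)) * (1 + 4 / 2 ^ w) ^ C ≤ 2 ^ (B * w))
    (hL' : B * w ≤ L' + (a - 2) * w) :
    ∃ (R p₀ : ℕ) (r : Z → ℕ) (mem : Z → ℕ → Bool) (p : ℕ → ℕ),
      ((R : ℝ) * 2 ^ L' ≤
        2 ^ L' + (∏ c ∈ Finset.range C, ((Y c).card : ℝ)) * (1 + 4 / 2 ^ w) ^ C) ∧
      (∀ z, V z → r z < R) ∧
      ∀ c < C, ∀ z z', V z → V z' → r z = r z' →
        (∀ i, p₀ ≤ i → i < p₀ + (2 * a + q) * w → i < L' → mem z i = mem z' i) →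
        (∀ i, p c ≤ i → i < p c + 2 * (a + q + 2) * w → i < L' → mem z i = mem z' i) →
        y z c = y z' c := by
  by_cases hne : ∀ c < C, (Y c).Nonempty
  · choose e he he' using fun c => exists_finset_index (Y c)
    -- The packing lemma wants sizes at least 1 for every index, including those beyond `C`; the
    -- maximum with 1 changes nothing in the range that matters.
    have hprod : (∏ c ∈ Finset.range C, ((max 1 (Y c).card : ℕ) : ℝ)) =
        ∏ c ∈ Finset.range C, ((Y c).card : ℝ) := by
      refine Finset.prod_congr rfl fun c hc => ?_
      have := (hne c (Finset.mem_range.1 hc)).card_pos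
      congr 1
      exact max_eq_right this
    obtain ⟨R, p₀, r, mem, hR, hr, hdet⟩ := exists_packing_of_length (B := B) hw ha
      (n := fun c => max 1 (Y c).card) (fun c => le_max_left _ _)
      (fun c => max_le Nat.one_le_two_pow (hY c)) C L' (by rwa [hprod]) hL'
    rw [hprod] at hR
    have hval : ∀ z, V z → ∀ c < C, e c (y z c) < max 1 (Y c).card :=
      fun z hz c hc => (he' c _ (hy z hz c hc)).trans_le (le_max_right _ _)
    choose! p hp using hdet
    refine ⟨R, p₀, fun z => r fun c => e c (y z c), fun z => mem fun c => e c (y z c), p, hR,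
      fun z hz => hr _ (hval z hz), fun c hc z z' hz hz' er e0 e1 => ?_⟩
    exact he c (hy z hz c hc) (hy z' hz' c hc) (hp c hc _ _ (hval z hz) (hval z' hz') er e0 e1)
  -- An empty cell means that the class has no inputs, and then no carry value is needed.
  · push Not at hne
    obtain ⟨c, hc, hce⟩ := hne
    have hV : ∀ z, ¬ V z := fun z hz => by simpa [hce] using hy z hz c hc
    refine ⟨0, 0, fun _ => 0, fun _ _ => false, fun _ => 0, ?_, fun z hz => absurd hz (hV z),
      fun c _ z _ hz => absurd hz (hV z)⟩
    rw [Nat.cast_zero, zero_mul]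
    have h0 : 0 ≤ ∏ c ∈ Finset.range C, ((Y c).card : ℝ) :=
      Finset.prod_nonneg fun _ _ => Nat.cast_nonneg _
    exact add_nonneg (by positivity) (mul_nonneg h0 (by positivity))

/-- Inputs are described by a class `m z` and the contents `y z c ∈ Y (m z) c` of its cells
`c < C`. If the number of the combinations of a class and of contents is at most `S`, there is
a data structure of size about `S` that answers in time `O(1)` every query that depends on
the class and on two cells, and whose spillover determines `τ (m z)`. -/
theorem exists_dataStructure_of_cells {Z M α : Type} [Nonempty Z] [Fintype M]
    {w B C q t Tn κ : ℕ} (hw : 1 ≤ w) (htB : t + 1 ≤ B)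
    (Y : M → ℕ → Finset α) (hY : ∀ m c, (Y m c).card ≤ 2 ^ (q * w))
    (m : Z → M) (y : Z → ℕ → α) (hy : ∀ z, ∀ c < C, y z c ∈ Y (m z) c)
    (τ : M → ℕ) (hτ : ∀ m, τ m < Tn) {S : ℝ}
    (hS : ∑ m, ∏ c ∈ Finset.range C, ((Y m c).card : ℝ) ≤ S)
    (hS' : S * (1 + 4 / 2 ^ w) ^ C ≤ 2 ^ ((B + 2) * w))
    (hκ : Tn + 1 + (Fintype.card M + S * (1 + 4 / 2 ^ w) ^ C / 2 ^ ((B - 1 - t) * w)) /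
      2 ^ (t * w) ≤ (κ : ℝ)) :
    ∃ D : DataStructure Z κ ((B - 1) * w),
      (∀ (β : Type) (f : Z → β) (c₁ c₂ : M → ℕ), (∀ m, c₁ m < C) → (∀ m, c₂ m < C) →
        (∀ z z', m z = m z' → y z (c₁ (m z)) = y z' (c₁ (m z)) →
          y z (c₂ (m z)) = y z' (c₂ (m z)) → f z = f z') →
        D.DecodesInTime w (2 * (t + (2 * (t + 5) + q) + 2 * (t + 5 + q + 2))) f) ∧
      D.SpilloverDetermines (fun z => τ (m z)) := by
  classical
  set L' := (B - 1 - t) * w with hL'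
  have hmw : (B - 1) * w = t * w + L' := by
    rw [hL', ← add_mul]; congr 1; omega
  have heps : (0 : ℝ) < 1 + 4 / 2 ^ w := by positivity
  have hone : ∀ m₀, (∏ c ∈ Finset.range C, ((Y m₀ c).card : ℝ)) * (1 + 4 / 2 ^ w) ^ C ≤
      2 ^ ((B + 2) * w) := by
    intro m₀
    refine le_trans ?_ hS'
    gcongr
    refine le_trans ?_ hS
    exact Finset.single_le_sum (f := fun m => ∏ c ∈ Finset.range C, ((Y m c).card : ℝ))
      (fun _ _ => Finset.prod_nonneg fun _ _ => Nat.cast_nonneg _) (Finset.mem_univ m₀)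
  -- The group threshold of `t + 5` words is the one for which this holds with equality.
  have hLB : (B + 2) * w ≤ L' + (t + 5 - 2) * w := by
    rw [hL', ← add_mul]; exact Nat.mul_le_mul_right _ (by omega)
  choose R p₀ r mem p hR hr hdet using fun m₀ => exists_packing_of_finset (Z := Z)
    (B := B + 2) hw (show 3 ≤ t + 5 by omega) (Y m₀) (hY m₀) C L' (fun z => m z = m₀) y
    (fun z hz => hz ▸ hy z) (hone m₀) hLB
  obtain ⟨pos, hpos, hinj, hmono⟩ :=
    exists_monotone_enumeration (fun e : (Σ m₀, Fin (R m₀)) => τ e.1)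
  -- Each class wastes at most one carry value by rounding. The resulting `Fintype.card M` is
  -- divided by `2^(t*w)` in the spillover, so it is cheap when a class fits into `t` words.
  have hcard : (Fintype.card (Σ m₀, Fin (R m₀)) : ℝ) ≤
      Fintype.card M + S * (1 + 4 / 2 ^ w) ^ C / 2 ^ L' := by
    rw [Fintype.card_sigma]
    push_cast
    calc ∑ m₀, (Fintype.card (Fin (R m₀)) : ℝ)
        ≤ ∑ m₀, (1 + (∏ c ∈ Finset.range C, ((Y m₀ c).card : ℝ)) *
            (1 + 4 / 2 ^ w) ^ C / 2 ^ L') := by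
          refine Finset.sum_le_sum fun m₀ _ => ?_
          rw [Fintype.card_fin, ← sub_nonneg]
          have h0 : (0 : ℝ) < 2 ^ L' := by positivity
          have := hR m₀
          rw [sub_nonneg, ← mul_le_mul_iff_left₀ h0, add_mul, one_mul, div_mul_cancel₀ _ h0.ne']
          exact this
      _ = Fintype.card M + (∑ m, ∏ c ∈ Finset.range C, ((Y m c).card : ℝ)) *
            (1 + 4 / 2 ^ w) ^ C / 2 ^ L' := by
          rw [Finset.sum_add_distrib, Finset.sum_mul, Finset.sum_div]; simp
      _ ≤ _ := by gcongr
  let E : Z → (Σ m₀, Fin (R m₀)) := fun z => ⟨m z, ⟨r (m z) z, hr _ z rfl⟩⟩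
  have hlt : ∀ z, pos (E z) / 2 ^ (t * w) + τ (m z) < κ := by
    intro z
    have h1 : ((pos (E z) / 2 ^ (t * w) : ℕ) : ℝ) ≤
        (Fintype.card M + S * (1 + 4 / 2 ^ w) ^ C / 2 ^ L') / 2 ^ (t * w) := by
      calc ((pos (E z) / 2 ^ (t * w) : ℕ) : ℝ) ≤ (pos (E z) : ℝ) / 2 ^ (t * w) := by
            have := @Nat.cast_div_le ℝ _ _ _ (pos (E z)) (2 ^ (t * w))
            push_cast at this; exact_mod_cast this
        _ ≤ _ := by
          gcongr
          refine le_trans ?_ hcard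
          exact_mod_cast (hpos (E z)).le
    have h2 : (τ (m z) : ℝ) + 1 ≤ Tn := by exact_mod_cast hτ (m z)
    have h3 : ((pos (E z) / 2 ^ (t * w) : ℕ) : ℝ) + τ (m z) < κ := by linarith
    exact_mod_cast h3
  -- The low `t` words of the position open the memory. The quotient is only weakly increasing in
  -- `τ`; adding `τ` makes it strictly increasing, so that the spillover determines both summands.
  let D : DataStructure Z κ ((B - 1) * w) := fun z => (⟨pos (E z) / 2 ^ (t * w) + τ (m z), hlt z⟩,
    fun i => if (i : ℕ) < t * w then (pos (E z) % 2 ^ (t * w)).testBit i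
      else mem (m z) z (i - t * w))
  have hspill : ∀ z z', (D z).1 = (D z').1 →
      τ (m z) = τ (m z') ∧ pos (E z) / 2 ^ (t * w) = pos (E z') / 2 ^ (t * w) := by
    intro z z' h
    have h1 : pos (E z) / 2 ^ (t * w) + τ (m z) = pos (E z') / 2 ^ (t * w) + τ (m z') :=
      congrArg Fin.val h
    rcases lt_trichotomy (τ (m z)) (τ (m z')) with hlt | heq | hgt
    · have := Nat.div_le_div_right (c := 2 ^ (t * w)) (hmono (E z) (E z') hlt).le; omega
    · exact ⟨heq, by omega⟩
    · have := Nat.div_le_div_right (c := 2 ^ (t * w)) (hmono (E z') (E z) hgt).le; omega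
  have hbitlo : ∀ z i, i < t * w →
      bitAt (D z).2 i = (pos (E z) % 2 ^ (t * w)).testBit i := by
    intro z i hi
    have : i < (B - 1) * w := by omega
    simp [bitAt, D, this, hi]
  have hbithi : ∀ z i, i < L' → bitAt (D z).2 (t * w + i) = mem (m z) z i := by
    intro z i hi
    have : t * w + i < (B - 1) * w := by omega
    simp [bitAt, D, this]
  refine ⟨D, fun β f c₁ c₂ hc₁ hc₂ hf => ?_, ?_⟩
  · have hE : D.DecodesInTime w (0 + t) (fun z => (m z, r (m z) z)) := by
      refine (D.decodesInTime_spillover w).of_determined (fun _ => 0) t _ fun z z' h hb => ?_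
      have h1 : pos (E z) % 2 ^ (t * w) = pos (E z') % 2 ^ (t * w) := by
        refine eq_of_testBit_eq_of_lt (Nat.mod_lt _ (by positivity))
          (Nat.mod_lt _ (by positivity)) (b := t * w) fun i hi => ?_
        rw [← hbitlo z i hi, ← hbitlo z' i hi]
        exact hb i (Nat.zero_le _) (by omega)
      have h2 : pos (E z) = pos (E z') := by
        rw [← Nat.div_add_mod (pos (E z)) (2 ^ (t * w)),
          ← Nat.div_add_mod (pos (E z')) (2 ^ (t * w)), (hspill z z' h).2, h1]
      have h3 := congrArg (fun e : (Σ m₀, Fin (R m₀)) => (e.1, (e.2 : ℕ))) (hinj h2)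
      exact h3
    have hcell : ∀ c : M → ℕ, (∀ m, c m < C) → D.DecodesInTime w
        (0 + t + (2 * (t + 5) + q) + 2 * (t + 5 + q + 2))
        (fun z => (m z, y z (c (m z)))) := by
      intro c hc
      -- The remaining probes read the padding area at `p₀` of the class and then the window of the
      -- requested cell, both shifted by the `t` words in front.
      refine (hE.interval (fun x => t * w + p₀ x.1) (2 * (t + 5) + q)).of_determined
        (fun x => t * w + p x.1.1 (c x.1.1)) _ _ fun z z' h hb => ?_
      simp only [Prod.mk.injEq] at h
      obtain ⟨⟨hm, hrr⟩, hbits⟩ := h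
      refine Prod.ext hm ?_
      rw [← hm]
      rw [← hm] at hbits hrr
      refine hdet (m z) (c (m z)) (hc _) z z' rfl hm.symm hrr (fun i hi hi' hiL => ?_)
        (fun i hi hi' hiL => ?_)
      · have e := congrFun hbits ⟨i - p₀ (m z), by omega⟩
        have e1 : t * w + p₀ (m z) + (i - p₀ (m z)) = t * w + i := by omega
        simp only [e1, hbithi _ i hiL] at e
        rwa [← hm] at e
      · have e := hb (t * w + i) (by simpa using hi) (by simp only; omega)
        rwa [hbithi _ i hiL, hbithi _ i hiL, ← hm] at e
    have hpair := ((hcell c₁ hc₁).pair (hcell c₂ hc₂))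
    refine (hpair.of_determined (fun _ => 0) 0 f fun z z' h _ => ?_).mono (by omega)
    simp only [Prod.mk.injEq] at h
    refine hf z z' h.1.1 ?_ ?_
    · rw [h.1.2, h.1.1]
    · rw [h.2.2, h.1.1]
  · obtain ⟨z₀⟩ := ‹Nonempty Z›
    have hfac : Function.FactorsThrough (fun z => τ (m z)) (fun z => (D z).1) :=
      fun z z' h => (hspill z z' h).1
    obtain ⟨g, hg⟩ := (Function.factorsThrough_iff (fun z => τ (m z))).1 hfac
    exact ⟨g, fun z => (congrFun hg z).symm⟩

/-! ### Chains: storing keys through prefix sums with independent cells. -/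

theorem exists_injOn_of_card_le {α β : Type} [Inhabited β] {s : Finset α}
    {t : Finset β} (h : s.card ≤ t.card) : ∃ f : α → β, (∀ x ∈ s, f x ∈ t) ∧ Set.InjOn f s := by
  obtain ⟨e, he, he'⟩ := exists_finset_index s
  refine ⟨fun x => if hx : e x < t.card then t.equivFin.symm ⟨e x, hx⟩ else default,
    fun x hx => ?_, fun x hx y hy hxy => ?_⟩
  · simp only [(he' x hx).trans_le h, dif_pos]; exact Subtype.prop _
  · simp only [(he' x hx).trans_le h, (he' y hy).trans_le h, dif_pos] at hxy
    have := t.equivFin.symm.injective (Subtype.ext hxy)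
    exact he hx hy (Fin.mk.inj this)

/-- A scheme for storing sequences of keys through the prefix sums `0 = T 0, T 1, …` of values
`δ k` of the keys: the `c`-th key is described by a component `j`, a number below
`A c (blk (T c)) (blk (T (c + 1))) j (T (c + 1))`, stored with `T (c + 1)`, and a number below
`G c (blk (T c)) (blk (T (c + 1))) j (T c)`, stored with `T c`. -/
structure Chain (ι : Type) where
  /-- The block of a prefix sum. -/
  blk : ℕ → ℕ
  /-- The factor that depends on the later prefix sum. -/
  A : ℕ → ℕ → ℕ → ι → ℕ → ℕ
  /-- The factor that depends on the earlier prefix sum. -/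
  G : ℕ → ℕ → ℕ → ι → ℕ → ℕ

namespace Chain

variable {ι : Type}

/-- The number of the descriptions of a key that leads from the prefix sum `T'` to `T`. -/
def cap [Fintype ι] (𝒞 : Chain ι) (c T' T : ℕ) : ℕ :=
  ∑ j, 𝒞.A c (𝒞.blk T') (𝒞.blk T) j T * 𝒞.G c (𝒞.blk T') (𝒞.blk T) j T'

/-- The classes of sequences of `g` keys: the blocks of all prefix sums, the components of all
keys, and the total sum. -/
abbrev Class (ι : Type) (g nb Tmax : ℕ) : Type :=
  (Fin (g + 1) → Fin nb) × (Fin g → ι) × Fin Tmax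

variable {g nb Tmax : ℕ}

/-- The block of the `c`-th prefix sum in a class. -/
def Class.block (m : Class ι g nb Tmax) (c : ℕ) : ℕ :=
  if h : c < g + 1 then m.1 ⟨c, h⟩ else 0

/-- The component of the `c`-th key in a class. -/
def Class.comp [Inhabited ι] (m : Class ι g nb Tmax) (c : ℕ) : ι :=
  if h : c < g then m.2.1 ⟨c, h⟩ else default

/-- The number of the values that are stored with the later prefix sum. -/
def lateCard [Inhabited ι] (𝒞 : Chain ι) (m : Class ι g nb Tmax) (c T : ℕ) : ℕ :=
  if c = 0 then 1 else 𝒞.A (c - 1) (m.block (c - 1)) (m.block c) (m.comp (c - 1)) T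

/-- The number of the values that are stored with the earlier prefix sum. -/
def earlyCard [Inhabited ι] (𝒞 : Chain ι) (m : Class ι g nb Tmax) (c T : ℕ) : ℕ :=
  if c < g then 𝒞.G c (m.block c) (m.block (c + 1)) (m.comp c) T else 1

/-- The possible contents of the `c`-th cell for the sequences of a class. -/
def cell [Inhabited ι] (𝒞 : Chain ι) (m : Class ι g nb Tmax) (c : ℕ) : Finset (ℕ × ℕ × ℕ) :=
  ((Finset.range Tmax).filter fun T =>
    𝒞.blk T = m.block c ∧ (c = 0 → T = 0) ∧ (c = g → T = m.2.2)).biUnion fun T =>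
      {T} ×ˢ (Finset.range (𝒞.lateCard m c T) ×ˢ Finset.range (𝒞.earlyCard m c T))

theorem mem_cell [Inhabited ι] {𝒞 : Chain ι} {m : Class ι g nb Tmax} {c : ℕ} {x : ℕ × ℕ × ℕ} :
    x ∈ 𝒞.cell m c ↔ x.1 < Tmax ∧ 𝒞.blk x.1 = m.block c ∧ (c = 0 → x.1 = 0) ∧
      (c = g → x.1 = m.2.2) ∧ x.2.1 < 𝒞.lateCard m c x.1 ∧ x.2.2 < 𝒞.earlyCard m c x.1 := by
  simp only [cell, Finset.mem_biUnion, Finset.mem_filter, Finset.mem_range, Finset.mem_product,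
    Finset.mem_singleton]
  constructor
  · rintro ⟨T, ⟨h1, h2, h3, h4⟩, rfl, h5, h6⟩
    exact ⟨h1, h2, h3, h4, h5, h6⟩
  · rintro ⟨h1, h2, h3, h4, h5, h6⟩
    exact ⟨x.1, ⟨h1, h2, h3, h4⟩, rfl, h5, h6⟩

/-- A crude bound suffices here: it only has to show that a cell fits into a fixed number of words.
-/
theorem card_cell_le [Inhabited ι] {𝒞 : Chain ι} {W : ℕ} (hW : 1 ≤ W)
    (hA : ∀ c β' β j T, 𝒞.A c β' β j T ≤ W) (hG : ∀ c β' β j T, 𝒞.G c β' β j T ≤ W)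
    (m : Class ι g nb Tmax) (c : ℕ) : (𝒞.cell m c).card ≤ Tmax * (W * W) := by
  refine Finset.card_biUnion_le.trans ?_
  calc _ ≤ ∑ T ∈ (Finset.range Tmax).filter fun T =>
        𝒞.blk T = m.block c ∧ (c = 0 → T = 0) ∧ (c = g → T = m.2.2), W * W := by
        refine Finset.sum_le_sum fun T _ => ?_
        rw [Finset.card_product, Finset.card_product, Finset.card_singleton, one_mul,
          Finset.card_range, Finset.card_range]
        refine Nat.mul_le_mul ?_ ?_
        · unfold lateCard; split_ifs
          · exact hW
          · exact hA _ _ _ _ _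
        · unfold earlyCard; split_ifs
          · exact hG _ _ _ _ _
          · exact hW
    _ ≤ _ := by
        rw [Finset.sum_const, smul_eq_mul]
        refine Nat.mul_le_mul_right _ ?_
        exact (Finset.card_filter_le _ _).trans (Finset.card_range _).le

/-- The descriptions of keys that start at the prefix sum `T'`. -/
noncomputable def step [Fintype ι] (𝒞 : Chain ι) (Tmax c T' : ℕ) : Finset (ι × ℕ × ℕ × ℕ) := by
  classical
  exact (Finset.univ ×ˢ Finset.range Tmax).biUnion fun x =>
    {x.1} ×ˢ ({x.2} ×ˢ (Finset.range (𝒞.A c (𝒞.blk T') (𝒞.blk x.2) x.1 x.2) ×ˢ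
      Finset.range (𝒞.G c (𝒞.blk T') (𝒞.blk x.2) x.1 T')))

theorem mem_step [Fintype ι] {𝒞 : Chain ι} {c T' : ℕ} {x : ι × ℕ × ℕ × ℕ} :
    x ∈ 𝒞.step Tmax c T' ↔ x.2.1 < Tmax ∧
      x.2.2.1 < 𝒞.A c (𝒞.blk T') (𝒞.blk x.2.1) x.1 x.2.1 ∧
      x.2.2.2 < 𝒞.G c (𝒞.blk T') (𝒞.blk x.2.1) x.1 T' := by
  classical
  obtain ⟨j, T, u, v⟩ := x
  simp only [step, Finset.mem_biUnion, Finset.mem_range, Finset.mem_product,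
    Finset.mem_singleton, Finset.mem_univ, true_and]
  constructor
  · rintro ⟨⟨j', T₁⟩, h1, rfl, rfl, h2, h3⟩
    exact ⟨h1, h2, h3⟩
  · rintro ⟨h1, h2, h3⟩
    exact ⟨(j, T), h1, rfl, rfl, h2, h3⟩

theorem card_step_le [Fintype ι] (𝒞 : Chain ι) (Tmax c T' : ℕ) :
    (𝒞.step Tmax c T').card ≤ ∑ T ∈ Finset.range Tmax, 𝒞.cap c T' T := by
  classical
  refine Finset.card_biUnion_le.trans (le_of_eq ?_)
  rw [Finset.sum_product_right]
  refine Finset.sum_congr rfl fun T _ => ?_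
  simp [cap]

/-- A class with a filling of its cells is a path of prefix sums with a description of each step.
The path starts at 0, and from a given prefix sum at most `Φ c` steps are possible, so it is coded
by one number below `Φ c` per step. Blocks and total are functions of the path and are not counted
again. -/
theorem sum_prod_card_cell_le [Fintype ι] [Inhabited ι] (𝒞 : Chain ι) (g nb Tmax : ℕ) (Φ : ℕ → ℕ)
    (hΦ : ∀ c < g, ∀ T' < Tmax, ∑ T ∈ Finset.range Tmax, 𝒞.cap c T' T ≤ Φ c) :
    ∑ m : Class ι g nb Tmax, ∏ c ∈ Finset.range (g + 1), (𝒞.cell m c).card ≤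
      ∏ c ∈ Finset.range g, Φ c := by
  classical
  have hL : ∑ m : Class ι g nb Tmax, ∏ c ∈ Finset.range (g + 1), (𝒞.cell m c).card =
      ((Finset.univ : Finset (Class ι g nb Tmax)).sigma fun m =>
        Fintype.piFinset fun c : Fin (g + 1) => 𝒞.cell m c).card := by
    rw [Finset.card_sigma]
    refine Finset.sum_congr rfl fun m _ => ?_
    rw [Fintype.card_piFinset, Finset.prod_range]
  have hR : ∏ c ∈ Finset.range g, Φ c =
      (Fintype.piFinset fun c : Fin g => Finset.range (Φ c)).card := by
    rw [Fintype.card_piFinset, Finset.prod_range]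
    exact Finset.prod_congr rfl fun c _ => (Finset.card_range _).symm
  choose e he he' using fun c T' => exists_finset_index (𝒞.step Tmax c T')
  rw [hL, hR]
  have key : ∀ (x : (_ : Class ι g nb Tmax) × (Fin (g + 1) → ℕ × ℕ × ℕ)),
      (∀ c : Fin (g + 1), x.2 c ∈ 𝒞.cell x.1 c) → ∀ c : Fin g,
      (x.1.2.1 c, (x.2 c.succ).1, (x.2 c.succ).2.1, (x.2 c.castSucc).2.2) ∈
        𝒞.step Tmax c (x.2 c.castSucc).1 := by
    rintro ⟨m, y⟩ hy c
    have h1 := mem_cell.1 (hy c.succ)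
    have h2 := mem_cell.1 (hy c.castSucc)
    have hcomp : m.comp c = m.2.1 c := by simp [Class.comp]
    simp only [Fin.val_succ, Fin.val_castSucc, lateCard, earlyCard, Nat.succ_ne_zero,
      if_false, Nat.add_sub_cancel, c.2, if_true, hcomp] at h1 h2
    rw [mem_step]
    refine ⟨h1.1, ?_, ?_⟩
    · simp only; rw [h2.2.1, h1.2.1]; exact h1.2.2.2.2.1
    · simp only; rw [h2.2.1, h1.2.1]; exact h2.2.2.2.2.2
  refine Finset.card_le_card_of_injOn (fun x c => e c (x.2 c.castSucc).1
    (x.1.2.1 c, (x.2 c.succ).1, (x.2 c.succ).2.1, (x.2 c.castSucc).2.2)) ?_ ?_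
  · rintro x hx
    simp only [Finset.coe_sigma, Set.mem_sigma_iff, Finset.mem_coe, Fintype.mem_piFinset] at hx
    simp only [Finset.mem_coe, Fintype.mem_piFinset, Finset.mem_range]
    intro c
    refine (he' _ _ _ (key x hx.2 c)).trans_le ((𝒞.card_step_le _ _ _).trans ?_)
    exact hΦ c c.2 _ (mem_cell.1 (hx.2 c.castSucc)).1
  · rintro ⟨m, y⟩ hx ⟨m', y'⟩ hx' h
    simp only [Finset.coe_sigma, Set.mem_sigma_iff, Finset.mem_coe, Fintype.mem_piFinset]
      at hx hx'
    have hy := hx.2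
    have hy' := hx'.2
    have hstep : ∀ c : Fin g, (y c.castSucc).1 = (y' c.castSucc).1 →
        m.2.1 c = m'.2.1 c ∧ (y c.succ).1 = (y' c.succ).1 ∧ (y c.succ).2.1 = (y' c.succ).2.1 ∧
          (y c.castSucc).2.2 = (y' c.castSucc).2.2 := by
      intro c hc
      have h1 := congrFun h c
      have k1 := key ⟨m, y⟩ hy c
      have k2 := key ⟨m', y'⟩ hy' c
      simp only [← hc] at h1 k2
      have := he _ _ k1 k2 h1
      simpa using this
    -- The code is decoded from left to right: the index of a step can only be interpreted once the
    -- prefix sum before it is known.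
    have hT : ∀ c : Fin (g + 1), (y c).1 = (y' c).1 := by
      intro c
      induction c using Fin.induction with
      | zero =>
        rw [(mem_cell.1 (hy 0)).2.2.1 rfl, (mem_cell.1 (hy' 0)).2.2.1 rfl]
      | succ c ih => exact (hstep c ih).2.1
    have hu : ∀ c : Fin (g + 1), (y c).2.1 = (y' c).2.1 := by
      intro c
      induction c using Fin.cases with
      | zero =>
        have h1 := (mem_cell.1 (hy 0)).2.2.2.2.1
        have h2 := (mem_cell.1 (hy' 0)).2.2.2.2.1
        simp only [lateCard, Fin.val_zero, if_true] at h1 h2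
        omega
      | succ c => exact (hstep c (hT _)).2.2.1
    have hv : ∀ c : Fin (g + 1), (y c).2.2 = (y' c).2.2 := by
      intro c
      induction c using Fin.lastCases with
      | last =>
        have h1 := (mem_cell.1 (hy (Fin.last g))).2.2.2.2.2
        have h2 := (mem_cell.1 (hy' (Fin.last g))).2.2.2.2.2
        simp only [earlyCard, Fin.val_last, lt_irrefl, if_false] at h1 h2
        omega
      | cast c => exact (hstep c (hT _)).2.2.2
    have hyy : y = y' := funext fun c => Prod.ext (hT c) (Prod.ext (hu c) (hv c))
    have hmm : m = m' := by
      refine Prod.ext (funext fun c => Fin.ext ?_) (Prod.ext (funext fun c => ?_) (Fin.ext ?_))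
      · have h1 := (mem_cell.1 (hy c)).2.1
        have h2 := (mem_cell.1 (hy' c)).2.1
        simp only [Class.block, c.2, dif_pos] at h1 h2
        rw [← h1, ← h2, hT]
      · exact (hstep c (hT _)).1
      · have h1 := (mem_cell.1 (hy (Fin.last g))).2.2.2.1 rfl
        have h2 := (mem_cell.1 (hy' (Fin.last g))).2.2.2.1 rfl
        rw [← h1, ← h2, hT]
    rw [hyy, hmm]

/-- Sequences of keys of total value below `Tmax` can be stored in the cells of a chain that has
enough descriptions for the keys. -/
theorem exists_encoding [Fintype ι] [Inhabited ι] {κ : Type} (𝒞 : Chain ι) (g : ℕ) {nb Tmax : ℕ} (hTmax : 0 < Tmax)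
    (hblk : ∀ T < Tmax, 𝒞.blk T < nb) (δ : κ → ℕ) (S : Finset κ)
    (hcap : ∀ c < g, ∀ T' < Tmax, ∀ T < Tmax, (c = 0 → T' = 0) →
      (S.filter fun k => T' + δ k = T).card ≤ 𝒞.cap c T' T) :
    ∃ (m : List κ → Class ι g nb Tmax) (y : List κ → ℕ → ℕ × ℕ × ℕ),
      ∀ L : List κ, L.length = g → (∀ k ∈ L, k ∈ S) → (L.map δ).sum < Tmax →
        (∀ c < g + 1, y L c ∈ 𝒞.cell (m L) c) ∧
        (∀ c ≤ g, (y L c).1 = ((L.take c).map δ).sum) ∧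
        ((m L).2.2 : ℕ) = (L.map δ).sum ∧
        ∀ L' : List κ, L'.length = g → (∀ k ∈ L', k ∈ S) → (L'.map δ).sum < Tmax →
          m L = m L' → ∀ c < g, y L c = y L' c → y L (c + 1) = y L' (c + 1) →
            L[c]? = L'[c]? := by
  classical
  have : NeZero nb := ⟨(Nat.zero_lt_of_lt (hblk 0 hTmax)).ne'⟩
  have : NeZero Tmax := ⟨hTmax.ne'⟩
  -- For fixed `T'`, `T` the keys leading from one to the other are injected into triples of a
  -- component and two numbers. Outside the admissible range `θ` is a dummy.
  have hθ : ∀ c T' T, ∃ θ : κ → ι × ℕ × ℕ, c < g → T' < Tmax → T < Tmax → (c = 0 → T' = 0) →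
      Set.InjOn θ (S.filter fun k => T' + δ k = T) ∧ ∀ k ∈ S, T' + δ k = T →
        (θ k).2.1 < 𝒞.A c (𝒞.blk T') (𝒞.blk T) (θ k).1 T ∧
        (θ k).2.2 < 𝒞.G c (𝒞.blk T') (𝒞.blk T) (θ k).1 T' := by
    intro c T' T
    by_cases h : c < g ∧ T' < Tmax ∧ T < Tmax ∧ (c = 0 → T' = 0)
    · have hc := hcap c h.1 T' h.2.1 T h.2.2.1 h.2.2.2
      let s : Finset (ι × ℕ × ℕ) := (Finset.univ : Finset ι).biUnion fun j =>
        {j} ×ˢ (Finset.range (𝒞.A c (𝒞.blk T') (𝒞.blk T) j T) ×ˢ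
          Finset.range (𝒞.G c (𝒞.blk T') (𝒞.blk T) j T'))
      have hs : s.card = 𝒞.cap c T' T := by
        rw [Finset.card_biUnion]
        · simp [cap]
        · intro i _ j _ hij
          rw [Function.onFun, Finset.disjoint_left]
          rintro ⟨x, y⟩ h1 h2
          simp only [Finset.mem_product, Finset.mem_singleton] at h1 h2
          exact hij (h1.1.symm.trans h2.1)
      rw [← hs] at hc
      obtain ⟨f, hf, hf'⟩ := exists_injOn_of_card_le hc
      refine ⟨f, fun _ _ _ _ => ⟨hf', fun k hk hk' => ?_⟩⟩
      have := hf k (Finset.mem_filter.2 ⟨hk, hk'⟩)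
      simp only [s, Finset.mem_biUnion, Finset.mem_product, Finset.mem_range,
        Finset.mem_singleton, Finset.mem_univ, true_and] at this
      obtain ⟨j, rfl, h1, h2⟩ := this
      exact ⟨h1, h2⟩
    · exact ⟨fun _ => default, fun h1 h2 h3 h4 => absurd ⟨h1, h2, h3, h4⟩ h⟩
  choose θ hθ using hθ
  let T : List κ → ℕ → ℕ := fun L c => ((L.take c).map δ).sum
  let x : List κ → ℕ → ι × ℕ × ℕ := fun L c =>
    (L[c]?.map (θ c (T L c) (T L (c + 1)))).getD default
  -- The reductions modulo `nb` and `Tmax` only make `m` total; for admissible lists the values are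
  -- in range.
  let m : List κ → Class ι g nb Tmax := fun L =>
    (fun c => Fin.ofNat nb (𝒞.blk (T L c)), fun c => (x L c).1, Fin.ofNat Tmax (L.map δ).sum)
  let y : List κ → ℕ → ℕ × ℕ × ℕ := fun L c =>
    (T L c, if c = 0 then 0 else (x L (c - 1)).2.1, if c < g then (x L c).2.2 else 0)
  refine ⟨m, y, fun L hL hS hsum => ?_⟩
  have hTlt : ∀ L : List κ, (L.map δ).sum < Tmax → ∀ c, T L c < Tmax := by
    intro L hsum c
    refine lt_of_le_of_lt ?_ hsum
    calc T L c ≤ T L c + ((L.drop c).map δ).sum := Nat.le_add_right _ _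
      _ = (L.map δ).sum := by
        rw [← List.sum_append, ← List.map_append, List.take_append_drop]
  have hTs : ∀ (L : List κ) c (h : c < L.length), T L c + δ L[c] = T L (c + 1) := by
    intro L c h
    simp only [T]
    rw [List.take_succ_eq_append_getElem h, List.map_append, List.sum_append]; simp
  have hT0 : ∀ (L : List κ) c, c = 0 → T L c = 0 := by
    rintro L c rfl; simp [T]
  have hx : ∀ (L : List κ) c (h : c < L.length), x L c = θ c (T L c) (T L (c + 1)) L[c] := by
    intro L c h
    simp [x, List.getElem?_eq_getElem h]
  have hblock : ∀ c < g + 1, (m L).block c = 𝒞.blk (T L c) := by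
    intro c hc
    simp only [Class.block, hc, dif_pos, m, Fin.ofNat]
    exact Nat.mod_eq_of_lt (hblk _ (hTlt L hsum c))
  have hcomp : ∀ c < g, (m L).comp c = (x L c).1 := by
    intro c hc
    simp [Class.comp, hc, m]
  have hlast : ((m L).2.2 : ℕ) = (L.map δ).sum := Nat.mod_eq_of_lt hsum
  have hbd : ∀ c (h : c < g), (x L c).2.1 < 𝒞.A c (𝒞.blk (T L c)) (𝒞.blk (T L (c + 1)))
        (x L c).1 (T L (c + 1)) ∧
      (x L c).2.2 < 𝒞.G c (𝒞.blk (T L c)) (𝒞.blk (T L (c + 1))) (x L c).1 (T L c) := by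
    intro c h
    rw [hx L c (hL ▸ h)]
    exact (hθ c _ _ h (hTlt L hsum c) (hTlt L hsum (c + 1)) (hT0 L c)).2 _ (hS _ (List.getElem_mem _))
      (hTs L c (hL ▸ h))
  refine ⟨fun c hc => ?_, fun c _ => rfl, hlast, fun L' hL' hS' hsum' hm c hc h1 h2 => ?_⟩
  · refine mem_cell.2 ⟨hTlt L hsum c, (hblock c hc).symm, ?_, ?_, ?_, ?_⟩
    · rintro rfl; simp [y, T]
    · rintro rfl
      rw [hlast]; simp only [y, T]; rw [← hL, List.take_length]
    · simp only [y, lateCard]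
      split_ifs with h0
      · exact Nat.one_pos
      · obtain ⟨d, rfl⟩ := Nat.exists_eq_succ_of_ne_zero h0
        simp only [Nat.succ_eq_add_one, Nat.add_sub_cancel]
        rw [hblock d (by omega), hblock (d + 1) hc, hcomp d (by omega)]
        exact (hbd d (by omega)).1
    · simp only [y, earlyCard]
      split_ifs with h0
      · rw [hblock c hc, hblock (c + 1) (by omega), hcomp c h0]
        exact (hbd c h0).2
      · exact Nat.one_pos
  · have e0 : T L c = T L' c := congrArg Prod.fst h1
    have e1 : T L (c + 1) = T L' (c + 1) := congrArg Prod.fst h2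
    have e2 : (x L c).2.1 = (x L' c).2.1 := by
      have := congrArg (fun z => z.2.1) h2
      simpa [y] using this
    have e3 : (x L c).2.2 = (x L' c).2.2 := by
      have := congrArg (fun z => z.2.2) h1
      simpa [y, hc] using this
    have e4 : (x L c).1 = (x L' c).1 := by
      have := congrFun (congrArg (fun z => z.2.1) hm) ⟨c, hc⟩
      simpa [m] using this
    have hcL : c < L.length := hL ▸ hc
    have hcL' : c < L'.length := hL' ▸ hc
    have e5 : x L c = x L' c := Prod.ext e4 (Prod.ext e2 e3)
    rw [hx L c hcL, hx L' c hcL', ← e0, ← e1] at e5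
    rw [List.getElem?_eq_getElem hcL, List.getElem?_eq_getElem hcL']
    congr 1
    refine (hθ c _ _ hc (hTlt L hsum c) (hTlt L hsum (c + 1)) (hT0 L c)).1 ?_ ?_ e5
    · exact Finset.mem_coe.2 (Finset.mem_filter.2 ⟨hS _ (List.getElem_mem _), hTs L c hcL⟩)
    · refine Finset.mem_coe.2 (Finset.mem_filter.2 ⟨hS' _ (List.getElem_mem _), ?_⟩)
      rw [e0, e1]; exact hTs L' c hcL'

end Chain

/-! ### Iterated differences of binomial coefficients. -/

/-- The Leibniz rule for iterated forward differences. -/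
theorem fwdDiff_iter_mul (u v : ℕ → ℝ) (k s : ℕ) :
    ((fwdDiff 1)^[k] (fun x => u x * v x)) s =
      ∑ i ∈ Finset.range (k + 1), (k.choose i : ℝ) *
        (((fwdDiff 1)^[i] u) s * ((fwdDiff 1)^[k - i] v) (s + i)) := by
  induction k generalizing u v s with
  | zero => simp
  | succ k ih =>
    have h1 : (fwdDiff 1) (fun x => u x * v x) =
        (fun x => ((fwdDiff 1) u) x * v (x + 1)) + (fun x => u x * ((fwdDiff 1) v) x) := by
      funext x; simp only [fwdDiff, Pi.add_apply]; ring
    have hshift : ∀ (i x : ℕ), ((fwdDiff 1)^[i] (fun x => v (x + 1))) x = ((fwdDiff 1)^[i] v) (x + 1) :=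
      fun i x => fwdDiff_iter_comp_add 1 v 1 i x
    rw [Function.iterate_succ_apply, h1, fwdDiff_iter_add, Pi.add_apply, ih, ih,
      Finset.sum_choose_succ_mul (fun i j => ((fwdDiff 1)^[i] u) s * ((fwdDiff 1)^[j] v) (s + i)) k, add_comm]
    congr 1
    · refine Finset.sum_congr rfl fun i hi => ?_
      have : k + 1 - i = (k - i) + 1 := by have := Finset.mem_range.1 hi; omega
      rw [this, Function.iterate_succ_apply]
    · refine Finset.sum_congr rfl fun i _ => ?_
      rw [hshift, Function.iterate_succ_apply, add_assoc, add_comm i 1]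

theorem fwdDiff_iter_inv (i s : ℕ) :
    ((fwdDiff 1)^[i] (fun x : ℕ => ((x : ℝ) + 1)⁻¹)) s =
      (-1) ^ i * i.factorial / ((s + 1).ascFactorial (i + 1) : ℝ) := by
  induction i generalizing s with
  | zero => simp [Nat.ascFactorial]
  | succ i ih =>
    rw [Function.iterate_succ_apply', fwdDiff, ih, ih]
    have h1 : ((s + 1).ascFactorial (i + 1 + 1) : ℝ) =
        ((s + 1 : ℕ) + (i + 1 : ℕ) : ℝ) * (s + 1).ascFactorial (i + 1) := by
      rw [Nat.ascFactorial_succ]; push_cast; ring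
    have h2 : ((s + 1 : ℕ) : ℝ) * ((s + 1 + 1).ascFactorial (i + 1) : ℝ) =
        ((s + 1 : ℕ) + (i + 1 : ℕ) : ℝ) * (s + 1).ascFactorial (i + 1) := by
      have := Nat.succ_ascFactorial (s + 1) (i + 1)
      have h := congrArg (Nat.cast (R := ℝ)) this
      push_cast at h ⊢; linarith
    have p1 : (0 : ℝ) < (s + 1).ascFactorial (i + 1) := by
      exact_mod_cast Nat.ascFactorial_pos _ _
    have p2 : (0 : ℝ) < (s + 1 + 1).ascFactorial (i + 1) := by
      exact_mod_cast Nat.ascFactorial_pos _ _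
    rw [h1, Nat.factorial_succ, pow_succ]
    have e2 : ((s + 1 + 1).ascFactorial (i + 1) : ℝ) =
        ((s + 1 : ℕ) + (i + 1 : ℕ) : ℝ) * (s + 1).ascFactorial (i + 1) / (s + 1 : ℕ) := by
      rw [eq_div_iff (by positivity), mul_comm]; exact h2
    rw [e2]
    push_cast
    field_simp
    ring

/-- The iterated differences of binomial coefficients near the centre are small. -/
theorem abs_fwdDiff_iter_choose_le {l s N : ℕ} {θ : ℝ} (hθ : 0 ≤ θ)
    (h1 : 1 ≤ θ * (s + 1)) (h2 : (l : ℝ) + 1 ≤ (θ * (s + 1)) ^ 2)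
    (h0 : ∀ j < N, |((l : ℝ) + 1) / ((s + j : ℕ) + 1) - 2| ≤ θ) (k : ℕ) (hk : k ≤ N) :
    |((fwdDiff 1)^[k] (fun x => (l.choose x : ℝ))) s| ≤ k.factorial * θ ^ k * l.choose s := by
  set f : ℕ → ℝ := fun x => (l.choose x : ℝ) with hf
  set h : ℕ → ℝ := fun x => ((l : ℝ) + 1) / (x + 1) - 2 with hh
  -- The ratio of neighbouring binomial coefficients turns the difference into multiplication by
  -- `h`, so the Leibniz rule expresses each iterated difference by lower ones.
  have hfd : (fwdDiff 1) f = fun x => f x * h x := by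
    funext x
    have e : (l.choose (x + 1) : ℝ) * (x + 1) = l.choose x * (l - x) := by
      rcases le_or_gt x l with hx | hx
      · have := congrArg (Nat.cast (R := ℝ)) (Nat.choose_succ_right_eq l x)
        push_cast [Nat.cast_sub hx] at this
        exact this
      · rw [Nat.choose_eq_zero_of_lt hx, Nat.choose_eq_zero_of_lt (hx.trans (Nat.lt_succ_self x))]
        simp
    have hx : (x : ℝ) + 1 ≠ 0 := by positivity
    simp only [fwdDiff, hf, hh]
    have e' : (l.choose (x + 1) : ℝ) = l.choose x * (l - x) / (x + 1) := by
      rw [eq_div_iff hx, e]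
    rw [e']; field_simp; ring
  -- For `i = 0` this is closeness to the centre. For `i ≥ 1` the constant `2` drops out, and the
  -- differences of `1/(x+1)` decay like `i! / (s+1)^(i+1)`; one square of `θ(s+1)` absorbs the
  -- factor `l + 1`.
  have hη : ∀ i j, i + j < N → |((fwdDiff 1)^[i] h) (s + j)| ≤ i.factorial * θ ^ (i + 1) := by
    intro i j hij
    rcases Nat.eq_zero_or_pos i with rfl | hi
    · simpa [hh] using h0 j (by omega)
    · have hd : (fwdDiff 1)^[i] h = ((l : ℝ) + 1) • (fwdDiff 1)^[i] (fun x : ℕ => ((x : ℝ) + 1)⁻¹) := by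
        obtain ⟨i, rfl⟩ : ∃ i', i = i' + 1 := ⟨i - 1, by omega⟩
        rw [← fwdDiff_iter_const_smul, Function.iterate_succ_apply, Function.iterate_succ_apply]
        congr 1
        funext x
        simp only [fwdDiff, hh, Pi.smul_apply, smul_eq_mul]
        ring
      rw [hd, Pi.smul_apply, smul_eq_mul, fwdDiff_iter_inv, abs_mul, abs_div, abs_mul, abs_pow,
        abs_neg, abs_one, one_pow, one_mul, Nat.abs_cast, Nat.abs_cast,
        abs_of_nonneg (by positivity : (0 : ℝ) ≤ (l : ℝ) + 1), ← mul_div_assoc]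
      have p1 : (0 : ℝ) < (s + j + 1).ascFactorial (i + 1) := by
        exact_mod_cast Nat.ascFactorial_pos _ _
      rw [div_le_iff₀ p1]
      have p2 : ((s : ℝ) + 1) ^ (i + 1) ≤ (s + j + 1).ascFactorial (i + 1) := by
        have a1 : (s + 1) ^ (i + 1) ≤ (s + j + 1) ^ (i + 1) := Nat.pow_le_pow_left (by omega) _
        have a2 := Nat.pow_succ_le_ascFactorial (s + j + 1) (i + 1)
        exact_mod_cast a1.trans a2
      have p3 : (l : ℝ) + 1 ≤ (θ * (s + 1)) ^ (i + 1) :=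
        h2.trans (pow_le_pow_right₀ h1 (by omega))
      calc ((l : ℝ) + 1) * i.factorial ≤ (θ * (s + 1)) ^ (i + 1) * i.factorial := by gcongr
        _ = i.factorial * θ ^ (i + 1) * (s + 1) ^ (i + 1) := by rw [mul_pow]; ring
        _ ≤ _ := by gcongr
  induction k using Nat.strong_induction_on with
  | _ k ih =>
    rcases k with _ | k
    · simp [hf]
    · rw [Function.iterate_succ_apply, hfd, fwdDiff_iter_mul]
      refine (Finset.abs_sum_le_sum_abs _ _).trans ?_
      calc _ ≤ ∑ i ∈ Finset.range (k + 1), (k.factorial : ℝ) * θ ^ (k + 1) * l.choose s := by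
            refine Finset.sum_le_sum fun i hi => ?_
            have hik : i ≤ k := Nat.lt_succ_iff.1 (Finset.mem_range.1 hi)
            rw [abs_mul, abs_mul, Nat.abs_cast]
            have b1 := ih i (by omega) (by omega)
            have b2 := hη (k - i) i (by omega)
            have e3 : (k.choose i : ℝ) * i.factorial * (k - i).factorial = k.factorial := by
              exact_mod_cast Nat.choose_mul_factorial_mul_factorial hik
            have e4 : θ ^ i * θ ^ (k - i + 1) = θ ^ (k + 1) := by
              rw [← pow_add]; congr 1; omega
            calc (k.choose i : ℝ) * (|((fwdDiff 1)^[i] f) s| * |((fwdDiff 1)^[k - i] h) (s + i)|)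
                ≤ k.choose i * ((i.factorial * θ ^ i * l.choose s) *
                    ((k - i).factorial * θ ^ (k - i + 1))) := by gcongr
              _ = (k.choose i * i.factorial * (k - i).factorial) * (θ ^ i * θ ^ (k - i + 1)) *
                    l.choose s := by ring
              _ = _ := by rw [e3, e4]
        _ = _ := by
            rw [Finset.sum_const, Finset.card_range, nsmul_eq_mul, Nat.factorial_succ]
            push_cast; ring

/-! ### Approximating a Newton series by sums of products of natural numbers. -/

/-- The components of the decomposition of a polynomial of degree below `d`: one for the
constant, and three for every pair of exponents. -/
abbrev Component (d : ℕ) : Type := Option (Fin d × Fin d × Fin 3)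

/-- A nonnegative combination of products of functions with values in `[0, 1]` is approximated
from above by a sum of products of natural numbers. -/
theorem exists_nat_products {ι : Type} [Fintype ι] {H : ℕ} (ρ : ι → ℝ) (φ ψ : ι → ℕ → ℝ) {σ V : ℝ}
    (hσ : 0 ≤ σ) (hρ : ∀ j, 0 ≤ ρ j) (hρσ : ∀ j, ρ j ≤ σ ^ 2) (hσV : σ + 1 ≤ V)
    (hφ : ∀ j, ∀ x < H, 0 ≤ φ j x ∧ φ j x ≤ 1) (hψ : ∀ j, ∀ x < H, 0 ≤ ψ j x ∧ ψ j x ≤ 1) :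
    ∃ a g : ι → ℕ → ℕ, (∀ j x, (a j x : ℝ) ≤ V) ∧ (∀ j x, (g j x : ℝ) ≤ V) ∧
      ∀ x < H, ∀ x' < H, ∑ j, ρ j * φ j x * ψ j x' ≤ ∑ j, (a j x : ℝ) * g j x' ∧
        ∑ j, (a j x : ℝ) * g j x' ≤
          ∑ j, ρ j * φ j x * ψ j x' + Fintype.card ι * (2 * σ + 1) := by
  have hsq : ∀ j, √(ρ j) ≤ σ := fun j => Real.sqrt_le_iff.2 ⟨hσ, hρσ j⟩
  have bound : ∀ (j : ι) (t : ℝ), 0 ≤ t → t ≤ 1 → √(ρ j) * t ≤ ⌈√(ρ j) * t⌉₊ ∧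
      (⌈√(ρ j) * t⌉₊ : ℝ) ≤ √(ρ j) * t + 1 ∧ √(ρ j) * t ≤ σ := by
    intro j t h0 h1
    refine ⟨Nat.le_ceil _, (Nat.ceil_lt_add_one (by positivity)).le, ?_⟩
    calc √(ρ j) * t ≤ σ * 1 := mul_le_mul (hsq j) h1 h0 hσ
      _ = σ := mul_one σ
  -- The weight `ρ` is split evenly between the two factors: rounding up then costs at most `2σ + 1`
  -- per component, although the product itself may be of order `σ^2`.
  refine ⟨fun j x => if x < H then ⌈√(ρ j) * φ j x⌉₊ else 0,
    fun j x => if x < H then ⌈√(ρ j) * ψ j x⌉₊ else 0, fun j x => ?_, fun j x => ?_,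
    fun x hx x' hx' => ?_⟩
  · simp only
    split_ifs with hx
    · have := bound j _ (hφ j x hx).1 (hφ j x hx).2; linarith
    · rw [Nat.cast_zero]; linarith
  · simp only
    split_ifs with hx
    · have := bound j _ (hψ j x hx).1 (hψ j x hx).2; linarith
    · rw [Nat.cast_zero]; linarith
  · simp only [hx, hx', if_true]
    have hterm : ∀ j, ρ j * φ j x * ψ j x' = (√(ρ j) * φ j x) * (√(ρ j) * ψ j x') := by
      intro j
      rw [← Real.mul_self_sqrt (hρ j)]
      simp only [Real.sqrt_mul_self (Real.sqrt_nonneg _)]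
      ring
    refine ⟨Finset.sum_le_sum fun j _ => ?_, ?_⟩
    · have b1 := bound j _ (hφ j x hx).1 (hφ j x hx).2
      have b2 := bound j _ (hψ j x' hx').1 (hψ j x' hx').2
      rw [hterm]
      exact mul_le_mul b1.1 b2.1 (mul_nonneg (Real.sqrt_nonneg _) (hψ j x' hx').1) (by positivity)
    · have hc : (Fintype.card ι : ℝ) * (2 * σ + 1) = ∑ _j : ι, (2 * σ + 1) := by
        rw [Finset.sum_const, Finset.card_univ, nsmul_eq_mul]
      rw [hc, ← Finset.sum_add_distrib]
      refine Finset.sum_le_sum fun j _ => ?_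
      have b1 := bound j _ (hφ j x hx).1 (hφ j x hx).2
      have b2 := bound j _ (hψ j x' hx').1 (hψ j x' hx').2
      rw [hterm]
      have n1 : 0 ≤ √(ρ j) * φ j x := mul_nonneg (Real.sqrt_nonneg _) (hφ j x hx).1
      have n2 : 0 ≤ √(ρ j) * ψ j x' := mul_nonneg (Real.sqrt_nonneg _) (hψ j x' hx').1
      calc (⌈√(ρ j) * φ j x⌉₊ : ℝ) * ⌈√(ρ j) * ψ j x'⌉₊
          ≤ (√(ρ j) * φ j x + 1) * (√(ρ j) * ψ j x' + 1) := by gcongr; exacts [b1.2.1, b2.2.1]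
        _ ≤ _ := by nlinarith [b1.2.2, b2.2.2]

/-- A function given by a rapidly converging Newton series at `0` is approximated on sums
`x + x'` by few products of natural numbers depending on `x` and on `x'`. -/
theorem exists_products_of_newton {H d : ℕ} (F : ℕ → ℝ) (q : ℕ → ℝ) {t W σ V : ℝ}
    (hF : ∀ y < 2 * H, F y = ∑ k ∈ Finset.range (2 * H), (y.choose k : ℝ) * q k)
    (hd : 1 ≤ d) (ht0 : 0 ≤ t) (ht : t ≤ 1 / 2) (hdt : (d : ℝ) ^ 2 * t ≤ 1)
    (hq0 : 0 ≤ q 0) (hqW : q 0 ≤ W)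
    (hq : ∀ k < 2 * H, |q k| * (2 * H) ^ k ≤ k.factorial * t ^ k * q 0)
    (hσ : 0 ≤ σ) (hσt : W * t ≤ σ ^ 2) (hσV : σ + 1 ≤ V) (hWV : 3 * W + 1 ≤ V) :
    ∃ a g : Component d → ℕ → ℕ, (∀ j x, (a j x : ℝ) ≤ V) ∧ (∀ j x, (g j x : ℝ) ≤ V) ∧
      ∀ x < H, ∀ x' < H, F (x + x') ≤ ∑ j, (a j x : ℝ) * g j x' ∧
        ∑ j, (a j x : ℝ) * g j x' ≤
          F (x + x') + (4 * W * t ^ d + 1 + 3 * d ^ 2 * (2 * σ + 1)) := by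
  classical
  have hW : 0 ≤ W := hq0.trans hqW
  -- the weight of a pair of exponents
  let c : ℕ → ℕ → ℝ := fun a b =>
    if 1 ≤ a + b ∧ a + b < d ∧ a + b < 2 * H then q (a + b) else 0
  let ρ : ℕ → ℕ → ℝ := fun a b => (H.choose a : ℝ) * H.choose b
  let φ : ℕ → ℕ → ℝ := fun a x => (x.choose a : ℝ) / H.choose a
  have hφ : ∀ a, ∀ x < H, 0 ≤ φ a x ∧ φ a x ≤ 1 := by
    intro a x hx
    refine ⟨by positivity, div_le_one_of_le₀ ?_ (by positivity)⟩
    exact_mod_cast Nat.choose_le_choose a hx.le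
  have hφc : ∀ a, ∀ x < H, (H.choose a : ℝ) * φ a x = x.choose a := by
    intro a x hx
    rcases Nat.eq_zero_or_pos (H.choose a) with h0 | hpos
    · have : x.choose a = 0 := Nat.le_zero.1 (h0 ▸ Nat.choose_le_choose a hx.le)
      simp [h0, this]
    · have : (H.choose a : ℝ) ≠ 0 := by exact_mod_cast hpos.ne'
      simp only [φ]; field_simp
  have hqk : ∀ k < 2 * H, |q k| * ((2 * H).choose k : ℝ) ≤ t ^ k * q 0 := by
    intro k hk
    have h1 : ((2 * H).choose k : ℝ) ≤ (2 * H) ^ k / k.factorial := by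
      have := Nat.choose_le_pow_div (α := ℝ) k (2 * H)
      push_cast at this; exact this
    have h2 := hq k hk
    calc |q k| * ((2 * H).choose k : ℝ) ≤ |q k| * ((2 * H) ^ k / k.factorial) := by gcongr
      _ = |q k| * (2 * H) ^ k / k.factorial := by ring
      _ ≤ k.factorial * t ^ k * q 0 / k.factorial := by gcongr
      _ = t ^ k * q 0 := by field_simp
  have hρk : ∀ a b, ρ a b ≤ ((2 * H).choose (a + b) : ℝ) := by
    intro a b
    have h := Nat.add_choose_eq H H (a + b)
    rw [← two_mul] at h
    have h2 : H.choose a * H.choose b ≤ (2 * H).choose (a + b) := by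
      rw [h]
      exact Finset.single_le_sum (f := fun ij : ℕ × ℕ => H.choose ij.1 * H.choose ij.2)
        (fun _ _ => Nat.zero_le _) (Finset.HasAntidiagonal.mem_antidiagonal.2 rfl : (a, b) ∈ _)
    simp only [ρ]; exact_mod_cast h2
  have hcρ : ∀ a b, |c a b| * ρ a b ≤ t * q 0 := by
    intro a b
    simp only [c]
    split_ifs with h
    · calc |q (a + b)| * ρ a b ≤ |q (a + b)| * ((2 * H).choose (a + b) : ℝ) := by
            gcongr; exact hρk a b
        _ ≤ t ^ (a + b) * q 0 := hqk _ h.2.2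
        _ ≤ t ^ 1 * q 0 := by
            exact mul_le_mul_of_nonneg_right
              (pow_le_pow_of_le_one ht0 (by linarith) h.1) hq0
        _ = t * q 0 := by rw [pow_one]
    · rw [abs_zero, zero_mul]; positivity
  have hρ0 : ∀ a b, 0 ≤ ρ a b := fun a b => by positivity
  -- the polynomial part
  have hpoly : ∀ x < H, ∀ x' < H,
      |F (x + x') - (q 0 + ∑ ab : Fin d × Fin d,
        c ab.1 ab.2 * ((x.choose ab.1 : ℝ) * x'.choose ab.2))| ≤ 2 * W * t ^ d := by
    intro x hx x' hx'
    have hy : x + x' < 2 * H := by omega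
    have hH : 0 < 2 * H := by omega
    have e1 : ∑ ab : Fin d × Fin d, c ab.1 ab.2 * ((x.choose ab.1 : ℝ) * x'.choose ab.2) =
        ∑ k ∈ Finset.range (2 * H), if 1 ≤ k ∧ k < d then ((x + x').choose k : ℝ) * q k else 0 := by
      have e2 : ∀ k ∈ Finset.range (2 * H),
          (if 1 ≤ k ∧ k < d then ((x + x').choose k : ℝ) * q k else 0) =
          ∑ ij ∈ Finset.HasAntidiagonal.antidiagonal k, c ij.1 ij.2 * ((x.choose ij.1 : ℝ) * x'.choose ij.2) := by
        intro k hk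
        have hk' := Finset.mem_range.1 hk
        have e3 : ∀ ij ∈ Finset.HasAntidiagonal.antidiagonal k, c ij.1 ij.2 * ((x.choose ij.1 : ℝ) *
            x'.choose ij.2) = (if 1 ≤ k ∧ k < d then q k else 0) *
              ((x.choose ij.1 : ℝ) * x'.choose ij.2) := by
          intro ij hij
          rw [Finset.HasAntidiagonal.mem_antidiagonal] at hij
          simp only [c, hij, hk', and_true]
        rw [Finset.sum_congr rfl e3, ← Finset.mul_sum]
        -- Vandermonde's identity is what separates the variables.
        have e4 : ((x + x').choose k : ℝ) =
            ∑ ij ∈ Finset.HasAntidiagonal.antidiagonal k, (x.choose ij.1 : ℝ) * x'.choose ij.2 := by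
          rw [Nat.add_choose_eq]; push_cast; rfl
        rw [← e4]
        split_ifs
        · ring
        · ring
      rw [Finset.sum_congr rfl e2, Finset.sum_sigma']
      refine Finset.sum_bij_ne_zero
        (fun ab _ _ => ⟨(ab.1 : ℕ) + ab.2, ((ab.1 : ℕ), (ab.2 : ℕ))⟩) ?_ ?_ ?_ ?_
      · intro ab _ hne
        have hc : c ab.1 ab.2 ≠ 0 := left_ne_zero_of_mul hne
        simp only [c, ne_eq, ite_eq_right_iff, Classical.not_imp] at hc
        exact Finset.mem_sigma.2 ⟨Finset.mem_range.2 hc.1.2.2, Finset.HasAntidiagonal.mem_antidiagonal.2 rfl⟩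
      · rintro ⟨a, b⟩ _ _ ⟨a', b'⟩ _ _ h
        simp only [Sigma.mk.injEq, heq_eq_eq, Prod.mk.injEq] at h
        exact Prod.ext (Fin.ext h.2.1) (Fin.ext h.2.2)
      · rintro ⟨k, a, b⟩ hk hne
        rw [Finset.mem_sigma, Finset.HasAntidiagonal.mem_antidiagonal] at hk
        obtain rfl : a + b = k := hk.2
        have hc : c a b ≠ 0 := left_ne_zero_of_mul hne
        simp only [c, ne_eq, ite_eq_right_iff, Classical.not_imp] at hc
        exact ⟨(⟨a, by omega⟩, ⟨b, by omega⟩), Finset.mem_univ _, hne, rfl⟩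
      · intro ab _ _; rfl
    rw [hF _ hy, e1]
    have e5 : q 0 = ∑ k ∈ Finset.range (2 * H), if k = 0 then q 0 else 0 := by
      rw [Finset.sum_ite_eq' (Finset.range (2 * H)) 0 (fun _ => q 0)]; simp [hH]
    rw [e5, ← Finset.sum_add_distrib, ← Finset.sum_sub_distrib]
    refine (Finset.abs_sum_le_sum_abs _ _).trans ?_
    calc _ ≤ ∑ k ∈ Finset.range (2 * H), if d ≤ k then W * t ^ k else 0 := by
          refine Finset.sum_le_sum fun k hk => ?_
          have hk' := Finset.mem_range.1 hk
          rcases Nat.eq_zero_or_pos k with rfl | hk0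
          · have : ¬ d ≤ 0 := by omega
            simp [this]
          · by_cases hkd : k < d
            · have : ¬ d ≤ k := by omega
              have h3 : 1 ≤ k ∧ k < d := ⟨hk0, hkd⟩
              simp [h3, this, hk0.ne']
            · have h3 : ¬ (1 ≤ k ∧ k < d) := fun h => hkd h.2
              rw [if_neg h3, if_neg hk0.ne', if_pos (by omega), add_zero, sub_zero, abs_mul,
                Nat.abs_cast]
              calc ((x + x').choose k : ℝ) * |q k| ≤ ((2 * H).choose k : ℝ) * |q k| := by
                    gcongr
                _ = |q k| * ((2 * H).choose k : ℝ) := mul_comm _ _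
                _ ≤ t ^ k * q 0 := hqk k hk'
                _ ≤ W * t ^ k := by rw [mul_comm]; gcongr
      _ ≤ W * t ^ d * ∑ k ∈ Finset.range (2 * H), t ^ k := by
          rw [← Finset.sum_filter, Finset.mul_sum]
          have h6 : ((Finset.range (2 * H)).filter fun k => d ≤ k) = Finset.Ico d (2 * H) := by
            ext k; simp [and_comm]
          rw [h6, Finset.sum_Ico_eq_sum_range]
          calc ∑ i ∈ Finset.range (2 * H - d), W * t ^ (d + i)
              = ∑ i ∈ Finset.range (2 * H - d), W * t ^ d * t ^ i :=
                Finset.sum_congr rfl fun i _ => by rw [pow_add]; ring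
            _ ≤ _ := Finset.sum_le_sum_of_subset_of_nonneg
                (Finset.range_mono (by omega)) fun i _ _ => by positivity
      _ ≤ W * t ^ d * 2 := by
          gcongr
          have h7 : (1 - t) * ∑ k ∈ Finset.range (2 * H), t ^ k ≤ 1 := by
            rw [mul_neg_geom_sum]
            have : 0 ≤ t ^ (2 * H) := by positivity
            linarith
          have h8 : 0 ≤ ∑ k ∈ Finset.range (2 * H), t ^ k :=
            Finset.sum_nonneg fun _ _ => by positivity
          nlinarith
      _ = 2 * W * t ^ d := by ring
  -- the constant
  set E : ℝ := ∑ ab : Fin d × Fin d, max (-c ab.1 ab.2) 0 * ρ ab.1 ab.2 with hE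
  have hE0 : 0 ≤ E := Finset.sum_nonneg fun ab _ => mul_nonneg (le_max_right _ _) (hρ0 _ _)
  have hEq : E ≤ q 0 := by
    calc E ≤ ∑ _ab : Fin d × Fin d, t * q 0 := by
          refine Finset.sum_le_sum fun ab _ => le_trans ?_ (hcρ ab.1 ab.2)
          exact mul_le_mul_of_nonneg_right (max_le (neg_le_abs _) (abs_nonneg _)) (hρ0 _ _)
      _ = ((d : ℝ) ^ 2 * t) * q 0 := by
          rw [Finset.sum_const, Finset.card_univ, Fintype.card_prod, Fintype.card_fin,
            nsmul_eq_mul]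
          push_cast; ring
      _ ≤ 1 * q 0 := by gcongr
      _ = q 0 := one_mul _
  -- The constant pays back what the negative coefficients add, and includes the truncation error so
  -- that the approximation is from above. Nonnegativity needs `E ≤ q 0`, which is where `d^2 * t ≤
  -- 1` enters.
  set κ : ℝ := q 0 - E + 2 * W * t ^ d with hκ
  have htd : t ^ d ≤ 1 := pow_le_one₀ ht0 (by linarith)
  have hκ0 : 0 ≤ κ := by
    have : 0 ≤ 2 * W * t ^ d := by positivity
    linarith
  have hκW : κ ≤ 3 * W := by
    have : 2 * W * t ^ d ≤ 2 * W := mul_le_of_le_one_right (by positivity) htd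
    linarith
  -- A negative coefficient is made positive by `-φψ = (1-φ)ψ + (1-ψ) - 1`; hence three components
  -- per pair, and the `-1` moves into the constant.
  obtain ⟨a, g, ha, hg, hag⟩ := exists_nat_products (ι := Fin d × Fin d × Fin 3) (H := H)
    (fun j => (if j.2.2 = 0 then max (c j.1 j.2.1) 0 else max (-c j.1 j.2.1) 0) * ρ j.1 j.2.1)
    (fun j x => if j.2.2 = 0 then φ j.1 x else if j.2.2 = 1 then 1 - φ j.1 x else 1)
    (fun j x => if j.2.2 = 2 then 1 - φ j.2.1 x else φ j.2.1 x) (σ := σ) (V := V) hσ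
    (fun j => mul_nonneg (by split_ifs <;> exact le_max_right _ _) (hρ0 _ _))
    (fun j => by
      refine le_trans ?_ ((hcρ j.1 j.2.1).trans ?_)
      · refine mul_le_mul_of_nonneg_right ?_ (hρ0 _ _)
        · split_ifs
          · exact max_le (le_abs_self _) (abs_nonneg _)
          · exact max_le (neg_le_abs _) (abs_nonneg _)
      · refine le_trans ?_ hσt
        rw [mul_comm]; gcongr) hσV
    (fun j x hx => by
      have := hφ j.1 x hx
      split_ifs
      · exact this
      · constructor <;> linarith
      · norm_num)
    (fun j x hx => by
      have := hφ j.2.1 x hx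
      split_ifs
      · constructor <;> linarith
      · exact this)
  have hsum : ∀ x < H, ∀ x' < H, ∑ j : Fin d × Fin d × Fin 3,
      (if j.2.2 = 0 then max (c j.1 j.2.1) 0 else max (-c j.1 j.2.1) 0) * ρ j.1 j.2.1 *
        (if j.2.2 = 0 then φ j.1 x else if j.2.2 = 1 then 1 - φ j.1 x else 1) *
        (if j.2.2 = 2 then 1 - φ j.2.1 x' else φ j.2.1 x') =
      (∑ ab : Fin d × Fin d, c ab.1 ab.2 * ((x.choose ab.1 : ℝ) * x'.choose ab.2)) + E := by
    intro x hx x' hx'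
    rw [hE, ← Finset.sum_add_distrib, Fintype.sum_prod_type, Fintype.sum_prod_type]
    refine Finset.sum_congr rfl fun i _ => ?_
    rw [Fintype.sum_prod_type]
    refine Finset.sum_congr rfl fun b _ => ?_
    rw [Fin.sum_univ_three]
    have e1 : (1 : Fin 3) ≠ 0 := by decide
    have e2 : (2 : Fin 3) ≠ 0 := by decide
    have e3 : (2 : Fin 3) ≠ 1 := by decide
    have e4 : (0 : Fin 3) ≠ 2 := by decide
    have e5 : (1 : Fin 3) ≠ 2 := by decide
    simp only [if_true, e1, e2, e3, e4, e5, if_false]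
    rw [← hφc i x hx, ← hφc b x' hx']
    have e6 : c i b = max (c i b) 0 - max (-c i b) 0 := by
      rcases le_total 0 (c i b) with h | h
      · rw [max_eq_left h, max_eq_right (by linarith)]; ring
      · rw [max_eq_right h, max_eq_left (by linarith)]; ring
    simp only [ρ]
    linear_combination (-(H.choose i : ℝ) * φ i x * ((H.choose b : ℝ) * φ b x')) * e6
  -- The constant can be as large as `3 * W`. It is not split by square roots but multiplied by 1,
  -- so rounding it costs less than 1.
  refine ⟨fun j x => j.elim ⌈κ⌉₊ fun j => a j x, fun j x => j.elim 1 fun j => g j x, ?_, ?_,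
    fun x hx x' hx' => ?_⟩
  · rintro (_ | j) x
    · have := (Nat.ceil_lt_add_one hκ0).le
      simp only [Option.elim]; linarith
    · exact ha j x
  · rintro (_ | j) x
    · simp only [Option.elim, Nat.cast_one]; linarith
    · exact hg j x
  · obtain ⟨l1, l2⟩ := hag x hx x' hx'
    rw [hsum x hx x' hx'] at l1 l2
    have hp := abs_le.1 (hpoly x hx x' hx')
    have k1 := Nat.le_ceil κ
    have k2 := (Nat.ceil_lt_add_one hκ0).le
    rw [Fintype.sum_option]
    simp only [Option.elim, Nat.cast_one, mul_one]
    have hcard : (Fintype.card (Fin d × Fin d × Fin 3) : ℝ) = 3 * d ^ 2 := by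
      simp only [Fintype.card_prod, Fintype.card_fin]; push_cast; ring
    rw [hcard] at l2
    constructor
    · linarith
    · linarith

/-! ### Binomial weights and their tails. -/

/-- The expected number of the spillovers that decode to `s`. -/
noncomputable def binWeight (w l s : ℕ) : ℝ := (l.choose s : ℝ) * 2 ^ w / 2 ^ l

theorem binWeight_nonneg (w l s : ℕ) : 0 ≤ binWeight w l s := by
  unfold binWeight; positivity

theorem sum_binWeight (w l : ℕ) : ∑ s ∈ Finset.range (l + 1), binWeight w l s = 2 ^ w := by
  unfold binWeight
  rw [← Finset.sum_div, ← Finset.sum_mul]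
  have := Nat.sum_range_choose l
  have h : (∑ s ∈ Finset.range (l + 1), (l.choose s : ℝ)) = 2 ^ l := by exact_mod_cast this
  rw [h]; field_simp

theorem binWeight_le (w l s : ℕ) : binWeight w l s ≤ 2 ^ w := by
  rcases le_or_gt s l with h | h
  · rw [← sum_binWeight w l]
    exact Finset.single_le_sum (f := fun s => binWeight w l s)
      (fun _ _ => binWeight_nonneg _ _ _) (Finset.mem_range.2 (Nat.lt_succ_of_le h))
  · rw [binWeight, Nat.choose_eq_zero_of_lt h]; simp

/-- Chernoff's bound for the binomial coefficients far from the centre. -/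
theorem sum_choose_filter_mul_exp_le {l Z : ℕ} {t : ℝ} (ht : 0 ≤ t) :
    (∑ s ∈ (Finset.range (l + 1)).filter (fun s => ¬ (l ≤ 2 * s + 2 * Z ∧ 2 * s ≤ l + 2 * Z)),
      (l.choose s : ℝ)) * Real.exp (2 * Z * t) ≤ 2 * 2 ^ l * Real.exp (l * t ^ 2 / 2) := by
  have hexp : ∀ u : ℝ, ∑ s ∈ Finset.range (l + 1), Real.exp (u * (2 * s - l)) * l.choose s =
      (2 * Real.cosh u) ^ l := by
    intro u
    have e : 2 * Real.cosh u = Real.exp u + Real.exp (-u) := by rw [Real.cosh_eq]; ring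
    rw [e, add_pow]
    refine Finset.sum_congr rfl fun s hs => ?_
    have hs' : s ≤ l := Nat.lt_succ_iff.1 (Finset.mem_range.1 hs)
    rw [← Real.exp_nat_mul, ← Real.exp_nat_mul, ← Real.exp_add]
    congr 2
    push_cast [Nat.cast_sub hs']; ring
  have h1 : (2 * Real.cosh t) ^ l ≤ 2 ^ l * Real.exp (l * t ^ 2 / 2) := by
    rw [mul_pow]
    gcongr
    calc Real.cosh t ^ l ≤ Real.exp (t ^ 2 / 2) ^ l :=
          pow_le_pow_left₀ (Real.cosh_pos t).le (Real.cosh_le_exp_half_sq t) l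
      _ = _ := by rw [← Real.exp_nat_mul]; congr 1; ring
  have h2 := hexp t
  have h3 := hexp (-t)
  rw [Real.cosh_neg] at h3
  calc _ = ∑ s ∈ (Finset.range (l + 1)).filter
          (fun s => ¬ (l ≤ 2 * s + 2 * Z ∧ 2 * s ≤ l + 2 * Z)),
            (l.choose s : ℝ) * Real.exp (2 * Z * t) := Finset.sum_mul _ _ _
    _ ≤ ∑ s ∈ (Finset.range (l + 1)).filter
          (fun s => ¬ (l ≤ 2 * s + 2 * Z ∧ 2 * s ≤ l + 2 * Z)),
            (Real.exp (t * (2 * s - l)) * l.choose s +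
              Real.exp (-t * (2 * s - l)) * l.choose s) := by
        refine Finset.sum_le_sum fun s hs => ?_
        rw [← add_mul, mul_comm]
        refine mul_le_mul_of_nonneg_right ?_ (Nat.cast_nonneg _)
        have hs' := (Finset.mem_filter.1 hs).2
        rw [not_and_or, not_le, not_le] at hs'
        rcases hs' with hs' | hs'
        · have : (2 * (s : ℝ) + 2 * Z) ≤ l := by exact_mod_cast hs'.le
          refine le_trans ?_ (le_add_of_nonneg_left (Real.exp_pos _).le)
          exact Real.exp_le_exp.2 (by nlinarith)
        · have : (l : ℝ) + 2 * Z ≤ 2 * s := by exact_mod_cast hs'.le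
          refine le_trans ?_ (le_add_of_nonneg_right (Real.exp_pos _).le)
          exact Real.exp_le_exp.2 (by nlinarith)
    _ ≤ ∑ s ∈ Finset.range (l + 1), (Real.exp (t * (2 * s - l)) * l.choose s +
              Real.exp (-t * (2 * s - l)) * l.choose s) :=
        Finset.sum_le_sum_of_subset_of_nonneg (Finset.filter_subset _ _)
          fun _ _ _ => by positivity
    _ = 2 * (2 * Real.cosh t) ^ l := by rw [Finset.sum_add_distrib, h2, h3]; ring
    _ ≤ _ := by linarith

/-- Chernoff's bound with `t = w / Z`: since `Z` is at least of order `w√l`, the tails have relative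
mass at most about `2 * exp(1 - 2w)`, which is tiny even after scaling by `2^w`. -/
theorem sub_le_sum_binWeight {w l Z base : ℕ} (hw : 1 ≤ w) (hZ : 0 < Z)
    (hZw : (l : ℝ) * w ^ 2 ≤ 2 * Z ^ 2) (hbase : 2 * base + 2 * Z = l) :
    (2 : ℝ) ^ w - 3 ≤ ∑ s ∈ Finset.Icc base (base + 2 * Z), binWeight w l s := by
  have hZ0 : (0 : ℝ) < Z := by exact_mod_cast hZ
  have hc := sum_choose_filter_mul_exp_le (l := l) (Z := Z) (t := w / Z) (by positivity)
  set Q := ∑ s ∈ (Finset.range (l + 1)).filter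
    (fun s => ¬ (l ≤ 2 * s + 2 * Z ∧ 2 * s ≤ l + 2 * Z)), (l.choose s : ℝ) with hQ
  have e1 : 2 * (Z : ℝ) * (w / Z) = 2 * w := by field_simp
  have e2 : (l : ℝ) * (w / Z) ^ 2 / 2 ≤ 1 := by
    rw [div_pow, ← mul_div_assoc, div_div, div_le_one (by positivity)]
    linarith
  rw [e1] at hc
  have hQ2 : Q * 2 ^ w / 2 ^ l ≤ 3 := by
    have h2w : (2 : ℝ) ^ w ≤ Real.exp w := by
      have : (2 : ℝ) ≤ Real.exp 1 := by have := Real.add_one_le_exp 1; linarith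
      calc (2 : ℝ) ^ w ≤ Real.exp 1 ^ w := by gcongr
        _ = Real.exp w := by rw [← Real.exp_nat_mul, mul_one]
    have hexp : Real.exp (2 * w) = Real.exp w * Real.exp w := by rw [← Real.exp_add]; ring_nf
    have hle : Real.exp (l * (w / Z) ^ 2 / 2) ≤ Real.exp w := by
      refine Real.exp_le_exp.2 (e2.trans ?_)
      exact_mod_cast hw
    have hQ0 : 0 ≤ Q := Finset.sum_nonneg fun _ _ => Nat.cast_nonneg _
    have hpos := Real.exp_pos (w : ℝ)
    rw [div_le_iff₀ (by positivity)]
    have h3 : Q * Real.exp w ≤ 2 * 2 ^ l := by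
      refine le_of_mul_le_mul_right ?_ hpos
      calc Q * Real.exp w * Real.exp w = Q * Real.exp (2 * w) := by rw [hexp]; ring
        _ ≤ 2 * 2 ^ l * Real.exp (l * (w / Z) ^ 2 / 2) := hc
        _ ≤ 2 * 2 ^ l * Real.exp w := by gcongr
    have h4 : Q * 2 ^ w ≤ Q * Real.exp w := by gcongr
    have : (0 : ℝ) < 2 ^ l := by positivity
    linarith
  have hsplit := Finset.sum_filter_add_sum_filter_not (Finset.range (l + 1))
    (fun s => l ≤ 2 * s + 2 * Z ∧ 2 * s ≤ l + 2 * Z) (fun s => binWeight w l s)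
  rw [sum_binWeight] at hsplit
  have e3 : ∑ s ∈ (Finset.range (l + 1)).filter
      (fun s => ¬ (l ≤ 2 * s + 2 * Z ∧ 2 * s ≤ l + 2 * Z)), binWeight w l s =
      Q * 2 ^ w / 2 ^ l := by
    unfold binWeight; rw [hQ, ← Finset.sum_div, ← Finset.sum_mul]
  have e4 : (Finset.range (l + 1)).filter (fun s => l ≤ 2 * s + 2 * Z ∧ 2 * s ≤ l + 2 * Z) =
      Finset.Icc base (base + 2 * Z) := by
    ext s; simp only [Finset.mem_filter, Finset.mem_range, Finset.mem_Icc]; omega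
  rw [e3, e4] at hsplit
  linarith

/-! ### Product approximation of the binomial weights. -/

/-- Factors `a D j x`, `g D j x'` whose sum of products over `j` approximates the weights of the
sums `base + D * H + x - x'`, where `[base, base + 2 * Z]` is the range of the typical sums. -/
structure IsProductApprox (w l B Z H base : ℕ) (a g : ℕ → Component B → ℕ → ℕ) : Prop where
  one_le : 1 ≤ H
  le_base : H ≤ base + 1
  le_length : base + 2 * Z + 2 * H ≤ l + 2
  blocks : 2 * Z * B / H + 1 ≤ 2 ^ (11 * B ^ 2)
  mass : (2 : ℝ) ^ w - 3 ≤ ∑ s ∈ Finset.Icc base (base + 2 * Z), binWeight w l s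
  le_a : ∀ D j x, a D j x ≤ 2 ^ (w + 2)
  le_g : ∀ D j x, g D j x ≤ 2 ^ (w + 2)
  lower : ∀ D, D * H < 2 * Z + H → ∀ x < H, ∀ x' < H, ∀ s, s + x' = base + D * H + x →
    binWeight w l s ≤ ∑ j, (a D j x : ℝ) * g D j x'
  upper : ∀ D, D * H < 2 * Z + H → ∀ x < H, ∀ x' < H, ∀ s, s + x' = base + D * H + x →
    ∑ j, (a D j x : ℝ) * g D j x' ≤ binWeight w l s + 2 ^ (w / 2)

/-- For small `l` a block can be a single sum: the block difference `D` then is the value of the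
key, one constant component suffices, and only the rounding up is lost. -/
theorem exists_isProductApprox_of_lt {w l B : ℕ} (hl : Even l)
    (hsmall : l < 2 ^ (10 * B ^ 2)) :
    ∃ Z H base a g, IsProductApprox w l B Z H base a g := by
  obtain ⟨h, rfl⟩ := hl
  refine ⟨h, 1, 0, fun D j _ => j.elim ⌈binWeight w (h + h) D⌉₊ fun _ => 0, fun _ _ _ => 1,
    le_rfl, by omega, by omega, ?_, ?_, ?_, fun _ _ _ => Nat.one_le_two_pow, ?_, ?_⟩
  · rw [Nat.div_one]
    have h1 : B + 1 ≤ 2 ^ (B ^ 2) := by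
      refine le_trans ?_ (Nat.pow_le_pow_right (by norm_num) (Nat.le_self_pow two_ne_zero B))
      exact Nat.lt_two_pow_self
    calc 2 * h * B + 1 ≤ 2 ^ (10 * B ^ 2) * B + 2 ^ (10 * B ^ 2) := by
          refine Nat.add_le_add (Nat.mul_le_mul_right _ (by omega)) Nat.one_le_two_pow
      _ = 2 ^ (10 * B ^ 2) * (B + 1) := by ring
      _ ≤ 2 ^ (10 * B ^ 2) * 2 ^ (B ^ 2) := Nat.mul_le_mul_left _ h1
      _ = _ := by rw [← pow_add]; congr 1; ring
  · have : Finset.Icc 0 (0 + 2 * h) = Finset.range (h + h + 1) := by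
      ext s; simp only [Finset.mem_Icc, Finset.mem_range]; omega
    rw [this, sum_binWeight]; linarith
  · rintro D (_ | j) x
    · simp only [Option.elim]
      refine Nat.ceil_le.2 ((binWeight_le _ _ _).trans ?_)
      push_cast
      exact pow_le_pow_right₀ (by norm_num) (by omega)
    · simp
  · intro D _ x hx x' hx' s hs
    obtain rfl : s = D := by omega
    rw [Fintype.sum_option]
    simpa using Nat.le_ceil _
  · intro D _ x hx x' hx' s hs
    obtain rfl : s = D := by omega
    rw [Fintype.sum_option]
    have := (Nat.ceil_lt_add_one (binWeight_nonneg w (h + h) s)).le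
    have h1 : (1 : ℝ) ≤ 2 ^ (w / 2) := one_le_pow₀ (by norm_num)
    simp only [Option.elim, Nat.cast_one, mul_one, Nat.cast_zero, Finset.sum_const_zero, add_zero]
    linarith

set_option maxHeartbeats 800000 in
/-- The approximation of the weights near `s₀` by products. -/
theorem exists_products_binWeight {w l B X r Z H s₀ : ℕ} (hw : w = B ^ 3) (hwe : Even w)
    (hB : 10 ≤ B) (hX : X = 2 ^ B ^ 2) (hXB : 1024 * B ^ 6 ≤ X) (hrl : r ^ 2 ≤ l)
    (hlr : l ≤ 4 * r ^ 2) (hr1 : 1 ≤ r)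
    (hZ : Z = r * X) (hH1 : 1 ≤ H) (hH : H * X ^ 4 ≤ r) (hs : l ≤ 4 * (s₀ + 1))
    (hlo : l ≤ 2 * s₀ + 5 * Z + 1) (hhi : 2 * (s₀ + 2 * H) ≤ l + 5 * Z) :
    ∃ a g : Component B → ℕ → ℕ, (∀ j x, (a j x : ℝ) ≤ 2 ^ (w + 2)) ∧
      (∀ j x, (g j x : ℝ) ≤ 2 ^ (w + 2)) ∧
      ∀ x < H, ∀ x' < H, binWeight w l (s₀ + (x + x')) ≤ ∑ j, (a j x : ℝ) * g j x' ∧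
        ∑ j, (a j x : ℝ) * g j x' ≤ binWeight w l (s₀ + (x + x')) + 2 ^ (w / 2) := by
  set f : ℕ → ℝ := fun x => (l.choose x : ℝ) with hf
  have hl1 : 1 ≤ l := le_trans (Nat.one_le_pow _ _ hr1) hrl
  have hl0 : (0 : ℝ) < l := by exact_mod_cast hl1
  have hB1 : (10 : ℝ) ≤ B := by exact_mod_cast hB
  have hXr : (1024 : ℝ) * B ^ 6 ≤ X := by exact_mod_cast hXB
  have hB6 : (B : ℝ) ^ 2 ≤ B ^ 6 := pow_le_pow_right₀ (by linarith) (by norm_num)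
  have hB2 : (100 : ℝ) ≤ B ^ 2 := by nlinarith
  have hX0 : (1024 : ℝ) * B ^ 2 ≤ X := by linarith
  have hX1 : (102400 : ℝ) ≤ X := by linarith
  have hXpos : (0 : ℝ) < X := by linarith
  set S : ℝ := 2 ^ (w / 2) with hS
  have hSS : S ^ 2 = 2 ^ w := by
    rw [hS, ← pow_mul, Nat.div_mul_cancel hwe.two_dvd]
  have hSX : (X : ℝ) ≤ S := by
    rw [hS, hX]; push_cast
    refine pow_le_pow_right₀ (by norm_num) ?_
    rw [Nat.le_div_iff_mul_le (by norm_num), hw]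
    calc B ^ 2 * 2 ≤ B ^ 2 * B := Nat.mul_le_mul_left _ (by omega)
      _ = B ^ 3 := by ring
  have hXB' : (X : ℝ) ^ B = 2 ^ w := by
    rw [hX, hw]; push_cast; rw [← pow_mul]; congr 1
  -- In the relevant range `|l - 1 - 2s| ≤ 5Z` and `s + 1 ≥ l / 4`, so the logarithmic differences
  -- are at most `5Z / (l/4)`.
  set θ : ℝ := 20 * Z / l with hθ
  have hθ0 : 0 ≤ θ := by positivity
  have hZr : (Z : ℝ) = r * X := by rw [hZ]; push_cast; rfl
  have hrr : (r : ℝ) ^ 2 ≤ l := by exact_mod_cast hrl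
  have hlr' : (l : ℝ) ≤ 4 * r ^ 2 := by exact_mod_cast hlr
  have hr1' : (1 : ℝ) ≤ r := by exact_mod_cast hr1
  have hs' : (l : ℝ) ≤ 4 * (s₀ + 1) := by exact_mod_cast hs
  have hZr1 : (r : ℝ) ≤ Z := by rw [hZr]; nlinarith
  have hθs : 5 * Z ≤ θ * (s₀ + 1) := by
    rw [hθ, div_mul_eq_mul_div, le_div_iff₀ hl0]
    have : (0 : ℝ) ≤ Z := by positivity
    nlinarith
  have hD := abs_fwdDiff_iter_choose_le (l := l) (s := s₀) (N := 2 * H) hθ0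
    (by linarith) (by
      have h5 : (5 * (r : ℝ)) ^ 2 ≤ (θ * (s₀ + 1)) ^ 2 := by
        refine pow_le_pow_left₀ (by positivity) ?_ 2
        linarith
      nlinarith) (by
      intro j hj
      have hpos : (0 : ℝ) < ((s₀ + j : ℕ) : ℝ) + 1 := by positivity
      have hge : (l : ℝ) ≤ 4 * (((s₀ + j : ℕ) : ℝ) + 1) := by
        push_cast; have : (0 : ℝ) ≤ j := by positivity
        linarith
      have e : ((l : ℝ) + 1) / (((s₀ + j : ℕ) : ℝ) + 1) - 2 =
          ((l : ℝ) - 1 - 2 * (s₀ + j : ℕ)) / (((s₀ + j : ℕ) : ℝ) + 1) := by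
        field_simp; ring
      rw [e, abs_div, abs_of_pos hpos, div_le_iff₀ hpos]
      have hab : |(l : ℝ) - 1 - 2 * (s₀ + j : ℕ)| ≤ 5 * Z := by
        rw [abs_le]
        have k1 : 2 * (s₀ + j) + 1 ≤ l + 5 * Z := by omega
        have k2 : l ≤ 2 * (s₀ + j) + 5 * Z + 1 := by omega
        have k1' : 2 * ((s₀ + j : ℕ) : ℝ) + 1 ≤ l + 5 * Z := by exact_mod_cast k1
        have k2' : (l : ℝ) ≤ 2 * ((s₀ + j : ℕ) : ℝ) + 5 * Z + 1 := by exact_mod_cast k2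
        constructor <;> linarith
      refine hab.trans ?_
      rw [hθ, div_mul_eq_mul_div, le_div_iff₀ hl0]
      have : (0 : ℝ) ≤ Z := by positivity
      nlinarith)
  -- With `Z = rX`, `H ≤ r / X^4` and `r^2 ≤ l` the left side is at most `40 / X^3`.
  have ht : θ * (2 * H) ≤ 1 / X ^ 2 := by
    rw [hθ, div_mul_eq_mul_div, div_le_div_iff₀ hl0 (by positivity), one_mul]
    have hHr : (H : ℝ) * X ^ 4 ≤ r := by exact_mod_cast hH
    have h1 : 20 * (Z : ℝ) * (2 * H) * X ^ 2 * X ≤ l * X := by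
      calc 20 * (Z : ℝ) * (2 * H) * X ^ 2 * X = 40 * r * (H * X ^ 4) := by rw [hZr]; ring
        _ ≤ 40 * (r : ℝ) * r := by gcongr
        _ = 40 * (r : ℝ) ^ 2 := by ring
        _ ≤ X * l := by
          have : (0 : ℝ) ≤ (r : ℝ) ^ 2 := by positivity
          nlinarith
        _ = l * X := mul_comm _ _
    exact le_of_mul_le_mul_right h1 hXpos
  set cw : ℝ := 2 ^ w / 2 ^ l with hcw
  have hcw0 : 0 ≤ cw := by positivity
  have hP : ∀ s, binWeight w l s = f s * cw := fun s => by rw [binWeight, hcw, mul_div_assoc]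
  have hq0 : ((fwdDiff 1)^[0] f) s₀ * cw = binWeight w l s₀ := by rw [hP]; rfl
  -- Here `X^B = 2^w`, so degree `B` reduces the truncation error to `4 * 2^w * X^(-2B) ≤ 4`. The
  -- factors are of size at most `σ = S / X`, so all `3B^2` roundings together stay below `S =
  -- 2^(w/2)`.
  obtain ⟨a, g, ha, hg, hag⟩ := exists_products_of_newton (H := H) (d := B)
    (fun y => binWeight w l (s₀ + y)) (fun k => ((fwdDiff 1)^[k] f) s₀ * cw)
    (t := 1 / X ^ 2) (W := 2 ^ w) (σ := S / X) (V := 2 ^ (w + 2)) (by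
      intro y hy
      have h1 := shift_eq_sum_fwdDiff_iter 1 f y s₀
      simp only [smul_eq_mul, mul_one, nsmul_eq_mul] at h1
      simp only [hP]
      rw [h1, Finset.sum_mul]
      have h2 : Finset.range (y + 1) ⊆ Finset.range (2 * H) := Finset.range_mono (by omega)
      rw [Finset.sum_congr rfl fun k _ => mul_assoc _ _ _]
      refine Finset.sum_subset h2 fun k _ hk => ?_
      have : y < k := by simpa using hk
      rw [Nat.choose_eq_zero_of_lt this]; simp) (by omega) (by positivity)
    (by
      rw [div_le_div_iff₀ (by positivity) (by norm_num)]; nlinarith)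
    (by
      rw [mul_one_div, div_le_one (by positivity)]; nlinarith)
    (by rw [hq0]; exact binWeight_nonneg _ _ _) (by rw [hq0]; exact binWeight_le _ _ _)
    (by
      intro k hk
      rw [hq0, hP, abs_mul, abs_of_nonneg hcw0]
      have h1 := hD k hk.le
      have hf0 : 0 ≤ f s₀ := by simp only [hf]; positivity
      calc |((fwdDiff 1)^[k] f) s₀| * cw * (2 * H) ^ k
          ≤ (k.factorial * θ ^ k * f s₀) * cw * (2 * H) ^ k := by gcongr
        _ = k.factorial * (θ * (2 * H)) ^ k * (f s₀ * cw) := by rw [mul_pow]; ring_nf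
        _ ≤ k.factorial * (1 / X ^ 2) ^ k * (f s₀ * cw) := by gcongr)
    (by positivity) (by rw [div_pow, hSS, mul_one_div])
    (by
      have h1 : S / X ≤ S := div_le_self (by positivity) (by linarith)
      have h2 : (2 : ℝ) ^ (w + 2) = 4 * S ^ 2 := by rw [hSS]; ring
      rw [h2]
      nlinarith)
    (by
      have h2 : (2 : ℝ) ^ (w + 2) = 4 * 2 ^ w := by ring
      have : (1 : ℝ) ≤ 2 ^ w := one_le_pow₀ (by norm_num)
      linarith)
  refine ⟨a, g, ha, hg, fun x hx x' hx' => ⟨(hag x hx x' hx').1,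
    (hag x hx x' hx').2.trans (add_le_add_right ?_ _)⟩⟩
  have h3 : 4 * (2 : ℝ) ^ w * (1 / X ^ 2) ^ B ≤ 4 := by
    have : ((1 : ℝ) / X ^ 2) ^ B = 1 / (2 ^ w) ^ 2 := by
      rw [div_pow, one_pow, ← pow_mul, mul_comm 2 B, pow_mul, hXB']
    rw [this]
    have h1 : (1 : ℝ) ≤ 2 ^ w := one_le_pow₀ (by norm_num)
    rw [mul_one_div, div_le_iff₀ (by positivity)]
    nlinarith
  have h4 : 3 * (B : ℝ) ^ 2 * (2 * (S / X)) ≤ S / 100 := by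
    rw [← mul_div_assoc, ← mul_div_assoc, div_le_div_iff₀ hXpos (by norm_num)]
    have : (0 : ℝ) ≤ S := by positivity
    nlinarith
  have h5 : 3 * (B : ℝ) ^ 2 * (2 * (S / X) + 1) = 3 * (B : ℝ) ^ 2 * (2 * (S / X)) + 3 * B ^ 2 := by
    ring
  rw [h5]
  linarith

/-- The scale `X = 2^(B^2)` balances three demands: `Z = √l * X` covers all but a negligible tail,
`H = √l / X^4` makes the Newton series converge like powers of `X^(-2)`, and the number of blocks
remains `2^(O(B^2))`. -/
theorem exists_isProductApprox {w l B : ℕ} (hw : w = B ^ 3) (hwe : Even w) (hl : Even l)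
    (hB : 10 ≤ B) : ∃ Z H base a g, IsProductApprox w l B Z H base a g := by
  set X : ℕ := 2 ^ B ^ 2 with hX
  by_cases hsmall : l < 2 ^ (10 * B ^ 2)
  · exact exists_isProductApprox_of_lt hl hsmall
  have hX10 : 2 ^ (10 * B ^ 2) = X ^ 10 := by rw [hX, ← pow_mul]; congr 1; ring
  have hXB : 1024 * B ^ 6 ≤ X := by
    calc 1024 * B ^ 6 ≤ 2 ^ 10 * (2 ^ B) ^ 6 := by
          refine Nat.mul_le_mul (by norm_num) (Nat.pow_le_pow_left Nat.lt_two_pow_self.le 6)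
      _ = 2 ^ (10 + B * 6) := by rw [← pow_mul, ← pow_add]
      _ ≤ X := Nat.pow_le_pow_right (by norm_num) (by nlinarith)
  have hB6 : B ≤ B ^ 6 := Nat.le_self_pow (by norm_num) B
  have hX1 : 10240 ≤ X := by omega
  set r := Nat.sqrt l with hr
  have hrX : X ^ 5 ≤ r := by
    rw [hr, Nat.le_sqrt, ← pow_add, ← hX10]; exact not_lt.1 hsmall
  have hrl : r ^ 2 ≤ l := by rw [hr]; exact Nat.sqrt_le' l
  have hlr0 : l < (r + 1) ^ 2 := by rw [hr]; exact Nat.lt_succ_sqrt' l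
  have hr1 : 1 ≤ r := le_trans (Nat.one_le_pow _ _ (by omega)) hrX
  have hlr : l ≤ 4 * r ^ 2 := by nlinarith
  set Z := r * X with hZ
  set H := r / X ^ 4 with hH
  have hX4 : 0 < X ^ 4 := by positivity
  have hHr : H * X ^ 4 ≤ r := Nat.div_mul_le_self _ _
  have hrH : r < (H + 1) * X ^ 4 := by
    rw [hH, mul_comm]; exact Nat.lt_mul_div_succ _ hX4
  have hXH : X ≤ H := by
    rw [hH, Nat.le_div_iff_mul_le hX4]
    calc X * X ^ 4 = X ^ 5 := by ring
      _ ≤ r := hrX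
  have hHr' : H ≤ r := le_trans (Nat.le_mul_of_pos_right _ hX4) hHr
  have hrZ : 10240 * r ≤ Z := by rw [hZ, mul_comm]; exact Nat.mul_le_mul_left _ hX1
  have hX2 : X ^ 2 ≤ r := le_trans (Nat.pow_le_pow_right (by omega) (by norm_num)) hrX
  have hZl : 10240 * Z ≤ l := by
    calc 10240 * Z ≤ X * Z := Nat.mul_le_mul_right _ hX1
      _ = X ^ 2 * r := by rw [hZ]; ring
      _ ≤ r * r := Nat.mul_le_mul_right _ hX2
      _ = r ^ 2 := by ring
      _ ≤ l := hrl
  obtain ⟨h, rfl⟩ := hl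
  set base := h - Z with hbase
  have hbZ : base + Z = h := by omega
  have key : ∀ D, D * H < 2 * Z + H → ∃ a g : Component B → ℕ → ℕ,
      (∀ j x, (a j x : ℝ) ≤ 2 ^ (w + 2)) ∧ (∀ j x, (g j x : ℝ) ≤ 2 ^ (w + 2)) ∧
      ∀ x < H, ∀ x' < H, binWeight w (h + h) (base + D * H - (H - 1) + (x + x')) ≤
          ∑ j, (a j x : ℝ) * g j x' ∧
        ∑ j, (a j x : ℝ) * g j x' ≤
          binWeight w (h + h) (base + D * H - (H - 1) + (x + x')) + 2 ^ (w / 2) := by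
    intro D hD
    refine exists_products_binWeight (H := H) (Z := Z) hw hwe hB hX hXB hrl hlr hr1 hZ
      (by omega) hHr ?_ ?_ ?_
    · omega
    · omega
    · omega
  have key' : ∀ D, ∃ a g : Component B → ℕ → ℕ,
      (∀ j x, a j x ≤ 2 ^ (w + 2)) ∧ (∀ j x, g j x ≤ 2 ^ (w + 2)) ∧
      (D * H < 2 * Z + H → ∀ x < H, ∀ x' < H,
        binWeight w (h + h) (base + D * H - (H - 1) + (x + x')) ≤
          ∑ j, (a j x : ℝ) * g j x' ∧
        ∑ j, (a j x : ℝ) * g j x' ≤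
          binWeight w (h + h) (base + D * H - (H - 1) + (x + x')) + 2 ^ (w / 2)) := by
    intro D
    by_cases hD : D * H < 2 * Z + H
    · obtain ⟨a, g, h1, h2, h3⟩ := key D hD
      exact ⟨a, g, fun j x => by exact_mod_cast h1 j x, fun j x => by exact_mod_cast h2 j x,
        fun _ => h3⟩
    · exact ⟨fun _ _ => 0, fun _ _ => 0, fun _ _ => Nat.zero_le _, fun _ _ => Nat.zero_le _,
        fun h => absurd h hD⟩
  choose a g ha hg hag using key'
  -- The weight depends on the difference `x - x'`, the Newton lemma treats sums; reflecting `x'` to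
  -- `H - 1 - x'` converts one into the other.
  have hshift : ∀ D x x' s, x < H → x' < H → s + x' = base + D * H + x →
      s = base + D * H - (H - 1) + (x + (H - 1 - x')) := by
    intro D x x' s hx hx' hs
    omega
  refine ⟨Z, H, base, a, fun D j x' => g D j (H - 1 - x'), by omega, by omega, by omega, ?_, ?_,
    ha, fun D j x => hg D j _, ?_, ?_⟩
  · have h1 : 2 * Z * B / H ≤ 4 * B * X ^ 5 := by
      refine Nat.div_le_of_le_mul ?_
      have h2 : r ≤ 2 * H * X ^ 4 := by
        refine hrH.le.trans (Nat.mul_le_mul_right _ (by omega))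
      calc 2 * Z * B = 2 * X * B * r := by rw [hZ]; ring
        _ ≤ 2 * X * B * (2 * H * X ^ 4) := Nat.mul_le_mul_left _ h2
        _ = H * (4 * B * X ^ 5) := by ring
    have h3 : 2 ^ (11 * B ^ 2) = X ^ 11 := by rw [hX, ← pow_mul]; congr 1; ring
    rw [h3]
    calc 2 * Z * B / H + 1 ≤ 4 * B * X ^ 5 + X ^ 5 :=
          Nat.add_le_add h1 (Nat.one_le_pow _ _ (by omega))
      _ = (4 * B + 1) * X ^ 5 := by ring
      _ ≤ X * X ^ 5 := Nat.mul_le_mul_right _ (by omega)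
      _ = X ^ 6 := by ring
      _ ≤ X ^ 11 := Nat.pow_le_pow_right (by omega) (by norm_num)
  · refine sub_le_sum_binWeight ?_ (by omega) ?_ (by omega)
    · rw [hw]; exact Nat.one_le_pow _ _ (by omega)
    · have h1 : (h + h) * w ^ 2 ≤ 2 * Z ^ 2 := by
        have h2 : w ^ 2 ≤ X := by
          have : w ^ 2 = B ^ 6 := by rw [hw, ← pow_mul]
          omega
        calc (h + h) * w ^ 2 ≤ 4 * r ^ 2 * X := Nat.mul_le_mul hlr h2
          _ ≤ X * r ^ 2 * X := by gcongr; omega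
          _ = Z ^ 2 := by rw [hZ]; ring
          _ ≤ 2 * Z ^ 2 := by omega
      exact_mod_cast h1
  · intro D hD x hx x' hx' s hs
    have := (hag D hD x hx (H - 1 - x') (by omega)).1
    rwa [← hshift D x x' s hx hx' hs] at this
  · intro D hD x hx x' hx' s hs
    have := (hag D hD x hx (H - 1 - x') (by omega)).2
    rwa [← hshift D x x' s hx hx' hs] at this

/-! ### Good and bad keys and their chains. -/

theorem card_filter_sum_eq (l s : ℕ) :
    (Finset.univ.filter fun A : Fin l → Bool =>
      (Finset.univ.filter (A · = true)).card = s).card = l.choose s := by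
  rw [← Fintype.card_fin l, ← Finset.card_univ, ← Finset.card_powersetCard, Finset.card_univ,
    Fintype.card_fin]
  refine Finset.card_bij' (fun A _ => Finset.univ.filter (A · = true))
    (fun S _ i => decide (i ∈ S)) ?_ ?_ ?_ ?_
  · intro A hA
    exact Finset.mem_powersetCard.2 ⟨Finset.subset_univ _, (Finset.mem_filter.1 hA).2⟩
  · intro S hS
    rw [Finset.mem_filter]
    refine ⟨Finset.mem_univ _, ?_⟩
    rw [← (Finset.mem_powersetCard.1 hS).2]
    congr 1; ext i; simp
  · intro A _
    funext i; simp
  · intro S _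
    ext i; simp

/-- A sum decoder decodes every value from at least the expected number of spillovers. -/
theorem IsSumDecoder.binWeight_le {w l K : ℕ} {SUM : Fin K → Fin (l + 1)}
    (h : IsSumDecoder w l K SUM) (hwl : w ≤ l) (s : ℕ) :
    binWeight w l s ≤ ((Finset.univ.filter fun k => (SUM k : ℕ) = s).card : ℝ) := by
  obtain ⟨D, hD, hsum⟩ := h
  have h1 : (Finset.univ.filter fun A : Fin l → Bool =>
      (Finset.univ.filter (A · = true)).card = s).card ≤
      ((Finset.univ.filter fun k => (SUM k : ℕ) = s) ×ˢ
        (Finset.univ : Finset (Fin (l - w) → Bool))).card := by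
    refine Finset.card_le_card_of_injOn D ?_ hD.injOn
    intro A hA
    have := (Finset.mem_filter.1 (Finset.mem_coe.1 hA)).2
    simp only [Finset.coe_product, Set.mem_prod, Finset.mem_coe, Finset.mem_filter,
      Finset.mem_univ, true_and, and_true]
    rw [hsum, this]
  rw [card_filter_sum_eq, Finset.card_product, Finset.card_univ, Fintype.card_fun,
    Fintype.card_bool, Fintype.card_fin] at h1
  have h2 : (l.choose s : ℝ) ≤
      ((Finset.univ.filter fun k => (SUM k : ℕ) = s).card : ℝ) * 2 ^ (l - w) := by
    exact_mod_cast h1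
  have h3 : (2 : ℝ) ^ l = 2 ^ (l - w) * 2 ^ w := by rw [← pow_add]; congr 1; omega
  rw [binWeight, div_le_iff₀ (by positivity), h3, ← mul_assoc]
  gcongr

/-- The choice of the good keys: their values lie in the typical range, no value has more of
them than expected, and few keys are not good. -/
theorem IsSumDecoder.exists_good {w l σ Z base : ℕ} {SUM : Fin (2 ^ w + σ) → Fin (l + 1)}
    (h : IsSumDecoder w l (2 ^ w + σ) SUM) (hwl : w ≤ l) (hZ : 2 * Z ≤ l)
    (hmass : (2 : ℝ) ^ w - 3 ≤ ∑ s ∈ Finset.Icc base (base + 2 * Z), binWeight w l s) :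
    ∃ S : Finset (Fin (2 ^ w + σ)),
      (∀ k ∈ S, base ≤ (SUM k : ℕ) ∧ (SUM k : ℕ) ≤ base + 2 * Z) ∧
      (∀ s, ((S.filter fun k => (SUM k : ℕ) = s).card : ℝ) ≤ binWeight w l s) ∧
      Sᶜ.card ≤ σ + l + 4 := by
  classical
  -- Keeping only the integer part of the expected number makes the weights an upper bound for the
  -- good keys. Over the typical range the floors lose at most `l + 1` keys, the tail at most 3.
  have hex : ∀ s, ∃ G ⊆ Finset.univ.filter fun k => (SUM k : ℕ) = s,
      G.card = ⌊binWeight w l s⌋₊ := fun s =>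
    Finset.exists_subset_card_eq (by
      have := h.binWeight_le hwl s
      exact Nat.floor_le_of_le this)
  choose G hG hGc using hex
  have hGs : ∀ s, ∀ k ∈ G s, (SUM k : ℕ) = s := fun s k hk => (Finset.mem_filter.1 (hG s hk)).2
  refine ⟨(Finset.Icc base (base + 2 * Z)).biUnion G, ?_, ?_, ?_⟩
  · intro k hk
    obtain ⟨s, hs, hks⟩ := Finset.mem_biUnion.1 hk
    rw [hGs s k hks]
    exact Finset.mem_Icc.1 hs
  · intro s
    have hsub : ((Finset.Icc base (base + 2 * Z)).biUnion G).filter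
        (fun k => (SUM k : ℕ) = s) ⊆ G s := by
      intro k hk
      obtain ⟨hk1, hk2⟩ := Finset.mem_filter.1 hk
      obtain ⟨s', _, hks⟩ := Finset.mem_biUnion.1 hk1
      rw [← hk2, hGs s' k hks]; exact hks
    calc (_ : ℝ) ≤ ((G s).card : ℝ) := by exact_mod_cast Finset.card_le_card hsub
      _ = (⌊binWeight w l s⌋₊ : ℝ) := by rw [hGc]
      _ ≤ _ := Nat.floor_le (binWeight_nonneg _ _ _)
  · have hcard : ((Finset.Icc base (base + 2 * Z)).biUnion G).card =
        ∑ s ∈ Finset.Icc base (base + 2 * Z), ⌊binWeight w l s⌋₊ := by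
      rw [Finset.card_biUnion]
      · exact Finset.sum_congr rfl fun s _ => hGc s
      · intro s _ s' _ hss
        rw [Function.onFun, Finset.disjoint_left]
        intro k hk hk'
        exact hss ((hGs s k hk).symm.trans (hGs s' k hk'))
    have h1 : (2 : ℝ) ^ w - 3 - (l + 1) ≤
        ((Finset.Icc base (base + 2 * Z)).biUnion G).card := by
      rw [hcard]; push_cast
      calc (2 : ℝ) ^ w - 3 - (l + 1)
          ≤ (∑ s ∈ Finset.Icc base (base + 2 * Z), binWeight w l s) - (2 * Z + 1 : ℕ) := by
            have : ((2 * Z + 1 : ℕ) : ℝ) ≤ l + 1 := by exact_mod_cast Nat.succ_le_succ hZ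
            linarith
        _ = ∑ s ∈ Finset.Icc base (base + 2 * Z), (binWeight w l s - 1) := by
            rw [Finset.sum_sub_distrib, Finset.sum_const, Nat.card_Icc, nsmul_eq_mul, mul_one]
            congr 2; omega
        _ ≤ _ := Finset.sum_le_sum fun s _ => by
            have := Nat.lt_floor_add_one (binWeight w l s); linarith
    rw [Finset.card_compl, Fintype.card_fin]
    have h2 : 2 ^ w ≤ ((Finset.Icc base (base + 2 * Z)).biUnion G).card + (l + 4) := by
      have : (2 : ℝ) ^ w ≤ ((Finset.Icc base (base + 2 * Z)).biUnion G).card + (l + 4) := by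
        linarith
      exact_mod_cast this
    omega

/-- The chain for the good keys: blocks of length `H`. -/
def goodChain {B : ℕ} (Z H : ℕ) (a g : ℕ → Component B → ℕ → ℕ) : Chain (Component B) where
  blk T := T / H
  A _ β' β j T := if β' ≤ β ∧ (β - β') * H < 2 * Z + H then a (β - β') j (T % H) else 0
  G _ β' β j T' := g (β - β') j (T' % H)

namespace IsProductApprox

variable {w l B Z H base : ℕ} {a g : ℕ → Component B → ℕ → ℕ}

/-- The conditions `le_base` and `le_length` keep the index `base + T - T'` between 0 and `l` even
at the ends of the admissible blocks, so the truncated subtraction is harmless. -/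
theorem weight_index (hap : IsProductApprox w l B Z H base a g) {T' T : ℕ}
    (h : T' / H ≤ T / H ∧ (T / H - T' / H) * H < 2 * Z + H) :
    T' ≤ base + T ∧ base + T - T' ≤ l ∧
      base + T - T' + T' % H = base + (T / H - T' / H) * H + T % H := by
  have h1 := Nat.div_add_mod T H
  have h2 := Nat.div_add_mod T' H
  have h3 := Nat.mod_lt T hap.one_le
  have h4 := Nat.mod_lt T' hap.one_le
  have h5 := hap.le_base
  have h6 := hap.le_length
  have h7 : (T / H - T' / H) * H + H * (T' / H) = H * (T / H) := by
    rw [mul_comm _ H, ← Nat.mul_add, Nat.sub_add_cancel h.1]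
  have h8 := h.2
  refine ⟨by omega, by omega, by omega⟩

theorem card_le_cap (hap : IsProductApprox w l B Z H base a g) {κ : Type} (S : Finset κ)
    (sum : κ → ℕ) (hS : ∀ k ∈ S, base ≤ sum k ∧ sum k ≤ base + 2 * Z)
    (hcard : ∀ s, ((S.filter fun k => sum k = s).card : ℝ) ≤ binWeight w l s) (c T' T : ℕ) :
    (S.filter fun k => T' + (sum k - base) = T).card ≤ (goodChain Z H a g).cap c T' T := by
  rcases (S.filter fun k => T' + (sum k - base) = T).eq_empty_or_nonempty with he | ⟨k₀, hk₀⟩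
  · rw [he]; exact Nat.zero_le _
  · obtain ⟨hk₀, e₀⟩ := Finset.mem_filter.1 hk₀
    have hk₀' := hS k₀ hk₀
    have hTT : T' ≤ T := by omega
    have hH := hap.one_le
    have hdiv : T' / H ≤ T / H := Nat.div_le_div_right hTT
    have hcond : T' / H ≤ T / H ∧ (T / H - T' / H) * H < 2 * Z + H := by
      refine ⟨hdiv, ?_⟩
      have h1 := Nat.div_add_mod T H
      have h2 := Nat.div_add_mod T' H
      have h4 := Nat.mod_lt T' hH
      have h7 : (T / H - T' / H) * H + H * (T' / H) = H * (T / H) := by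
        rw [mul_comm _ H, ← Nat.mul_add, Nat.sub_add_cancel hdiv]
      omega
    obtain ⟨i1, i2, i3⟩ := hap.weight_index hcond
    have hlow := hap.lower _ hcond.2 (T % H) (Nat.mod_lt _ hH) (T' % H) (Nat.mod_lt _ hH) _ i3
    have hsub : (S.filter fun k => T' + (sum k - base) = T) ⊆
        S.filter fun k => sum k = base + T - T' := by
      intro k hk
      obtain ⟨hk, e⟩ := Finset.mem_filter.1 hk
      have := hS k hk
      exact Finset.mem_filter.2 ⟨hk, by omega⟩
    have h1 : ((S.filter fun k => T' + (sum k - base) = T).card : ℝ) ≤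
        ∑ j, (a (T / H - T' / H) j (T % H) : ℝ) * g (T / H - T' / H) j (T' % H) := by
      refine le_trans ?_ ((hcard _).trans hlow)
      exact_mod_cast Finset.card_le_card hsub
    have h2 : (goodChain Z H a g).cap c T' T =
        ∑ j, a (T / H - T' / H) j (T % H) * g (T / H - T' / H) j (T' % H) := by
      simp only [Chain.cap, goodChain, hcond, and_self, if_true]
    rw [h2]
    exact_mod_cast h1

/-- For fixed `T'` the admissible `T` correspond injectively to values in `[0, l]`. The weights of
all these values add up to `2^w`, and each value adds an error of at most `2^(w/2)`. -/
theorem sum_cap_le (hap : IsProductApprox w l B Z H base a g) (c T' Tmax : ℕ) :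
    ∑ T ∈ Finset.range Tmax, (goodChain Z H a g).cap c T' T ≤
      2 ^ w + (l + 1) * 2 ^ (w / 2) := by
  classical
  have hH := hap.one_le
  let Q : ℕ → Prop := fun T => T' / H ≤ T / H ∧ (T / H - T' / H) * H < 2 * Z + H
  have hcap : ∀ T, ((goodChain Z H a g).cap c T' T : ℝ) ≤
      if Q T then binWeight w l (base + T - T') + 2 ^ (w / 2) else 0 := by
    intro T
    by_cases hQ : Q T
    · rw [if_pos hQ]
      have hQ' : T' / H ≤ T / H ∧ (T / H - T' / H) * H < 2 * Z + H := hQ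
      have := hap.upper _ hQ'.2 (T % H) (Nat.mod_lt _ hH) (T' % H) (Nat.mod_lt _ hH) _
        (hap.weight_index hQ').2.2
      simp only [Chain.cap, goodChain, hQ', and_self, if_true]
      push_cast
      exact this
    · rw [if_neg hQ]
      have hQ' : ¬ (T' / H ≤ T / H ∧ (T / H - T' / H) * H < 2 * Z + H) := hQ
      simp only [Chain.cap, goodChain, hQ', if_false, zero_mul, Finset.sum_const_zero,
        Nat.cast_zero, le_refl]
  have h1 : (∑ T ∈ Finset.range Tmax, ((goodChain Z H a g).cap c T' T : ℝ)) ≤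
      2 ^ w + (l + 1) * 2 ^ (w / 2) := by
    calc _ ≤ ∑ T ∈ Finset.range Tmax,
            if Q T then binWeight w l (base + T - T') + 2 ^ (w / 2) else 0 :=
          Finset.sum_le_sum fun T _ => hcap T
      _ = ∑ T ∈ (Finset.range Tmax).filter Q,
            (binWeight w l (base + T - T') + 2 ^ (w / 2)) := (Finset.sum_filter _ _).symm
      _ = ∑ s ∈ ((Finset.range Tmax).filter Q).image (fun T => base + T - T'),
            (binWeight w l s + 2 ^ (w / 2)) := by
          rw [Finset.sum_image]
          intro T hT T₁ hT₁ e
          have i1 := (hap.weight_index (Finset.mem_filter.1 (Finset.mem_coe.1 hT)).2).1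
          have i2 := (hap.weight_index (Finset.mem_filter.1 (Finset.mem_coe.1 hT₁)).2).1
          simp only at e
          omega
      _ ≤ ∑ s ∈ Finset.range (l + 1), (binWeight w l s + 2 ^ (w / 2)) := by
          refine Finset.sum_le_sum_of_subset_of_nonneg ?_ fun s _ _ =>
            add_nonneg (binWeight_nonneg _ _ _) (by positivity)
          intro s hs
          obtain ⟨T, hT, rfl⟩ := Finset.mem_image.1 hs
          exact Finset.mem_range.2
            (Nat.lt_succ_of_le (hap.weight_index (Finset.mem_filter.1 hT).2).2.1)
      _ = _ := by
          rw [Finset.sum_add_distrib, sum_binWeight, Finset.sum_const, Finset.card_range,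
            nsmul_eq_mul]
          push_cast; ring
  exact_mod_cast h1

end IsProductApprox

/-- The chain for the bad keys: blocks of length `l + 1`. -/
def badChain {κ : Type} (l : ℕ) (S : Finset κ) (sum : κ → ℕ) : Chain Unit where
  blk U := U / (l + 1)
  A c β' β _ U :=
    if c = 0 then (S.filter fun k => sum k = U).card
    else if β = β' ∨ β = β' + 1 then S.card else 0
  G _ _ _ _ _ := 1

theorem card_le_cap_badChain {κ : Type} {l : ℕ} (S : Finset κ) (sum : κ → ℕ)
    (hsum : ∀ k, sum k ≤ l) {c T' T : ℕ} (hc : c = 0 → T' = 0) :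
    (S.filter fun k => T' + sum k = T).card ≤ (badChain l S sum).cap c T' T := by
  simp only [Chain.cap, badChain, Finset.univ_unique, Finset.sum_singleton, mul_one]
  split_ifs with h0 hβ
  · rw [hc h0]; simp
  · exact Finset.card_filter_le _ _
  · rw [Nat.le_zero, Finset.card_eq_zero, Finset.filter_eq_empty_iff]
    rintro k _ rfl
    apply hβ
    have h1 : T' / (l + 1) ≤ (T' + sum k) / (l + 1) := Nat.div_le_div_right (by omega)
    have h2 : (T' + sum k) / (l + 1) ≤ T' / (l + 1) + 1 := by
      rw [← Nat.add_div_right _ (Nat.succ_pos l)]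
      exact Nat.div_le_div_right (by have := hsum k; omega)
    omega

/-- The first bad key starts from the prefix sum 0, so its fibres are counted exactly. Later keys
allow every `T` in the current or next block, which costs `2(l+1)`. Without the exact first step
even a single bad key would cost a factor `l` in the space. -/
theorem sum_cap_badChain_le {κ : Type} {l : ℕ} (S : Finset κ) (sum : κ → ℕ) (c T' Tmax : ℕ) :
    ∑ T ∈ Finset.range Tmax, (badChain l S sum).cap c T' T ≤
      if c = 0 then S.card else 2 * (l + 1) * S.card := by
  simp only [Chain.cap, badChain, Finset.univ_unique, Finset.sum_singleton, mul_one]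
  split_ifs with h0
  · have h1 := Finset.card_eq_sum_card_fiberwise (s := S.filter fun k => sum k ∈ Finset.range Tmax)
      (t := Finset.range Tmax) (f := sum) (fun k hk => by
        simpa using (Finset.mem_filter.1 (Finset.mem_coe.1 hk)).2)
    calc ∑ T ∈ Finset.range Tmax, (S.filter fun k => sum k = T).card
        = ∑ T ∈ Finset.range Tmax,
          ((S.filter fun k => sum k ∈ Finset.range Tmax).filter fun k => sum k = T).card := by
          refine Finset.sum_congr rfl fun T hT => ?_
          congr 1; ext k
          simp only [Finset.mem_filter]
          constructor
          · rintro ⟨h1, rfl⟩; exact ⟨⟨h1, hT⟩, rfl⟩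
          · rintro ⟨⟨h1, _⟩, rfl⟩; exact ⟨h1, rfl⟩
      _ = _ := h1.symm
      _ ≤ _ := Finset.card_filter_le _ _
  · rw [← Finset.sum_filter, Finset.sum_const, smul_eq_mul]
    refine Nat.mul_le_mul_right _ ?_
    have hsub : (Finset.range Tmax).filter
        (fun T => T / (l + 1) = T' / (l + 1) ∨ T / (l + 1) = T' / (l + 1) + 1) ⊆
        Finset.Ico (T' / (l + 1) * (l + 1)) (T' / (l + 1) * (l + 1) + 2 * (l + 1)) := by
      intro T hT
      have h1 := (Finset.mem_filter.1 hT).2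
      have h2 := Nat.div_add_mod T (l + 1)
      have h3 : T % (l + 1) < l + 1 := Nat.mod_lt T (Nat.succ_pos l)
      rw [Finset.mem_Ico]
      rcases h1 with h1 | h1
      · rw [h1, mul_comm] at h2; omega
      · rw [h1, mul_comm, add_mul, one_mul] at h2; omega
    refine (Finset.card_le_card hsub).trans ?_
    rw [Nat.card_Ico]; omega

/-! ### Positions of the good and the bad keys within a tuple. -/

section Lists

variable {α : Type} (p : α → Bool)

theorem filter_take_eq (L : List α) (i : ℕ) :
    (L.filter p).take ((L.take i).countP p) = (L.take i).filter p := by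
  conv_lhs => rw [← List.take_append_drop i L, List.filter_append]
  rw [List.take_append_drop, List.countP_eq_length_filter, List.take_left']
  rfl

theorem getElem?_filter_countP (L : List α) (i : ℕ) (hi : i < L.length) (h : p L[i] = true) :
    (L.filter p)[(L.take i).countP p]? = some L[i] := by
  have e : L = L.take i ++ L[i] :: L.drop (i + 1) := by
    rw [List.getElem_cons_drop, List.take_append_drop]
  have hf := congrArg (List.filter p) e
  rw [List.filter_append, List.filter_cons_of_pos h] at hf
  rw [hf, List.countP_eq_length_filter, List.getElem?_append_right le_rfl, Nat.sub_self]
  rfl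

theorem sum_map_filter_add (L : List α) (f : α → ℕ) :
    ((L.filter p).map f).sum + ((L.filter fun a => !p a).map f).sum = (L.map f).sum := by
  induction L with
  | nil => rfl
  | cons a L ih =>
    by_cases h : p a
    · simp [h, ← ih, add_assoc]
    · simp [h, ← ih, add_left_comm]

end Lists

section Count

variable {B : ℕ}

/-- The number of the indices below `i` that lie outside of `J`. -/
def countOut (J : Finset (Fin B)) (i : ℕ) : ℕ :=
  ((List.finRange B).take i).countP fun j => !decide (j ∈ J)

/-- The number of the indices below `i` that lie in `J`. -/
def countIn (J : Finset (Fin B)) (i : ℕ) : ℕ :=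
  ((List.finRange B).take i).countP fun j => decide (j ∈ J)

theorem countOut_add_countIn (J : Finset (Fin B)) {i : ℕ} (hi : i ≤ B) :
    countOut J i + countIn J i = i := by
  have h := List.length_eq_countP_add_countP (fun j => decide (j ∈ J))
    (l := (List.finRange B).take i)
  rw [List.length_take, List.length_finRange, min_eq_left hi] at h
  rw [countOut, countIn, add_comm]
  refine Eq.trans ?_ h.symm
  congr 2
  funext j
  simp

theorem countIn_eq_card (J : Finset (Fin B)) : countIn J B = J.card := by
  have h : (List.finRange B).take B = List.finRange B :=
    List.take_of_length_le (by simp)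
  rw [countIn, h, List.countP_eq_length_filter,
    ← List.toFinset_card_of_nodup ((List.nodup_finRange B).filter _)]
  congr 1; ext j; simp

theorem countOut_eq (J : Finset (Fin B)) : countOut J B = B - J.card := by
  have := countOut_add_countIn J le_rfl
  rw [countIn_eq_card] at this
  omega

theorem countOut_mono (J : Finset (Fin B)) {i j : ℕ} (h : i ≤ j) :
    countOut J i ≤ countOut J j :=
  (List.take_sublist_take_left h).countP_le

theorem countIn_mono (J : Finset (Fin B)) {i j : ℕ} (h : i ≤ j) : countIn J i ≤ countIn J j :=
  (List.take_sublist_take_left h).countP_le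

theorem sum_Iic_eq_sum_take (f : Fin B → ℕ) (i : Fin B) :
    ∑ j ∈ Finset.Iic i, f j = (((List.finRange B).take (i + 1)).map f).sum := by
  rw [← List.sum_toFinset f ((List.nodup_finRange B).sublist (List.take_sublist _ _))]
  refine Finset.sum_congr ?_ fun _ _ => rfl
  ext j
  rw [Finset.mem_Iic, List.mem_toFinset, List.mem_take_iff_getElem]
  constructor
  · intro h
    exact ⟨j, by simp only [List.length_finRange]; omega, by simp⟩
  · rintro ⟨k, hk, rfl⟩
    rw [List.length_finRange] at hk
    rw [Fin.le_def]; simp; omega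

theorem sum_univ_eq_sum_map (f : Fin B → ℕ) : ∑ j, f j = ((List.finRange B).map f).sum := by
  rw [← List.sum_toFinset f (List.nodup_finRange B)]
  refine Finset.sum_congr ?_ fun _ _ => rfl
  ext j; simp

end Count

/-! ### Numerical estimates of the total weight. -/

theorem add_pow_le_pow_add_mul {Φ ω : ℝ} (hΦ : 0 ≤ Φ) (hω : 0 ≤ ω) (n : ℕ) :
    (Φ + ω) ^ (n + 1) ≤ Φ ^ (n + 1) + (n + 1) * ω * (Φ + ω) ^ n := by
  induction n with
  | zero => simp
  | succ n ih =>
    have h1 : Φ ^ (n + 1) ≤ (Φ + ω) ^ (n + 1) := pow_le_pow_left₀ hΦ (by linarith) _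
    calc (Φ + ω) ^ (n + 1 + 1) = (Φ + ω) * (Φ + ω) ^ (n + 1) := by ring
      _ ≤ (Φ + ω) * (Φ ^ (n + 1) + (n + 1) * ω * (Φ + ω) ^ n) := by gcongr
      _ = Φ ^ (n + 1 + 1) + ω * Φ ^ (n + 1) + (n + 1) * ω * (Φ + ω) ^ (n + 1) := by ring
      _ ≤ Φ ^ (n + 1 + 1) + ω * (Φ + ω) ^ (n + 1) + (n + 1) * ω * (Φ + ω) ^ (n + 1) := by gcongr
      _ = _ := by push_cast; ring

/-- The total weight of the sequences of `B` keys over all sets `J` of positions of bad keys. -/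
theorem sum_weight_le {B : ℕ} (hB : 1 ≤ B) {Φ b ω : ℝ} (hΦ : 0 ≤ Φ) (hb : 0 ≤ b) (hω : 0 < ω) :
    ∑ J : Finset (Fin B), Φ ^ (B - J.card) *
      ∏ c ∈ Finset.range J.card, (if c = 0 then b else ω) ≤
      Φ ^ B + b * B * (Φ + ω) ^ (B - 1) := by
  classical
  -- Replacing the first factor `b` by `ω` costs the fixed quotient `b / ω`; the sum over `J` then
  -- becomes the binomial expansion of `(Φ + ω)^B` without its empty term.
  have hprod : ∀ J : Finset (Fin B), J ≠ ∅ →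
      ∏ c ∈ Finset.range J.card, (if c = 0 then b else ω) = b / ω * ω ^ J.card := by
    intro J hJ
    obtain ⟨k, hk⟩ : ∃ k, J.card = k + 1 :=
      ⟨J.card - 1, by have := (Finset.nonempty_iff_ne_empty.2 hJ).card_pos; omega⟩
    rw [hk, Finset.prod_range_succ']
    simp only [Nat.succ_ne_zero, if_false, if_true, Finset.prod_const, Finset.card_range]
    field_simp
    ring
  have hsum := Fintype.sum_pow_mul_eq_add_pow (Fin B) ω Φ
  rw [Fintype.card_fin] at hsum
  rw [← Finset.add_sum_erase _ _ (Finset.mem_univ (∅ : Finset (Fin B)))] at hsum ⊢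
  simp only [Finset.card_empty, Nat.sub_zero, pow_zero, one_mul, Finset.range_zero,
    Finset.prod_empty, mul_one] at hsum ⊢
  have h1 : ∑ J ∈ Finset.univ.erase (∅ : Finset (Fin B)), Φ ^ (B - J.card) *
      ∏ c ∈ Finset.range J.card, (if c = 0 then b else ω) =
      b / ω * ((Φ + ω) ^ B - Φ ^ B) := by
    rw [add_comm Φ ω, ← hsum, add_sub_cancel_left, Finset.mul_sum]
    refine Finset.sum_congr rfl fun J hJ => ?_
    rw [hprod J (Finset.ne_of_mem_erase hJ)]; ring
  rw [h1]
  obtain ⟨n, rfl⟩ : ∃ n, B = n + 1 := ⟨B - 1, by omega⟩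
  have h2 := add_pow_le_pow_add_mul hΦ hω.le n
  rw [Nat.add_sub_cancel]
  refine add_le_add_right ?_ _
  calc b / ω * ((Φ + ω) ^ (n + 1) - Φ ^ (n + 1))
      ≤ b / ω * ((n + 1) * ω * (Φ + ω) ^ n) := by gcongr; linarith
    _ = _ := by push_cast; field_simp

theorem one_add_pow_le_exp {u x : ℝ} {n : ℕ} (hu : 0 ≤ u) (hx : n * u ≤ x) :
    (1 + u) ^ n ≤ Real.exp x := by
  calc (1 + u) ^ n ≤ Real.exp u ^ n := by
        gcongr; have := Real.add_one_le_exp u; linarith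
    _ = Real.exp (n * u) := (Real.exp_nat_mul u n).symm
    _ ≤ Real.exp x := Real.exp_le_exp.2 hx

theorem one_add_pow_le {u x : ℝ} {n : ℕ} (hu : 0 ≤ u) (hx : n * u ≤ x) (hx1 : x ≤ 1) :
    (1 + u) ^ n ≤ 1 + 2 * x := by
  have hx0 : 0 ≤ x := le_trans (by positivity) hx
  have h1 := one_add_pow_le_exp hu hx
  have h2 := (abs_le.1 (Real.abs_exp_sub_one_le (x := x) (by rwa [abs_of_nonneg hx0]))).2
  rw [abs_of_nonneg hx0] at h2
  linarith

/-- The total weight, including the losses by packing, is at most the space. -/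
theorem weight_numeric {B : ℕ} {l n σ s V : ℝ} (hB : 100 ≤ B) (hs : s ^ 2 = V) (hs0 : 0 < s)
    (hl : (B : ℝ) ^ 3 ≤ l) (hln : B * l ≤ n) (hσ : n * s ≤ σ) (hσV : σ * n ≤ V) :
    ((V + (l + 1) * s) ^ B + (σ + l + 4) * B *
      ((V + (l + 1) * s) + 2 * (l + 1) * (σ + l + 4)) ^ (B - 1)) * (1 + 4 / V) ^ (B + 2) ≤
      V ^ (B - 1) * (V + 25 * B * σ) := by
  have hB' : (100 : ℝ) ≤ B := by exact_mod_cast hB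
  have hl6 : (1000000 : ℝ) ≤ l := by
    have : (100 : ℝ) ^ 3 ≤ (B : ℝ) ^ 3 := by gcongr
    linarith
  have hBB : (B : ℝ) ^ 2 ≤ n := by nlinarith
  have hln' : 100 * l ≤ n := by nlinarith
  have hn : (100000000 : ℝ) ≤ n := by linarith
  have hσ0 : 0 < σ := lt_of_lt_of_le (by positivity) hσ
  have hns : n ^ 2 ≤ s := by
    have h1 : n * s * n ≤ s ^ 2 := by
      rw [hs]; exact le_trans (by gcongr) hσV
    have h2 : n ^ 2 * s ≤ s * s := by nlinarith
    exact le_of_mul_le_mul_right h2 hs0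
  have hsn : n ≤ s := by nlinarith
  have hsV : s ≤ V := by rw [← hs]; nlinarith
  have hV0 : 0 < V := lt_of_lt_of_le hs0 hsV
  have hσn : 10000 * n ≤ σ := by nlinarith
  have hσV' : σ ≤ V := by nlinarith
  have hBσ : 0 ≤ B * σ := by positivity
  -- the good part
  set u : ℝ := (l + 1) * s / V with hu
  have hu0 : 0 ≤ u := by positivity
  have hVu : V + (l + 1) * s = V * (1 + u) := by rw [hu]; field_simp
  have hBu : B * u ≤ 2 * σ / V := by
    rw [hu, ← mul_div_assoc]
    refine div_le_div_of_nonneg_right ?_ hV0.le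
    have h1 : (B : ℝ) * (l + 1) ≤ 2 * n := by nlinarith
    have h2 := mul_le_mul_of_nonneg_right h1 hs0.le
    linarith
  have hσV1 : 2 * σ / V ≤ 1 / 100 := by
    rw [div_le_div_iff₀ hV0 (by norm_num)]; nlinarith
  have hgood : (1 + u) ^ B ≤ 1 + 2 * (2 * σ / V) := one_add_pow_le hu0 hBu (by linarith)
  -- the bad part
  set b : ℝ := σ + l + 4 with hb
  have hb0 : 0 < b := by positivity
  have hbσ : b ≤ 1.01 * σ := by rw [hb]; linarith
  set v : ℝ := u + 2 * (l + 1) * b / V with hv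
  have hv0 : 0 ≤ v := by positivity
  have hVv : V * (1 + u) + 2 * (l + 1) * b = V * (1 + v) := by rw [hv]; field_simp; ring
  -- Since `B * l * σ ≤ n * σ ≤ V`, the wasteful factors of the bad chain multiply up to at most
  -- `exp 3 < 21`.
  have hBv : B * v ≤ 3 := by
    have h1 : B * (2 * (l + 1) * b / V) ≤ 2.1 := by
      rw [← mul_div_assoc, div_le_iff₀ hV0]
      have h2 : (l + 1) * b ≤ 1.01 * l * (1.01 * σ) := by
        gcongr
        linarith
      have h3 : B * l * σ ≤ n * σ := by gcongr
      nlinarith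
    rw [hv, mul_add]; linarith
  have hbad : (1 + v) ^ (B - 1) ≤ 21 := by
    have h1 : (((B - 1 : ℕ) : ℝ)) * v ≤ 3 := by
      refine le_trans ?_ hBv
      gcongr
      omega
    refine (one_add_pow_le_exp hv0 h1).trans ?_
    have h2 : Real.exp 3 = Real.exp 1 ^ 3 := by rw [← Real.exp_nat_mul]; norm_num
    have h3 := Real.exp_one_lt_d9
    rw [h2]
    calc Real.exp 1 ^ 3 ≤ 2.7182818286 ^ 3 := by gcongr
      _ ≤ 21 := by norm_num
  have hVB : V ^ B = V ^ (B - 1) * V := by rw [← pow_succ]; congr 1; omega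
  -- The good part exceeds `V` by at most `4σ`, the bad part contributes at most `1.01 * 21 * B *
  -- σ`; since `B ≥ 100`, together this is within `22 * B * σ`.
  have hS : (V * (1 + u)) ^ B + b * B * (V * (1 + v)) ^ (B - 1) ≤
      V ^ (B - 1) * (V + 22 * B * σ) := by
    rw [mul_pow, mul_pow, hVB]
    have h0 : 0 ≤ V ^ (B - 1) := by positivity
    have h1 : V * (1 + u) ^ B ≤ V + 4 * σ := by
      calc V * (1 + u) ^ B ≤ V * (1 + 2 * (2 * σ / V)) := by gcongr
        _ = V + 4 * σ := by field_simp; ring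
    have h2 : b * B * (1 + v) ^ (B - 1) ≤ 1.01 * σ * B * 21 := by gcongr
    calc V ^ (B - 1) * V * (1 + u) ^ B + b * B * (V ^ (B - 1) * (1 + v) ^ (B - 1))
        = V ^ (B - 1) * (V * (1 + u) ^ B + b * B * (1 + v) ^ (B - 1)) := by ring
      _ ≤ V ^ (B - 1) * (V + 22 * B * σ) := by
        refine mul_le_mul_of_nonneg_left ?_ h0
        nlinarith only [h1, h2, hB', hσ0]
  have hε : (1 + 4 / V) ^ (B + 2) ≤ 1 + 16 * B / V := by
    have h1 : ((B + 2 : ℕ) : ℝ) * (4 / V) ≤ 8 * B / V := by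
      rw [← mul_div_assoc]
      refine div_le_div_of_nonneg_right ?_ hV0.le
      push_cast
      linarith
    have h2 : 8 * B / V ≤ 1 := by
      rw [div_le_one hV0]; nlinarith only [hBB, hB', hsn, hsV]
    refine (one_add_pow_le (by positivity) h1 h2).trans (le_of_eq ?_)
    ring
  rw [hVu, hVv]
  calc ((V * (1 + u)) ^ B + b * B * (V * (1 + v)) ^ (B - 1)) * (1 + 4 / V) ^ (B + 2)
      ≤ (V ^ (B - 1) * (V + 22 * B * σ)) * (1 + 16 * B / V) := by gcongr
    _ = V ^ (B - 1) * (V + 22 * B * σ + 16 * B + 352 * B ^ 2 * σ / V) := by field_simp; ring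
    _ ≤ V ^ (B - 1) * (V + 25 * B * σ) := by
      have h1 : 352 * (B : ℝ) ^ 2 * σ / V ≤ 352 := by
        rw [div_le_iff₀ hV0]
        have h2 := mul_le_mul_of_nonneg_right hBB hσ0.le
        nlinarith only [h2, hσV]
      refine mul_le_mul_of_nonneg_left ?_ (by positivity)
      nlinarith only [h1, hB', hσn, hn]

/-! ### Joint classes for the good and the bad keys. -/

section Mixed

variable {B : ℕ}

/-- The entries of `z` at the positions selected by `p`. -/
def selectList {κ : Type} (p : Fin B → Bool) (z : Fin B → κ) : List κ :=
  ((List.finRange B).filter p).map z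

theorem length_selectList {κ : Type} (p : Fin B → Bool) (z : Fin B → κ) :
    (selectList p z).length = ((List.finRange B).take B).countP p := by
  rw [selectList, List.length_map, List.countP_eq_length_filter,
    List.take_of_length_le (by simp)]

theorem take_selectList {κ : Type} (p : Fin B → Bool) (z : Fin B → κ) (i : ℕ) :
    (selectList p z).take (((List.finRange B).take i).countP p) =
      (((List.finRange B).take i).filter p).map z := by
  rw [selectList, ← List.map_take, filter_take_eq]

theorem getElem?_selectList {κ : Type} (p : Fin B → Bool) (z : Fin B → κ) (i : Fin B)
    (hi : p i = true) :
    (selectList p z)[((List.finRange B).take i).countP p]? = some (z i) := by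
  rw [selectList, List.getElem?_map, getElem?_filter_countP p _ _ (by simp) (by simpa using hi)]
  simp

theorem mem_selectList {κ : Type} {p : Fin B → Bool} {z : Fin B → κ} {k : κ}
    (h : k ∈ selectList p z) : ∃ i, p i = true ∧ z i = k := by
  obtain ⟨i, hi, rfl⟩ := List.mem_map.1 h
  exact ⟨i, (List.mem_filter.1 hi).2, rfl⟩

/-- The classes of tuples of `B` keys: the set of the positions of the bad keys, and the classes
of the sequences of the good and of the bad keys. -/
abbrev MixedClass (ι ι' : Type) (B nb Tmax nb' Tmax' : ℕ) : Type :=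
  (J : Finset (Fin B)) ×
    (Chain.Class ι (countOut J B) nb Tmax × Chain.Class ι' (countIn J B) nb' Tmax')

namespace MixedClass

variable {ι ι' : Type} {nb Tmax nb' Tmax' : ℕ}

/-- The possible contents of the `c`-th cell: the cells of the good keys come first. -/
def cell [Inhabited ι] [Inhabited ι'] (𝒞 : Chain ι) (𝒞' : Chain ι')
    (m : MixedClass ι ι' B nb Tmax nb' Tmax') (c : ℕ) : Finset (ℕ × ℕ × ℕ) :=
  if c < countOut m.1 B + 1 then 𝒞.cell m.2.1 c else 𝒞'.cell m.2.2 (c - (countOut m.1 B + 1))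

/-- The first of the two cells that determine the key at position `i`. -/
def keyCell (m : MixedClass ι ι' B nb Tmax nb' Tmax') (i : Fin B) : ℕ :=
  if i ∈ m.1 then countOut m.1 B + 1 + countIn m.1 i else countOut m.1 i

/-- The total value of the tuples of the class. -/
def total (base : ℕ) (m : MixedClass ι ι' B nb Tmax nb' Tmax') : ℕ :=
  m.2.1.2.2 + countOut m.1 B * base + m.2.2.2.2

theorem card_eq_sum [Fintype ι] [Fintype ι'] :
    Fintype.card (MixedClass ι ι' B nb Tmax nb' Tmax') =
      ∑ J : Finset (Fin B), (nb ^ (countOut J B + 1) * (Fintype.card ι ^ countOut J B * Tmax)) *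
        (nb' ^ (countIn J B + 1) * (Fintype.card ι' ^ countIn J B * Tmax')) := by
  rw [Fintype.card_sigma]
  refine Finset.sum_congr rfl fun J _ => ?_
  simp only [Fintype.card_prod, Fintype.card_fun, Fintype.card_fin]

/-- Once `J` is fixed, the two chains use disjoint cells and independent classes, so the sum over
classes factors. A chain has one more cell than keys, hence `B + 2` cells in all. -/
theorem sum_prod_card_cell_le [Fintype ι] [Fintype ι'] [Inhabited ι] [Inhabited ι']
    (𝒞 : Chain ι) (𝒞' : Chain ι') (Φ Φ' : ℕ → ℕ)
    (hΦ : ∀ c T', ∑ T ∈ Finset.range Tmax, 𝒞.cap c T' T ≤ Φ c)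
    (hΦ' : ∀ c T', ∑ T ∈ Finset.range Tmax', 𝒞'.cap c T' T ≤ Φ' c) :
    ∑ m : MixedClass ι ι' B nb Tmax nb' Tmax', ∏ c ∈ Finset.range (B + 2), (cell 𝒞 𝒞' m c).card ≤
      ∑ J : Finset (Fin B), (∏ c ∈ Finset.range (B - J.card), Φ c) *
        ∏ c ∈ Finset.range J.card, Φ' c := by
  rw [Fintype.sum_sigma]
  refine Finset.sum_le_sum fun J _ => ?_
  have hB : B + 2 = (countOut J B + 1) + (countIn J B + 1) := by
    have := countOut_add_countIn J le_rfl; omega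
  calc ∑ m : Chain.Class ι (countOut J B) nb Tmax × Chain.Class ι' (countIn J B) nb' Tmax',
        ∏ c ∈ Finset.range (B + 2), (cell 𝒞 𝒞' ⟨J, m⟩ c).card
      = ∑ m : Chain.Class ι (countOut J B) nb Tmax × Chain.Class ι' (countIn J B) nb' Tmax',
        (∏ c ∈ Finset.range (countOut J B + 1), (𝒞.cell m.1 c).card) *
          ∏ c ∈ Finset.range (countIn J B + 1), (𝒞'.cell m.2 c).card := by
        refine Finset.sum_congr rfl fun m _ => ?_
        rw [hB, Finset.prod_range_add]
        congr 1
        · refine Finset.prod_congr rfl fun c hc => ?_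
          rw [cell, if_pos (Finset.mem_range.1 hc)]
        · refine Finset.prod_congr rfl fun c _ => ?_
          rw [cell, if_neg (Nat.not_lt.2 (Nat.le_add_right _ _)), Nat.add_sub_cancel_left]
    _ = (∑ m : Chain.Class ι (countOut J B) nb Tmax,
          ∏ c ∈ Finset.range (countOut J B + 1), (𝒞.cell m c).card) *
        ∑ m : Chain.Class ι' (countIn J B) nb' Tmax',
          ∏ c ∈ Finset.range (countIn J B + 1), (𝒞'.cell m c).card := by
        rw [Fintype.sum_prod_type, Finset.sum_mul_sum]
    _ ≤ (∏ c ∈ Finset.range (countOut J B), Φ c) * ∏ c ∈ Finset.range (countIn J B), Φ' c :=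
        Nat.mul_le_mul (𝒞.sum_prod_card_cell_le _ _ _ Φ fun c _ T' _ => hΦ c T')
          (𝒞'.sum_prod_card_cell_le _ _ _ Φ' fun c _ T' _ => hΦ' c T')
    _ = _ := by rw [countOut_eq, countIn_eq_card]

/-- Tuples of keys can be stored in the cells of two chains, one for the good and one for the
bad keys. -/
theorem exists_encoding [Fintype ι] [Inhabited ι] [Fintype ι'] [Inhabited ι'] {κ : Type}
    (𝒞 : Chain ι) (𝒞' : Chain ι') {Z l base : ℕ}
    (hZ : 2 * Z * B < Tmax) (hl : B * l < Tmax')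
    (hblk : ∀ T < Tmax, 𝒞.blk T < nb) (hblk' : ∀ T < Tmax', 𝒞'.blk T < nb')
    (S S' : Finset κ) (hSS : ∀ k, k ∉ S → k ∈ S') (sum : κ → ℕ) (hsum : ∀ k, sum k ≤ l)
    (hS : ∀ k ∈ S, base ≤ sum k ∧ sum k ≤ base + 2 * Z)
    (hcap : ∀ c T' T, (S.filter fun k => T' + (sum k - base) = T).card ≤ 𝒞.cap c T' T)
    (hcap' : ∀ c T' T, (c = 0 → T' = 0) →
      (S'.filter fun k => T' + sum k = T).card ≤ 𝒞'.cap c T' T) :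
    ∃ (m : (Fin B → κ) → MixedClass ι ι' B nb Tmax nb' Tmax')
      (y : (Fin B → κ) → ℕ → ℕ × ℕ × ℕ),
      (∀ z, ∀ c < B + 2, y z c ∈ cell 𝒞 𝒞' (m z) c) ∧
      (∀ z, total base (m z) = ∑ j, sum (z j)) ∧
      (∀ z (i : Fin B), ∑ j ∈ Finset.Iic i, sum (z j) =
        (y z (countOut (m z).1 (i + 1))).1 + countOut (m z).1 (i + 1) * base +
          (y z (countOut (m z).1 B + 1 + countIn (m z).1 (i + 1))).1) ∧
      ∀ z z' (i : Fin B), m z = m z' → y z (keyCell (m z) i) = y z' (keyCell (m z) i) →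
        y z (keyCell (m z) i + 1) = y z' (keyCell (m z) i + 1) → z i = z' i := by
  classical
  choose mG yG hG using fun g => 𝒞.exists_encoding g (nb := nb) (Nat.zero_lt_of_lt hZ) hblk
    (fun k => sum k - base) S fun c _ T' _ T _ _ => hcap c T' T
  choose mB yB hB using fun g => 𝒞'.exists_encoding g (nb := nb') (Nat.zero_lt_of_lt hl) hblk'
    sum S' fun c _ T' _ T _ h => hcap' c T' T h
  let J : (Fin B → κ) → Finset (Fin B) := fun z => Finset.univ.filter fun i => z i ∉ S
  let out : Finset (Fin B) → Fin B → Bool := fun J j => !decide (j ∈ J)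
  let inn : Finset (Fin B) → Fin B → Bool := fun J j => decide (j ∈ J)
  have hJ : ∀ z i, i ∈ J z ↔ z i ∉ S := fun z i => by simp [J]
  -- the sequences of the good and of the bad keys
  have hlenO : ∀ J (z : Fin B → κ), (selectList (out J) z).length = countOut J B :=
    fun J z => length_selectList _ z
  have hlenI : ∀ J (z : Fin B → κ), (selectList (inn J) z).length = countIn J B :=
    fun J z => length_selectList _ z
  have hmemO : ∀ z, ∀ k ∈ selectList (out (J z)) z, k ∈ S := by
    intro z k hk
    obtain ⟨i, hi, rfl⟩ := mem_selectList hk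
    by_contra h
    simp [out, (hJ z i).2 h] at hi
  have hmemI : ∀ z, ∀ k ∈ selectList (inn (J z)) z, k ∈ S' := by
    intro z k hk
    obtain ⟨i, hi, rfl⟩ := mem_selectList hk
    exact hSS _ ((hJ z i).1 (by simpa [inn] using hi))
  have hOle : ∀ J : Finset (Fin B), countOut J B ≤ B := fun J => by
    have := countOut_add_countIn J le_rfl; omega
  have hIle : ∀ J : Finset (Fin B), countIn J B ≤ B := fun J => by
    have := countOut_add_countIn J le_rfl; omega
  have hsumO : ∀ z, ((selectList (out (J z)) z).map fun k => sum k - base).sum < Tmax := by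
    intro z
    refine lt_of_le_of_lt ?_ hZ
    refine (List.sum_le_card_nsmul _ (2 * Z) ?_).trans ?_
    · intro x hx
      obtain ⟨k, hk, rfl⟩ := List.mem_map.1 hx
      have := hS k (hmemO z k hk); omega
    · rw [List.length_map, hlenO, smul_eq_mul, mul_comm]
      exact Nat.mul_le_mul_left _ (hOle _)
  have hsumI : ∀ z, ((selectList (inn (J z)) z).map sum).sum < Tmax' := by
    intro z
    refine lt_of_le_of_lt ?_ hl
    refine (List.sum_le_card_nsmul _ l ?_).trans ?_
    · intro x hx
      obtain ⟨k, _, rfl⟩ := List.mem_map.1 hx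
      exact hsum k
    · rw [List.length_map, hlenI, smul_eq_mul]
      exact Nat.mul_le_mul_right _ (hIle _)
  have hO := fun z => hG _ _ (hlenO (J z) z) (hmemO z) (hsumO z)
  have hI := fun z => hB _ _ (hlenI (J z) z) (hmemI z) (hsumI z)
  have hadd : ∀ z (i : ℕ), i ≤ B →
      (((List.finRange B).take i).map fun j => sum (z j)).sum =
        (((selectList (out (J z)) z).take (countOut (J z) i)).map fun k => sum k - base).sum +
          countOut (J z) i * base +
          (((selectList (inn (J z)) z).take (countIn (J z) i)).map sum).sum := by
    intro z i _
    rw [← sum_map_filter_add (out (J z)), countOut, countIn, take_selectList, take_selectList]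
    congr 1
    · rw [List.countP_eq_length_filter]
      have hmem : ∀ j ∈ ((List.finRange B).take i).filter (out (J z)), base ≤ sum (z j) := by
        intro j hj
        refine (hS _ ?_).1
        by_contra h
        have := (List.mem_filter.1 hj).2
        simp [out, (hJ z j).2 h] at this
      change _ = _ + (((List.finRange B).take i).filter (out (J z))).length * base
      generalize ((List.finRange B).take i).filter (out (J z)) = L at hmem
      induction L with
      | nil => simp
      | cons j L ih =>
        have h1 := ih fun j hj => hmem j (List.mem_cons_of_mem _ hj)
        have h2 := hmem j List.mem_cons_self
        simp only [List.map_cons, List.sum_cons, List.length_cons, add_mul, one_mul]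
        omega
    · rw [List.map_map]
      congr 3
      funext j
      simp [out]
  let m : (Fin B → κ) → MixedClass ι ι' B nb Tmax nb' Tmax' := fun z =>
    ⟨J z, mG _ (selectList (out (J z)) z), mB _ (selectList (inn (J z)) z)⟩
  let y : (Fin B → κ) → ℕ → ℕ × ℕ × ℕ := fun z c =>
    if c < countOut (J z) B + 1 then yG (countOut (J z) B) (selectList (out (J z)) z) c
    else yB (countIn (J z) B) (selectList (inn (J z)) z) (c - (countOut (J z) B + 1))
  have hyO : ∀ z c, c ≤ countOut (J z) B → y z c = yG (countOut (J z) B) (selectList (out (J z)) z) c :=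
    fun z c hc => if_pos (Nat.lt_succ_of_le hc)
  have hyI : ∀ z c, y z (countOut (J z) B + 1 + c) = yB (countIn (J z) B) (selectList (inn (J z)) z) c := by
    intro z c
    simp only [y]
    rw [if_neg (by omega), Nat.add_sub_cancel_left]
  refine ⟨m, y, ?_, ?_, ?_, ?_⟩
  · intro z c hc
    have := countOut_add_countIn (J z) le_rfl
    by_cases h : c < countOut (J z) B + 1
    · simp only [cell, y, m]
      rw [if_pos h, if_pos h]
      exact (hO z).1 c h
    · simp only [cell, y, m]
      rw [if_neg h, if_neg h]
      exact (hI z).1 _ (by omega)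
  · intro z
    have h1 := hadd z B le_rfl
    rw [← hlenO, ← hlenI (J z) z, List.take_length, List.take_length, hlenO,
      List.take_of_length_le (by simp)] at h1
    rw [sum_univ_eq_sum_map, h1, ← (hI z).2.2.1, ← (hO z).2.2.1]
    rfl
  · intro z i
    have h1 := hadd z (i + 1) i.2
    rw [sum_Iic_eq_sum_take (fun j => sum (z j)), h1]
    change _ = (y z (countOut (J z) (i + 1))).1 + countOut (J z) (i + 1) * base +
      (y z (countOut (J z) B + 1 + countIn (J z) (i + 1))).1
    rw [hyI, hyO z _ (countOut_mono _ i.2), (hO z).2.1 _ (countOut_mono _ i.2),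
      (hI z).2.1 _ (countIn_mono _ i.2)]
  · intro z z' i hm h1 h2
    have hJJ : J z = J z' := congrArg Sigma.fst hm
    have e1 := hyO z
    have e2 := hyI z
    have e3 := hyO z'
    have e4 := hyI z'
    have f1 := (hO z).2.2.2
    have f2 := (hI z).2.2.2
    have g1 := hmemO z'
    have g2 := hmemI z'
    have g3 := hsumO z'
    have g4 := hsumI z'
    have hJlt : ∀ i : Fin B, i ∉ J z → countOut (J z) i < countOut (J z) B := by
      intro i hi
      have := hlenO (J z) z
      rw [← this]
      refine (List.getElem?_eq_some_iff.1 (getElem?_selectList (out (J z)) z i ?_)).1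
      simp [out, hi]
    have hJlt' : ∀ i : Fin B, i ∈ J z → countIn (J z) i < countIn (J z) B := by
      intro i hi
      have := hlenI (J z) z
      rw [← this]
      refine (List.getElem?_eq_some_iff.1 (getElem?_selectList (inn (J z)) z i ?_)).1
      simp [inn, hi]
    -- The types of the two chain classes depend on `J`, so the equality of the sets has to be
    -- eliminated before the components can be compared.
    have hsplit : ∀ (J₁ J₂ : Finset (Fin B)) (L₁ L₂ L₁' L₂' : List κ), J₁ = J₂ →
        (⟨J₁, mG _ L₁, mB _ L₂⟩ : MixedClass ι ι' B nb Tmax nb' Tmax') =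
          ⟨J₂, mG _ L₁', mB _ L₂'⟩ →
        mG (countOut J₁ B) L₁ = mG _ L₁' ∧ mB (countIn J₁ B) L₂ = mB _ L₂' := by
      rintro J₁ _ L₁ L₂ L₁' L₂' rfl h
      simpa only [Sigma.mk.injEq, heq_eq_eq, true_and, Prod.mk.injEq] using h
    replace hm := hsplit _ _ _ _ _ _ hJJ hm
    rw [← hJJ] at e3 e4 g1 g2 g3 g4 hm
    simp only [keyCell, m] at h1 h2
    by_cases hi : i ∈ J z
    · have hsel : inn (J z) i = true := by simp [inn, hi]
      rw [if_pos hi] at h1 h2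
      rw [add_assoc] at h2
      rw [e2, e4] at h1 h2
      have := f2 _ (hlenI (J z) z') g2 g4 hm.2 _ (hJlt' i hi) h1 h2
      have k1 := getElem?_selectList (inn (J z)) z i hsel
      have k2 := getElem?_selectList (inn (J z)) z' i hsel
      exact Option.some.inj (k1.symm.trans (this.trans k2))
    · have hsel : out (J z) i = true := by simp [out, hi]
      have hlt := hJlt i hi
      rw [if_neg hi] at h1 h2
      rw [e1 _ hlt.le, e3 _ hlt.le] at h1
      rw [e1 _ hlt, e3 _ hlt] at h2
      have := f1 _ (hlenO (J z) z') g1 g3 hm.1 _ hlt h1 h2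
      have k1 := getElem?_selectList (out (J z)) z i hsel
      have k2 := getElem?_selectList (out (J z)) z' i hsel
      exact Option.some.inj (k1.symm.trans (this.trans k2))

end MixedClass

end Mixed

theorem countIn_lt {B : ℕ} {J : Finset (Fin B)} {i : Fin B} (hi : i ∈ J) :
    countIn J i < countIn J B := by
  have h := getElem?_filter_countP (fun j => decide (j ∈ J)) (List.finRange B) i (by simp)
    (by simpa using hi)
  have h1 := (List.getElem?_eq_some_iff.1 h).1
  rwa [← List.countP_eq_length_filter, ← List.take_of_length_le (l := List.finRange B) (i := B)
    (by simp), List.take_take, min_eq_left i.2.le] at h1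

namespace MixedClass

variable {ι ι' : Type} {B nb Tmax nb' Tmax' : ℕ}

theorem keyCell_add_one_lt (m : MixedClass ι ι' B nb Tmax nb' Tmax') (i : Fin B) :
    m.keyCell i + 1 < B + 2 := by
  have h1 := countOut_add_countIn m.1 i.2.le
  have h2 := countOut_add_countIn m.1 (le_refl B)
  have h3 := i.2
  unfold keyCell
  split_ifs with h
  · have := countIn_lt h; omega
  · omega

/-- The exponents are `B` for the set `J`, `11B^2(B+1)` for the good blocks, `B^3` for the
components, `B(B+1)` for the bad blocks and `B^3` for each of the two totals. -/
theorem card_le_two_pow (hB : 100 ≤ B) (hnb : nb ≤ 2 ^ (11 * B ^ 2))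
    (hTmax : Tmax ≤ 2 ^ B ^ 3) (hTmax' : Tmax' ≤ 2 ^ B ^ 3) :
    Fintype.card (MixedClass (Component B) Unit B nb Tmax (B + 1) Tmax') ≤
      2 ^ (18 * B ^ 3) := by
  have hcard : Fintype.card (Component B) ≤ 2 ^ B ^ 2 := by
    have h : Fintype.card (Component B) = B * (B * 3) + 1 := by
      simp [Component, Fintype.card_option, Fintype.card_prod]
    rw [h]
    have h2 : 2 * (B ^ 2 / 2 + 1) ≤ 2 ^ (B ^ 2 / 2 + 1) := Nat.mul_le_pow (by norm_num) _
    have h3 : B ^ 2 / 2 + 1 ≤ B ^ 2 - 2 := by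
      have : 100 * 100 ≤ B ^ 2 := by nlinarith
      omega
    have h4 : (2 : ℕ) ^ 2 * 2 ^ (B ^ 2 - 2) = 2 ^ B ^ 2 := by
      rw [← pow_add]; congr 1
      have : 100 * 100 ≤ B ^ 2 := by nlinarith
      omega
    have h5 := Nat.pow_le_pow_right (n := 2) (by norm_num) h3
    have h6 : B * (B * 3) = 3 * B ^ 2 := by ring
    omega
  have hB1 : B + 1 ≤ 2 ^ B := Nat.lt_two_pow_self
  have hpow : ∀ {x y a b : ℕ}, 1 ≤ y → x ≤ y → a ≤ b → x ^ a ≤ y ^ b := fun h1 h2 h3 =>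
    (Nat.pow_le_pow_left h2 _).trans (Nat.pow_le_pow_right h1 h3)
  rw [card_eq_sum]
  calc _ ≤ ∑ _J : Finset (Fin B),
        ((2 ^ (11 * B ^ 2)) ^ (B + 1) * ((2 ^ B ^ 2) ^ B * 2 ^ B ^ 3)) *
        ((2 ^ B) ^ (B + 1) * (1 * 2 ^ B ^ 3)) := by
        refine Finset.sum_le_sum fun J _ => ?_
        have h := countOut_add_countIn J (le_refl B)
        refine Nat.mul_le_mul (Nat.mul_le_mul ?_ (Nat.mul_le_mul ?_ hTmax))
          (Nat.mul_le_mul ?_ (Nat.mul_le_mul ?_ hTmax'))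
        · exact hpow Nat.one_le_two_pow hnb (by omega)
        · exact hpow Nat.one_le_two_pow hcard (by omega)
        · exact hpow Nat.one_le_two_pow hB1 (by omega)
        · simp
    _ = 2 ^ (B + ((11 * B ^ 2 * (B + 1) + (B ^ 2 * B + B ^ 3)) + (B * (B + 1) + B ^ 3))) := by
        rw [Finset.sum_const, Finset.card_univ, Fintype.card_finset, Fintype.card_fin,
          smul_eq_mul, one_mul]
        simp only [← pow_mul, ← pow_add]
    _ ≤ _ := Nat.pow_le_pow_right (by norm_num) (by nlinarith)

end MixedClass

/-! ### Assembly. -/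

theorem exists_dataStructure_of_isProductApprox {n w l B σ Z H base : ℕ}
    {a g : ℕ → Component B → ℕ → ℕ} {SUM : Fin (2 ^ w + σ) → Fin (l + 1)}
    (hap : IsProductApprox w l B Z H base a g) (hdec : IsSumDecoder w l (2 ^ w + σ) SUM)
    (hB : 100 ≤ B) (hw : w = B ^ 3) (hwe : Even w) (hwl : w ≤ l) (hln : B * l ≤ n)
    (hσ : n * 2 ^ (w / 2) ≤ σ) (hσn : σ * n ≤ 2 ^ w) :
    ∃ D : DataStructure (Fin B → Fin (2 ^ w + σ)) (2 ^ w + 34 * B * σ) ((B - 1) * w),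
      (∀ i : Fin B, D.DecodesInTime w (2 * (18 + (2 * (18 + 5) + 4) + 2 * (18 + 5 + 4 + 2)))
        fun k => k i) ∧
      (∀ i : Fin B, D.DecodesInTime w (2 * (18 + (2 * (18 + 5) + 4) + 2 * (18 + 5 + 4 + 2)))
        (prefixSum SUM i)) ∧
      D.SpilloverDetermines (totalSum SUM) := by
  classical
  have hw1 : 1000000 ≤ w := by
    rw [hw]; exact (Nat.pow_le_pow_left hB 3).trans' (by norm_num)
  have hlB : l ≤ B * l := Nat.le_mul_of_pos_left _ (by omega)
  have hs1 : 1 ≤ 2 ^ (w / 2) := Nat.one_le_two_pow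
  have hnσ : n ≤ σ := (Nat.le_mul_of_pos_right _ hs1).trans hσ
  have hBn : 100 * l ≤ n := (Nat.mul_le_mul_right _ hB).trans hln
  have hσV : 25 * B * σ ≤ 2 ^ w := by
    refine le_trans ?_ hσn
    rw [mul_comm σ]
    refine Nat.mul_le_mul_right _ ?_
    nlinarith
  have hσV' : σ ≤ 2 ^ w := le_trans (Nat.le_mul_of_pos_left _ (by omega)) hσV
  have hZl : base + 2 * Z ≤ l := by have := hap.le_length; have := hap.one_le; omega
  have hBZ : B * (base + 2 * Z) ≤ n := (Nat.mul_le_mul_left _ hZl).trans hln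
  have hBZ' : 2 * Z * B + B * base ≤ n := by linarith
  obtain ⟨S, hS, hScard, hSc⟩ := hdec.exists_good hwl (by omega) hap.mass
  let sum : Fin (2 ^ w + σ) → ℕ := fun k => SUM k
  have hsum : ∀ k, sum k ≤ l := fun k => Nat.lt_succ_iff.1 (SUM k).2
  -- Good values are counted from `base`, so a step is at most `2Z`; bad values are at most `l`, so
  -- blocks of length `l + 1` give at most `B + 1` blocks.
  obtain ⟨m, y, hy, htot, hpre, hkey⟩ := MixedClass.exists_encoding (B := B)
    (nb := 2 * Z * B / H + 1) (Tmax := 2 * Z * B + 1) (nb' := B + 1) (Tmax' := B * l + 1)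
    (goodChain Z H a g) (badChain l Sᶜ sum) (Z := Z) (l := l) (base := base)
    (Nat.lt_succ_self _) (Nat.lt_succ_self _)
    (fun T hT => Nat.lt_succ_of_le (Nat.div_le_div_right (Nat.lt_succ_iff.1 hT)))
    (fun T hT => (Nat.div_lt_iff_lt_mul (Nat.succ_pos l)).2 (by
      have : (B + 1) * (l + 1) = B * l + B + l + 1 := by ring
      simp only [Nat.succ_eq_add_one]
      omega))
    S Sᶜ (fun k hk => Finset.mem_compl.2 hk) sum hsum hS
    (hap.card_le_cap S sum hS hScard) (fun c T' T h => card_le_cap_badChain Sᶜ sum hsum h)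
  set b : ℕ := σ + l + 4 with hb
  set Φ : ℕ := 2 ^ w + (l + 1) * 2 ^ (w / 2) with hΦ
  have hSreal : ∑ x : MixedClass (Component B) Unit B (2 * Z * B / H + 1) (2 * Z * B + 1) (B + 1)
      (B * l + 1), ∏ c ∈ Finset.range (B + 2),
        ((x.cell (goodChain Z H a g) (badChain l Sᶜ sum) c).card : ℝ) ≤
      (Φ : ℝ) ^ B + b * B * (Φ + 2 * (l + 1) * b) ^ (B - 1) := by
    have h1 := MixedClass.sum_prod_card_cell_le (B := B) (nb := 2 * Z * B / H + 1)
      (Tmax := 2 * Z * B + 1) (nb' := B + 1) (Tmax' := B * l + 1)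
      (goodChain Z H a g) (badChain l Sᶜ sum) (fun _ => Φ)
      (fun c => if c = 0 then b else 2 * (l + 1) * b)
      (fun c T' => hap.sum_cap_le c T' _)
      (fun c T' => (sum_cap_badChain_le Sᶜ sum c T' _).trans (by
        split_ifs
        · exact hSc
        · exact Nat.mul_le_mul_left _ hSc))
    have h2 := sum_weight_le (B := B) (Φ := Φ) (b := b) (ω := 2 * (l + 1) * b) (by omega)
      (by positivity) (by positivity) (by positivity)
    refine le_trans ?_ h2
    simp only [Finset.prod_const, Finset.card_range] at h1
    exact_mod_cast h1
  have hnum := weight_numeric (B := B) (l := l) (n := n) (σ := σ) (s := 2 ^ (w / 2))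
    (V := 2 ^ w) hB
    (by rw [← pow_mul, Nat.div_mul_cancel hwe.two_dvd])
    (by positivity) (by exact_mod_cast hw ▸ hwl) (by exact_mod_cast hln) (by exact_mod_cast hσ)
    (by exact_mod_cast hσn)
  have hnum' : ((Φ : ℝ) ^ B + b * B * (Φ + 2 * (l + 1) * b) ^ (B - 1)) *
      (1 + 4 / 2 ^ w) ^ (B + 2) ≤ (2 ^ w) ^ (B - 1) * (2 ^ w + 25 * B * σ) := by
    rw [hΦ, hb]; push_cast; exact hnum
  have hcell : ∀ (x : MixedClass (Component B) Unit B (2 * Z * B / H + 1) (2 * Z * B + 1) (B + 1)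
      (B * l + 1)) c,
      (x.cell (goodChain Z H a g) (badChain l Sᶜ sum) c).card ≤ 2 ^ (4 * w) := by
    intro x c
    have hW : 1 ≤ 2 ^ (w + 2) := Nat.one_le_two_pow
    -- A cell holds a prefix sum and two numbers of at most `w + 2` bits, together at most `3w + 5`
    -- bits; hence `q = 4`.
    have hT : ∀ T, T ≤ n + 1 → T * (2 ^ (w + 2) * 2 ^ (w + 2)) ≤ 2 ^ (4 * w) := by
      intro T hT
      have h1 : T ≤ 2 ^ (w + 1) := by rw [pow_succ]; omega
      calc T * (2 ^ (w + 2) * 2 ^ (w + 2)) ≤ 2 ^ (w + 1) * (2 ^ (w + 2) * 2 ^ (w + 2)) :=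
            Nat.mul_le_mul_right _ h1
        _ = 2 ^ (3 * w + 5) := by rw [← pow_add, ← pow_add]; congr 1; ring
        _ ≤ _ := Nat.pow_le_pow_right (by norm_num) (by omega)
    unfold MixedClass.cell
    split_ifs
    · refine (Chain.card_cell_le hW ?_ ?_ _ _).trans (hT _ (by omega))
      · intro c β' β j T
        simp only [goodChain]
        split_ifs
        · exact hap.le_a _ _ _
        · exact Nat.zero_le _
      · intro c β' β j T
        exact hap.le_g _ _ _
    · have hcard : (Sᶜ).card ≤ 2 ^ (w + 2) := by
        refine (Finset.card_le_univ _).trans ?_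
        rw [Fintype.card_fin, pow_add]; omega
      refine (Chain.card_cell_le hW ?_ ?_ _ _).trans (hT _ (by omega))
      · intro c β' β j T
        simp only [badChain]
        split_ifs
        · exact (Finset.card_filter_le _ _).trans hcard
        · exact hcard
        · exact Nat.zero_le _
      · intro c β' β j T
        exact hW
  have hM : Fintype.card (MixedClass (Component B) Unit B (2 * Z * B / H + 1) (2 * Z * B + 1)
      (B + 1) (B * l + 1)) ≤ 2 ^ (18 * w) := by
    rw [hw]
    have hn1 : n + 1 ≤ 2 ^ B ^ 3 := by
      rw [← hw]; refine le_trans ?_ hσV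
      nlinarith
    exact MixedClass.card_le_two_pow hB hap.blocks (by omega) (by omega)
  have hV : (1 : ℝ) ≤ 2 ^ w := one_le_pow₀ (by norm_num)
  have hσVr : 25 * (B : ℝ) * σ ≤ 2 ^ w := by exact_mod_cast hσV
  have htau : ∀ x : MixedClass (Component B) Unit B (2 * Z * B / H + 1) (2 * Z * B + 1)
      (B + 1) (B * l + 1), x.total base < (2 * Z * B + 1) + B * base + (B * l + 1) := by
    intro x
    have h1 := x.2.1.2.2.2
    have h2 := x.2.2.2.2.2
    have h3 : countOut x.1 B * base ≤ B * base := Nat.mul_le_mul_right _ (by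
      have := countOut_add_countIn x.1 (le_refl B); omega)
    unfold MixedClass.total
    omega
  have hspace : ((Φ : ℝ) ^ B + b * B * (Φ + 2 * (l + 1) * b) ^ (B - 1)) *
      (1 + 4 / 2 ^ w) ^ (B + 2) ≤ 2 ^ ((B + 2) * w) := by
    refine hnum'.trans ?_
    have h1 : (2 : ℝ) ^ w + 25 * B * σ ≤ (2 ^ w) ^ 3 := by
      refine (add_le_add_right hσVr _).trans ?_
      have h2 : (2 : ℝ) ≤ 2 ^ w := by
        calc (2 : ℝ) = 2 ^ 1 := (pow_one _).symm
          _ ≤ _ := pow_le_pow_right₀ (by norm_num) (by omega)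
      nlinarith [mul_le_mul h2 hV (by norm_num) (by positivity)]
    calc _ ≤ ((2 : ℝ) ^ w) ^ (B - 1) * (2 ^ w) ^ 3 :=
          mul_le_mul_of_nonneg_left h1 (by positivity)
      _ = _ := by rw [← pow_add, ← pow_mul]; congr 1; rw [mul_comm]; congr 1; omega
  -- The constant `34` is `25 + 9`: the weight with the packing losses takes `25 * B * σ`, and `9 *
  -- B * σ` generously covers the range of the total sum that is added to the spillover, as well as
  -- the one unit for the classes.
  have hspill : (((2 * Z * B + 1) + B * base + (B * l + 1) : ℕ) : ℝ) + 1 +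
      (Fintype.card (MixedClass (Component B) Unit B (2 * Z * B / H + 1) (2 * Z * B + 1)
        (B + 1) (B * l + 1)) +
        ((Φ : ℝ) ^ B + b * B * (Φ + 2 * (l + 1) * b) ^ (B - 1)) *
          (1 + 4 / 2 ^ w) ^ (B + 2) / 2 ^ ((B - 1 - 18) * w)) / 2 ^ (18 * w) ≤
      ((2 ^ w + 34 * B * σ : ℕ) : ℝ) := by
    have h1 : (2 : ℝ) ^ ((B - 1 - 18) * w) * 2 ^ (18 * w) = (2 ^ w) ^ (B - 1) := by
      rw [← pow_add, ← pow_mul, ← add_mul, mul_comm w]; congr 2; omega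
    have h2 : (Fintype.card (MixedClass (Component B) Unit B (2 * Z * B / H + 1)
        (2 * Z * B + 1) (B + 1) (B * l + 1)) : ℝ) / 2 ^ (18 * w) ≤ 1 := by
      rw [div_le_one (by positivity)]; exact_mod_cast hM
    have h3 : ((Φ : ℝ) ^ B + b * B * (Φ + 2 * (l + 1) * b) ^ (B - 1)) *
        (1 + 4 / 2 ^ w) ^ (B + 2) / 2 ^ ((B - 1 - 18) * w) / 2 ^ (18 * w) ≤
        2 ^ w + 25 * B * σ := by
      rw [div_div, h1, div_le_iff₀ (by positivity)]
      exact hnum'.trans_eq (mul_comm _ _)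
    have h4 : (2 * Z * B + 1) + B * base + (B * l + 1) + 2 ≤ 9 * B * σ := by
      have : 900 * σ ≤ 9 * B * σ := Nat.mul_le_mul_right _ (by omega)
      omega
    have h5 : (((2 * Z * B + 1) + B * base + (B * l + 1) : ℕ) : ℝ) + 2 ≤ 9 * B * σ := by
      exact_mod_cast h4
    have h6 : ((2 ^ w + 34 * B * σ : ℕ) : ℝ) = 2 ^ w + 25 * B * σ + 9 * B * σ := by
      push_cast; ring
    rw [add_div, h6]
    linarith
  obtain ⟨D, hD, hDs⟩ := exists_dataStructure_of_cells (Z := Fin B → Fin (2 ^ w + σ))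
    (w := w) (B := B) (C := B + 2) (q := 4) (t := 18) (by omega) (by omega) _ hcell m y hy
    (MixedClass.total base) htau hSreal hspace hspill
  refine ⟨D, fun i => ?_, fun i => ?_, ?_⟩
  · exact hD _ (fun z => z i) (fun x => x.keyCell i) (fun x => x.keyCell i + 1)
      (fun x => (Nat.lt_succ_self _).trans (x.keyCell_add_one_lt i))
      (fun x => x.keyCell_add_one_lt i) (fun z z' => hkey z z' i)
  -- A prefix sum also needs just two cells: the last good and the last bad prefix sum before the
  -- position. The class tells where they are and how often `base` has to be added.
  · refine hD _ (prefixSum SUM i) (fun x => countOut x.1 (i + 1))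
      (fun x => countOut x.1 B + 1 + countIn x.1 (i + 1)) (fun x => ?_) (fun x => ?_)
      (fun z z' hm h1 h2 => ?_)
    · have := countOut_add_countIn x.1 (i := i + 1) i.2; omega
    · have := countOut_add_countIn x.1 (le_refl B)
      have := countIn_mono x.1 (i := i + 1) i.2
      omega
    · have e1 := hpre z i
      have e2 := hpre z' i
      rw [h1, h2, hm, ← e2] at e1
      exact e1
  · obtain ⟨f, hf⟩ := hDs
    exact ⟨f, fun z => (hf z).trans (htot z)⟩

end Spillover

theorem mainTheorem3 :
    ∃ c n₀ : ℕ, ∀ n w B l σ : ℕ, n₀ ≤ n →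
      w = B ^ 3 → Even w →
      w ≤ l → Even l → B * l ≤ n →
      n * 2 ^ (w / 2) ≤ σ → σ * n ≤ 2 ^ w →
      ∀ SUM : Fin (2 ^ w + σ) → Fin (l + 1), Spillover.IsSumDecoder w l (2 ^ w + σ) SUM →
        ∃ D : Spillover.DataStructure (Fin B → Fin (2 ^ w + σ))
            (2 ^ w + 34 * B * σ) ((B - 1) * w),
          (∀ i : Fin B, D.DecodesInTime w c (fun k => k i)) ∧
          (∀ i : Fin B, D.DecodesInTime w c (Spillover.prefixSum SUM i)) ∧
          D.SpilloverDetermines (Spillover.totalSum SUM) := by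
  -- The hypotheses on `σ` force `n ≤ 2^w`, so a large `n` makes `w`, and with it `B`, large.
  obtain ⟨n₀, hn₀⟩ : ∃ n₀ : ℕ, ∀ w, n₀ ≤ 2 ^ w → 100 ^ 3 ≤ w :=
    ⟨2 ^ 100 ^ 3, fun w h => (Nat.pow_le_pow_iff_right one_lt_two).1 h⟩
  refine ⟨2 * (18 + (2 * (18 + 5) + 4) + 2 * (18 + 5 + 4 + 2)), n₀,
    fun n w B l σ hn hw hwe hwl hle hln hσ hσn SUM hdec => ?_⟩
  have hnw : n ≤ 2 ^ w := by
    rcases Nat.eq_zero_or_pos n with rfl | hpos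
    · exact Nat.zero_le _
    · refine le_trans (Nat.le_mul_of_pos_left _ ?_) hσn
      exact lt_of_lt_of_le (Nat.mul_pos hpos (Nat.two_pow_pos _)) hσ
  have hB : 100 ≤ B := by
    have := hn₀ w (hn.trans hnw)
    rw [hw] at this
    exact le_of_pow_le_pow_left₀ three_ne_zero (Nat.zero_le _) this
  obtain ⟨Z, H, base, a, g, hap⟩ :=
    Spillover.exists_isProductApprox hw hwe hle ((by norm_num : 10 ≤ 100).trans hB)
  exact Spillover.exists_dataStructure_of_isProductApprox hap hdec hB hw hwe hwl hln hσ hσn
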